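/- Let $T$ be the torus with one boundary component (the torus $(\mathbb{R}/\mathbb{Z})^2$ with an open disc removed), let $h\colon T\to T$ be a homeomorphism that fixes $\partial T$ pointwise, and let $$M=\frac{T\times[0,1]}{(x,1)\sim(h(x),0)}$$ be the punctured torus bundle with monodromy $h$. Let $x\in\partial T$, and let $h_+$ be the automorphism that $h$ induces on $H_1(T;\mathbb{Z})=\pi_1(T,x)^{\mathrm{ab}}\cong\mathbb{Z}^2$. Suppose that $M$ is hyperbolic, i.e. the interior of $M$ is homeomorphic to a quotient $\mathbb{H}^3/\Gamma$ by a group $\Gamma$ of orientation-preserving isometries acting freely and properly discontinuously, and that $M$ is untwisted, i.e. all real eigenvalues of $h_+$ are positive. Write $\pi_1(M)$ for the fundamental group of $M$ based at $[(x,0)]$, let $G\le\pi_1(M)$ be the fiber group, that is, the image of $\pi_1(T,x)$ under the inclusion $y\mapsto[(y,0)]$, and let $G_1=G$, $G_{n+1}=[G_n,G]$ be its lower central series. A bi-ordering of a group is a strict total order invariant under left and right multiplication; a subgroup $C$ is convex if $a<g<b$ with $a,b\in C$ implies $g\in C$; a positive cone of a group $A$ is a conjugation-invariant subset $P$ with $PP\subseteq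 P$ and $A=P\sqcup P^{-1}\sqcup\{1\}$. A bi-ordering of $G$ is standard if there are positive cones $P_n$ of the groups $G_n/G_{n+1}$, $n\ge 1$, such that $g\in G$ is positive if and only if, for some $n$, $g\in G_n\setminus G_{n+1}$ and the class of $g$ in $G_n/G_{n+1}$ lies in $P_n$. Then $\pi_1(M)$ admits a non-standard bi-ordering, that is, a bi-ordering whose restriction to $G$ is not standard; moreover, it can be chosen so that $G_3=[[G,G],G]$ is not convex in $G$ with respect to this restriction. -/

import Mathlib

open scoped ComplexOrder TensorProduct MatrixGroups

/-! ### Bi-orders, convex subgroups, standard bi-orders -/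

/-- A strict total order on a group, invariant under left and right multiplication. -/
structure IsBiOrder {G : Type*} [Group G] (lt : G → G → Prop) : Prop where
  strictTotal : IsStrictTotalOrder G lt
  mul_left : ∀ a b c : G, lt a b → lt (c * a) (c * b)
  mul_right : ∀ a b c : G, lt a b → lt (a * c) (b * c)

/-- A subgroup is convex if it contains everything that lies between two of its elements. -/
def IsConvexSubgroup {G : Type*} [Group G] (lt : G → G → Prop) (C : Subgroup G) : Prop :=
  ∀ a ∈ C, ∀ b ∈ C, ∀ g : G, lt a g → lt g b → g ∈ C

/-- A conjugation invariant positive cone: `P * P ⊆ P`, the group is the disjoint union of `P`,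
`P⁻¹` and `{1}`, and `P` is invariant under conjugation. -/
structure IsPositiveCone {G : Type*} [Group G] (P : Set G) : Prop where
  mul_mem : ∀ a ∈ P, ∀ b ∈ P, a * b ∈ P
  one_notMem : (1 : G) ∉ P
  inv_notMem : ∀ a ∈ P, a⁻¹ ∉ P
  total : ∀ a : G, a ∈ P ∨ a⁻¹ ∈ P ∨ a = 1
  conj_mem : ∀ a ∈ P, ∀ g : G, g⁻¹ * a * g ∈ P

/-- The terms `G₁ = G`, `Gₙ₊₁ = [Gₙ, G]` of the lower central series; the index starts at `0`
here, so that `lcs G n` is `Gₙ₊₁`. -/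
abbrev lcs (G : Type*) [Group G] (n : ℕ) : Subgroup G :=
  (⊤ : Subgroup G).lowerCentralSeries n

/-- The lower central series quotients: `lcsQuotient G n` is `Gₙ₊₁ / Gₙ₊₂`. -/
abbrev lcsQuotient (G : Type*) [Group G] (n : ℕ) : Type _ :=
  lcs G n ⧸ (lcs G (n + 1)).subgroupOf (lcs G n)

/-- A bi-order is standard if it comes from positive cones on the lower central series quotients:
`g` is positive iff the class of `g` in the quotient `Gₙ / Gₙ₊₁` with `g ∈ Gₙ`, `g ∉ Gₙ₊₁` lies in
the chosen cone of that quotient. -/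
def IsStandardBiOrder {G : Type*} [Group G] (lt : G → G → Prop) : Prop :=
  IsBiOrder lt ∧ ∃ P : ∀ n : ℕ, Set (lcsQuotient G n), (∀ n, IsPositiveCone (P n)) ∧
    ∀ g : G, lt 1 g ↔ ∃ n : ℕ, ∃ hg : g ∈ lcs G n,
      g ∉ lcs G (n + 1) ∧ (QuotientGroup.mk (⟨g, hg⟩ : lcs G n) : lcsQuotient G n) ∈ P n

/-- The restriction of a relation on a group to a subgroup. -/
def restrictOrder {G : Type*} [Group G] (lt : G → G → Prop) (H : Subgroup G) : H → H → Prop :=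
  fun a b => lt (a : G) (b : G)

/-! ### The torus with one boundary component and its mapping tori -/

/-- The torus `(ℝ/ℤ)²` with the open square `{‖x‖ > 1/4, ‖y‖ > 1/4}` removed, where `‖x‖` is the
distance of `x` to `0` in `ℝ/ℤ`; the square is an open disc centred at `(1/2, 1/2)`. -/
abbrev PuncturedTorus : Type :=
  {p : UnitAddCircle × UnitAddCircle // min ‖p.1‖ ‖p.2‖ ≤ 1 / 4}

/-- The boundary circle of the punctured torus. -/
def PuncturedTorus.boundary : Set PuncturedTorus :=
  {p | min ‖p.1.1‖ ‖p.1.2‖ = 1 / 4}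

/-- A homeomorphism of the punctured torus that fixes the boundary pointwise. -/
structure Monodromy where
  toHomeomorph : PuncturedTorus ≃ₜ PuncturedTorus
  fixes_boundary : ∀ p ∈ PuncturedTorus.boundary, toHomeomorph p = p

/-- The identification `(x, 1) ∼ (h x, 0)` on `T × [0,1]`. -/
inductive BundleRel (h : Monodromy) :
    PuncturedTorus × unitInterval → PuncturedTorus × unitInterval → Prop
  | glue (x : PuncturedTorus) : BundleRel h (x, 1) (h.toHomeomorph x, 0)

/-- The punctured torus bundle over the circle with monodromy `h`, with the quotient topology. -/
abbrev PuncturedTorusBundle (h : Monodromy) : Type := Quot (BundleRel h)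

/-- The inclusion `x ↦ [(x, 0)]` of the fiber. -/
def fiberInclusion (h : Monodromy) : C(PuncturedTorus, PuncturedTorusBundle h) where
  toFun x := Quot.mk _ (x, 0)
  continuous_toFun := continuous_quot_mk.comp (by fun_prop)

/-- The fiber group `G`: the image of `π₁(T, x)` in `π₁(M, [(x, 0)])`. -/
noncomputable def fiberGroup (h : Monodromy) (x : PuncturedTorus) :
    Subgroup (FundamentalGroup (PuncturedTorusBundle h) (fiberInclusion h x)) :=
  (FundamentalGroup.map (fiberInclusion h) x).range

/-- The interior of the 3-manifold: the classes of `(x, t)` with `x` not on the boundary of `T`. -/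
abbrev BundleInterior (h : Monodromy) : Type :=
  {m : PuncturedTorusBundle h //
    ∃ p : PuncturedTorus × unitInterval, p.1 ∉ PuncturedTorus.boundary ∧ Quot.mk _ p = m}

/-- The automorphism `h_*` of `π₁(T, x)`, for a base point `x` on the boundary. -/
noncomputable def monodromyOnPi1 (h : Monodromy) (x : PuncturedTorus) (hx : x ∈ PuncturedTorus.boundary) :
    FundamentalGroup PuncturedTorus x →* FundamentalGroup PuncturedTorus x :=
  FundamentalGroup.mapOfEq (h.toHomeomorph : C(PuncturedTorus, PuncturedTorus))
    (h.fixes_boundary x hx)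

/-- The map `h_+` on `H₁(T; ℤ)`, the abelianization of `π₁(T, x)`. -/
noncomputable def monodromyOnH1 (h : Monodromy) (x : PuncturedTorus) (hx : x ∈ PuncturedTorus.boundary) :
    Additive (Abelianization (FundamentalGroup PuncturedTorus x)) →ₗ[ℤ]
      Additive (Abelianization (FundamentalGroup PuncturedTorus x)) :=
  (MonoidHom.toAdditive (Abelianization.map (monodromyOnPi1 h x hx))).toIntLinearMap

/-- The bundle is untwisted if `h_+` has no real eigenvalue that is not positive. (If the bundle is
hyperbolic, then `h_+` has two real eigenvalues of the same sign; the bundle is untwisted if they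
are positive, and twisted if they are negative.) -/
def IsUntwisted (h : Monodromy) (x : PuncturedTorus) (hx : x ∈ PuncturedTorus.boundary) : Prop :=
  ∀ μ : ℝ, Module.End.HasEigenvalue ((monodromyOnH1 h x hx).baseChange ℝ) μ → 0 < μ

/-! ### Hyperbolic 3-manifolds -/

/-- Hyperbolic 3-space: positive definite Hermitian `2 × 2` matrices of determinant one, the
hyperboloid `det = 1` in the Minkowski space of Hermitian matrices. -/
abbrev HyperbolicThreeSpace : Type :=
  {X : Matrix (Fin 2) (Fin 2) ℂ // X.PosDef ∧ X.det = 1}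

/-- `SL(2, ℂ)` acts by `g • X = g X gᴴ`; this identifies `PSL(2, ℂ)` with the group of orientation
preserving isometries of hyperbolic space. -/
instance : MulAction SL(2, ℂ) HyperbolicThreeSpace where
  smul g X := ⟨(g : Matrix (Fin 2) (Fin 2) ℂ) * X.1 * (g : Matrix (Fin 2) (Fin 2) ℂ).conjTranspose,
    X.2.1.mul_mul_conjTranspose_same (Matrix.vecMul_injective_of_isUnit
      ((Matrix.isUnit_iff_isUnit_det _).2 (by simp))),
    by simp [Matrix.det_conjTranspose, X.2.2]⟩
  one_smul X := Subtype.ext (by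
    change (1 : Matrix (Fin 2) (Fin 2) ℂ) * X.1 * (1 : Matrix (Fin 2) (Fin 2) ℂ).conjTranspose = X.1
    simp)
  mul_smul g k X := Subtype.ext (by
    change ((g * k : SL(2, ℂ)) : Matrix (Fin 2) (Fin 2) ℂ) * X.1 *
        ((g * k : SL(2, ℂ)) : Matrix (Fin 2) (Fin 2) ℂ).conjTranspose =
      (g : Matrix (Fin 2) (Fin 2) ℂ) * ((k : Matrix (Fin 2) (Fin 2) ℂ) * X.1 *
        (k : Matrix (Fin 2) (Fin 2) ℂ).conjTranspose) *
        (g : Matrix (Fin 2) (Fin 2) ℂ).conjTranspose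
    simp [Matrix.conjTranspose_mul, Matrix.mul_assoc])

/-- The bundle is hyperbolic if its interior carries a complete hyperbolic structure, that is, is
homeomorphic to a quotient of hyperbolic space by a group of orientation preserving isometries
acting freely and properly discontinuously. The group is given by a subgroup `Γ` of `SL(2, ℂ)`, in
which `-1`, if present, acts trivially. -/
def IsHyperbolicBundle (h : Monodromy) : Prop :=
  ∃ Γ : Subgroup SL(2, ℂ), ProperlyDiscontinuousSMul Γ HyperbolicThreeSpace ∧
    (∀ γ ∈ Γ, ∀ X : HyperbolicThreeSpace, γ • X = X → γ = 1 ∨ γ = -1) ∧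
    Nonempty (BundleInterior h ≃ₜ Quotient (MulAction.orbitRel Γ HyperbolicThreeSpace))

/-! The fiber group is free of rank two, and the fundamental group of the bundle is an extension of
the integers by it in which a generator acts as the automorphism φ induced by h. A bi-order of the
free group preserved by φ extends to the bundle group: compare images in the integers first. So it
suffices to find a φ-invariant bi-order with 1 < c < w, where c is the commutator of the generators,
outside the third lower central term, and w is inside it. Convexity then fails, and so does
standardness, since a standard order decides the sign of c modulo the third term
(`not_isStandardBiOrder_of_lt`).

Let φ act on the abelianization with determinant 1 and trace at least 3. A left eigenvector gives l
: F2 → ℝ with l ∘ φ = x l and x > 0, and the order compares by l first. On the kernel of l it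
compares by the sign of the leading coefficient of the Fox derivative with respect to a, pushed to
Hahn series by l. Conjugation multiplies this derivative by a monomial. As φ(c) is conjugate to c,
applying φ scales the exponents by x and multiplies by a fixed quotient of series with positive
leading coefficients (`fox_map`). Remaining ties are broken by an invariant order from the powers of
the augmentation ideal, whose successive quotients are spanned by products of eigenvectors with
positive eigenvalues (`exists_invariant_positiveCone`). The powers detect every nontrivial element
because of a faithful unipotent representation over a polynomial ring. Both c and c⁻¹w have Fox
derivatives with leading coefficient 1.

That φ(c) is conjugate to c for determinant 1 follows by Nielsen reduction: φ is a product of inner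
automorphisms and two twists fixing c (`mem_twistGroup_of_det_eq_one`).

Untwistedness yields determinant 1 and trace at least -1. Hyperbolicity makes commuting transitive
on nontrivial elements, because nonscalar 2 × 2 matrices have commutative centralizers. Trace -1, 0
or 1 would make a power of φ inner, so that an element outside the fiber group centralizes it; trace
2 would make φ a twist up to conjugacy and inner automorphisms. Both contradict transitivity
(`F2.three_le_trace`). This uses that an automorphism trivial on the abelianization is inner
(`exists_eq_conj`), which a normal form for the modular group provides.

The topological input is a free fundamental group from an open cover of the punctured torus, the
infinite cyclic cover T × ℝ, and a push of the bundle into its interior, where the hyperbolic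
structure lives. -/

/-! ### Orders on vector spaces preserved by a diagonalizable map with positive eigenvalues -/

/-- If `V / U` is spanned by eigenvectors of `f` with positive eigenvalues, then `V / U` carries
a positive cone preserved by `f`; it is given by its preimage `C` in `V`. -/
theorem exists_cone_of_span_eigenvectors {A : Type*} [AddCommGroup A] [Module ℝ A]
    (U V : Submodule ℝ A) (f : A →ₗ[ℝ] A) (hfU : ∀ u ∈ U, f u ∈ U) (hUV : U ≤ V)
    (hV : V ≤ Submodule.span ℝ {v | v ∈ V ∧ ∃ c : ℝ, 0 < c ∧ f v - c • v ∈ U} ⊔ U) :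
    ∃ C : Set A, (∀ x ∈ C, x ∈ V) ∧ (∀ x ∈ C, x ∉ U) ∧ (∀ x ∈ C, ∀ y ∈ C, x + y ∈ C) ∧
      (∀ x ∈ C, ∀ u ∈ U, x + u ∈ C) ∧ (∀ x ∈ V, x ∉ U → x ∈ C ∨ -x ∈ C) ∧
      ∀ x ∈ C, f x ∈ C := by
  classical
  set E : Set A := {v | v ∈ V ∧ ∃ c : ℝ, 0 < c ∧ f v - c • v ∈ U} with hE
  obtain ⟨b, hbE, hbspan, hbli⟩ := exists_linearIndependent ℝ (U.mkQ '' E)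
  have hb : LinearIndepOn ℝ id b := hbli
  -- The eigenvectors in `b` span the image of `V`. Coordinates are compared lexicographically: on
  -- the image of `V` the map multiplies each one by a positive number, so the first nonzero
  -- coordinate keeps its sign.
  let B := Module.Basis.extend hb
  let _ : LinearOrder (hb.extend (Set.subset_univ b)) := linearOrderOfSTO WellOrderingRel
  let F : (A ⧸ U) →ₗ[ℝ] (A ⧸ U) := U.mapQ U f hfU
  have hVspan : ∀ x ∈ V, U.mkQ x ∈ Submodule.span ℝ b := by
    intro x hx
    obtain ⟨y, hy, u, hu, rfl⟩ := Submodule.mem_sup.1 (hV hx)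
    have hu0 : U.mkQ u = 0 := by simpa using hu
    rw [map_add, hu0, add_zero, hbspan, Submodule.span_image]
    exact Submodule.mem_map_of_mem hy
  have heig : ∀ i : hb.extend (Set.subset_univ b), ∃ c : ℝ, 0 < c ∧
      ((i : A ⧸ U) ∈ b → F i = c • (i : A ⧸ U)) := by
    intro i
    by_cases hi : (i : A ⧸ U) ∈ b
    · obtain ⟨v, ⟨-, c, hc, hv⟩, hvi⟩ := hbE hi
      refine ⟨c, hc, fun _ => ?_⟩
      rw [← hvi]
      have : U.mkQ (f v - c • v) = 0 := (Submodule.Quotient.mk_eq_zero U).2 hv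
      rw [map_sub, map_smul, sub_eq_zero] at this
      simpa [F] using this
    -- A dummy factor for the vectors that only complete the basis; elements of `V` have no
    -- coordinates along them.
    · exact ⟨1, one_pos, fun h => absurd h hi⟩
  choose c hc0 hc using heig
  have hF : ∀ q ∈ Submodule.span ℝ b, ∀ i, B.repr (F q) i = c i * B.repr q i := by
    intro q hq
    induction hq using Submodule.span_induction with
    | mem x hx =>
      intro i
      let j : hb.extend (Set.subset_univ b) := ⟨x, hb.subset_extend _ hx⟩
      have hj : F x = c j • x := hc j hx
      have hBj : B j = x := Module.Basis.extend_apply_self hb j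
      rw [hj, map_smul, ← hBj, Module.Basis.repr_self, Finsupp.smul_apply, smul_eq_mul,
        Finsupp.single_apply]
      split_ifs with h
      · rw [h]
      · simp
    | zero => simp
    | add x y _ _ hx hy => intro i; simp [hx i, hy i, mul_add]
    | smul r x _ hx => intro i; simp only [map_smul, Finsupp.smul_apply, hx i, smul_eq_mul]; ring
  let L : A →+ Lex (hb.extend (Set.subset_univ b) →₀ ℝ) :=
    { toFun := fun x => toLex (B.repr (U.mkQ x))
      map_zero' := by simp
      map_add' := fun x y => by simp }
  have hL0 : ∀ x, L x = 0 ↔ x ∈ U := by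
    intro x
    change toLex (B.repr (U.mkQ x)) = 0 ↔ _
    rw [toLex_eq_zero, map_eq_zero_iff _ B.repr.injective]
    simp
  refine ⟨{x | x ∈ V ∧ 0 < L x}, fun x hx => hx.1, fun x hx h => ?_, ?_, ?_, ?_, ?_⟩
  · exact hx.2.ne' ((hL0 x).2 h)
  · rintro x ⟨hx, hx'⟩ y ⟨hy, hy'⟩
    exact ⟨V.add_mem hx hy, by rw [map_add]; exact add_pos hx' hy'⟩
  · rintro x ⟨hx, hx'⟩ u hu
    exact ⟨V.add_mem hx (hUV hu), by rwa [map_add, (hL0 u).2 hu, add_zero]⟩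
  · intro x hx hxU
    rcases lt_trichotomy 0 (L x) with h | h | h
    · exact Or.inl ⟨hx, h⟩
    · exact absurd ((hL0 x).1 h.symm) hxU
    · exact Or.inr ⟨V.neg_mem hx, by rw [map_neg]; exact neg_pos.2 h⟩
  · rintro x ⟨hx, hx'⟩
    refine ⟨?_, ?_⟩
    · have hle : Submodule.span ℝ E ⊔ U ≤ V.comap f := by
        refine sup_le (Submodule.span_le.2 ?_) fun u hu => hUV (hfU u hu)
        rintro v ⟨hv, r, -, hr⟩
        have := V.add_mem (hUV hr) (V.smul_mem r hv)
        simpa using this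
      exact hle (hV hx)
    · rw [Finsupp.Lex.lt_iff] at hx' ⊢
      obtain ⟨i, hi, hi'⟩ := hx'
      have key : ∀ j, B.repr (U.mkQ (f x)) j = c j * B.repr (U.mkQ x) j :=
        fun j => hF _ (hVspan x hx) j
      refine ⟨i, fun j hj => ?_, ?_⟩
      · have h1 : (0 : ℝ) = B.repr (U.mkQ x) j := hi j hj
        change (0 : ℝ) = B.repr (U.mkQ (f x)) j
        rw [key, ← h1, mul_zero]
      · have h1 : (0 : ℝ) < B.repr (U.mkQ x) i := hi'
        change (0 : ℝ) < B.repr (U.mkQ (f x)) i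
        rw [key]
        exact mul_pos (hc0 i) h1

/-! ### The filtration of a group by powers of the augmentation ideal -/

section Augmentation

variable (G : Type*) [Group G]

/-- The augmentation ideal of the real group algebra, as a subspace. -/
noncomputable def augmentation : Submodule ℝ (MonoidAlgebra ℝ G) :=
  Submodule.span ℝ (Set.range fun g : G => MonoidAlgebra.of ℝ G g - 1)

variable {G}

theorem of_sub_one_mem_augmentation (g : G) : MonoidAlgebra.of ℝ G g - 1 ∈ augmentation G :=
  Submodule.subset_span ⟨g, rfl⟩

theorem augmentation_mul_le : augmentation G * augmentation G ≤ augmentation G := by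
  rw [augmentation, Submodule.span_mul_span, Submodule.span_le]
  rintro _ ⟨_, ⟨g, rfl⟩, _, ⟨h, rfl⟩, rfl⟩
  have : (MonoidAlgebra.of ℝ G g - 1) * (MonoidAlgebra.of ℝ G h - 1) =
      (MonoidAlgebra.of ℝ G (g * h) - 1) - (MonoidAlgebra.of ℝ G g - 1) -
        (MonoidAlgebra.of ℝ G h - 1) := by rw [map_mul]; noncomm_ring
  change (MonoidAlgebra.of ℝ G g - 1) * (MonoidAlgebra.of ℝ G h - 1) ∈ augmentation G
  rw [this]
  exact Submodule.sub_mem _ (Submodule.sub_mem _ (of_sub_one_mem_augmentation _)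
    (of_sub_one_mem_augmentation _)) (of_sub_one_mem_augmentation _)

/-- Exponents start at 1 throughout: the zeroth power is the line of scalars, so the chain decreases
only from the first power on. -/
theorem augmentation_pow_succ_le (n : ℕ) : augmentation G ^ (n + 2) ≤ augmentation G ^ (n + 1) := by
  induction n with
  | zero => simpa [pow_two] using augmentation_mul_le
  | succ n ih =>
    rw [pow_succ _ (n + 2), pow_succ _ (n + 1)]
    exact mul_le_mul' ih le_rfl

theorem augmentation_pow_le {m n : ℕ} (h : m ≤ n) :
    augmentation G ^ (n + 1) ≤ augmentation G ^ (m + 1) := by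
  induction n, h using Nat.le_induction with
  | base => rfl
  | succ n _ ih => exact (augmentation_pow_succ_le n).trans ih

theorem of_mul_sub_mem {n : ℕ} {x : MonoidAlgebra ℝ G} (hx : x ∈ augmentation G ^ (n + 1)) (h : G) :
    MonoidAlgebra.of ℝ G h * x - x ∈ augmentation G ^ (n + 2) := by
  have : MonoidAlgebra.of ℝ G h * x - x = (MonoidAlgebra.of ℝ G h - 1) * x := by noncomm_ring
  rw [this, pow_succ']
  exact Submodule.mul_mem_mul (of_sub_one_mem_augmentation h) hx

theorem mul_of_sub_mem {n : ℕ} {x : MonoidAlgebra ℝ G} (hx : x ∈ augmentation G ^ (n + 1)) (h : G) :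
    x * MonoidAlgebra.of ℝ G h - x ∈ augmentation G ^ (n + 2) := by
  have : x * MonoidAlgebra.of ℝ G h - x = x * (MonoidAlgebra.of ℝ G h - 1) := by noncomm_ring
  rw [this, pow_succ]
  exact Submodule.mul_mem_mul hx (of_sub_one_mem_augmentation h)

/-- The algebra endomorphism induced by an endomorphism of the group. -/
noncomputable abbrev groupAlgebraMap (φ : G →* G) : MonoidAlgebra ℝ G →ₐ[ℝ] MonoidAlgebra ℝ G :=
  MonoidAlgebra.mapDomainAlgHom ℝ ℝ φ

theorem groupAlgebraMap_of_sub_one (φ : G →* G) (g : G) :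
    groupAlgebraMap φ (MonoidAlgebra.of ℝ G g - 1) = MonoidAlgebra.of ℝ G (φ g) - 1 := by
  rw [map_sub, map_one]
  simp [groupAlgebraMap]

theorem groupAlgebraMap_mem (φ : G →* G) {n : ℕ} {x : MonoidAlgebra ℝ G}
    (hx : x ∈ augmentation G ^ n) : groupAlgebraMap φ x ∈ augmentation G ^ n := by
  have h1 : (augmentation G).map (groupAlgebraMap φ).toLinearMap ≤ augmentation G := by
    rw [augmentation, Submodule.map_span, Submodule.span_le]
    rintro _ ⟨_, ⟨g, rfl⟩, rfl⟩
    change groupAlgebraMap φ (MonoidAlgebra.of ℝ G g - 1) ∈ augmentation G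
    rw [groupAlgebraMap_of_sub_one]
    exact of_sub_one_mem_augmentation _
  have h2 : (augmentation G ^ n).map (groupAlgebraMap φ).toLinearMap ≤ augmentation G ^ n := by
    rw [Submodule.map_pow]
    exact pow_le_pow_left' h1 n
  exact h2 (Submodule.mem_map_of_mem hx)

/-- The eigenvectors with positive eigenvalue of an endomorphism on a filtration quotient. -/
def augmentationEigen (φ : G →* G) (n : ℕ) : Set (MonoidAlgebra ℝ G) :=
  {v | v ∈ augmentation G ^ (n + 1) ∧ ∃ c : ℝ, 0 < c ∧
    (groupAlgebraMap φ).toLinearMap v - c • v ∈ augmentation G ^ (n + 2)}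

/-- The induced algebra map is multiplicative, so eigenvalues multiply, and products of positive
numbers are positive. -/
theorem augmentationEigen_mul (φ : G →* G) {n : ℕ} {v w : MonoidAlgebra ℝ G}
    (hv : v ∈ augmentationEigen φ n) (hw : w ∈ augmentationEigen φ 0) :
    v * w ∈ augmentationEigen φ (n + 1) := by
  obtain ⟨hv, c, hc, hvc⟩ := hv
  obtain ⟨hw, d, hd, hwd⟩ := hw
  refine ⟨?_, c * d, mul_pos hc hd, ?_⟩
  · rw [pow_succ _ (n + 1)]
    exact Submodule.mul_mem_mul hv (by simpa using hw)
  · simp only [AlgHom.toLinearMap_apply, map_mul] at *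
    have : groupAlgebraMap φ v * groupAlgebraMap φ w - (c * d) • (v * w) =
        (groupAlgebraMap φ v - c • v) * groupAlgebraMap φ w +
          (c • v) * (groupAlgebraMap φ w - d • w) := by
      simp only [sub_mul, mul_sub, smul_mul_assoc, mul_smul_comm, mul_smul]
      rw [smul_comm d c]
      abel
    rw [this]
    refine Submodule.add_mem _ ?_ ?_
    · rw [show n + 1 + 2 = (n + 2) + 1 by ring, pow_succ]
      exact Submodule.mul_mem_mul hvc (by simpa using groupAlgebraMap_mem φ hw)
    · rw [show n + 1 + 2 = (n + 1) + 2 by ring, pow_add]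
      exact Submodule.mul_mem_mul (Submodule.smul_mem _ _ hv) hwd

/-- Each power is generated by products from the first one, so positive eigenvectors in degree one
propagate to all degrees. Cross terms fall into the next power. -/
theorem augmentation_pow_le_span_eigen (φ : G →* G)
    (h : augmentation G ≤ Submodule.span ℝ (augmentationEigen φ 0) ⊔ augmentation G ^ 2) (n : ℕ) :
    augmentation G ^ (n + 1) ≤
      Submodule.span ℝ (augmentationEigen φ n) ⊔ augmentation G ^ (n + 2) := by
  induction n with
  | zero => simpa using h
  | succ n ih =>
    have hE0 : Submodule.span ℝ (augmentationEigen φ 0) ≤ augmentation G :=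
      Submodule.span_le.2 fun v hv => by simpa using hv.1
    have hEn : Submodule.span ℝ (augmentationEigen φ n) ≤ augmentation G ^ (n + 1) :=
      Submodule.span_le.2 fun v hv => hv.1
    calc augmentation G ^ (n + 1 + 1) = augmentation G ^ (n + 1) * augmentation G := pow_succ _ _
      _ ≤ (Submodule.span ℝ (augmentationEigen φ n) ⊔ augmentation G ^ (n + 2)) *
          (Submodule.span ℝ (augmentationEigen φ 0) ⊔ augmentation G ^ 2) :=
        mul_le_mul' ih h
      _ ≤ _ := by
        rw [Submodule.sup_mul, Submodule.mul_sup]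
        refine sup_le (sup_le ?_ ?_) ?_
        · refine le_sup_of_le_left ?_
          rw [Submodule.span_mul_span]
          refine Submodule.span_mono ?_
          rintro _ ⟨v, hv, w, hw, rfl⟩
          exact augmentationEigen_mul φ hv hw
        · refine le_sup_of_le_right ?_
          rw [show n + 1 + 2 = (n + 1) + 2 by ring, pow_add]
          exact mul_le_mul' hEn le_rfl
        · refine le_sup_of_le_right ?_
          rw [show n + 1 + 2 = (n + 2) + 1 by ring, pow_succ]
          refine mul_le_mul' le_rfl (sup_le hE0 ?_)
          simpa using augmentation_pow_succ_le (G := G) 0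

/-- A group that is separated in the augmentation filtration has a bi-order preserved by an
endomorphism acting on the first filtration quotient with positive eigenvalues. -/
theorem exists_invariant_positiveCone (φ : G →* G)
    (hres : ∀ g : G, g ≠ 1 → ∃ n : ℕ, MonoidAlgebra.of ℝ G g - 1 ∉ augmentation G ^ (n + 1))
    (h : augmentation G ≤ Submodule.span ℝ (augmentationEigen φ 0) ⊔ augmentation G ^ 2) :
    ∃ P : Set G, IsPositiveCone P ∧ ∀ g ∈ P, φ g ∈ P := by
  have hex := fun n : ℕ => exists_cone_of_span_eigenvectors (augmentation G ^ (n + 2))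
    (augmentation G ^ (n + 1)) (groupAlgebraMap φ).toLinearMap
    (fun u hu => groupAlgebraMap_mem φ hu) (augmentation_pow_succ_le n)
    (augmentation_pow_le_span_eigen φ h n)
  choose C hCV hCU hCadd hCaddU hCtot hCφ using hex
  -- D(gh) = D g + D h + D g D h, and the last term lies deeper than either factor. Hence the
  -- leading class of D g behaves additively, and g is declared positive when this class lies in the
  -- cone of its level.
  set D : G → MonoidAlgebra ℝ G := fun g => MonoidAlgebra.of ℝ G g - 1 with hD
  have hle : ∀ {m n : ℕ} {x : MonoidAlgebra ℝ G}, x ∈ C n → m < n →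
      x ∈ augmentation G ^ (m + 2) := fun hx hmn =>
    augmentation_pow_le (Nat.succ_le_of_lt hmn) (hCV _ _ hx)
  -- At different levels the shallower summand decides; at equal levels the cone is closed under
  -- addition.
  have huniq : ∀ {m n : ℕ} {x y : MonoidAlgebra ℝ G}, x ∈ C m → y ∈ C n →
      x + y ∈ C (min m n) := by
    intro m n x y hx hy
    rcases lt_trichotomy m n with hmn | rfl | hmn
    · rw [min_eq_left hmn.le]; exact hCaddU _ _ hx _ (hle hy hmn)
    · rw [min_self]; exact hCadd _ _ hx _ hy
    · rw [min_eq_right hmn.le, add_comm]; exact hCaddU _ _ hy _ (hle hx hmn)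
  have hmod : ∀ {n : ℕ} {x y : MonoidAlgebra ℝ G}, x ∈ C n → y - x ∈ augmentation G ^ (n + 2) →
      y ∈ C n := by
    intro n x y hx hy
    simpa using hCaddU _ _ hx _ hy
  have hinv : ∀ g : G, ∀ n, D g ∈ augmentation G ^ (n + 1) →
      D g⁻¹ - -D g ∈ augmentation G ^ (n + 2) := by
    intro g n hg
    have h1 := Submodule.neg_mem _ (mul_of_sub_mem hg g⁻¹)
    have h2 : D g⁻¹ - -D g = -(D g * MonoidAlgebra.of ℝ G g⁻¹ - D g) := by
      have h3 : MonoidAlgebra.of ℝ G g * MonoidAlgebra.of ℝ G g⁻¹ = 1 := by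
        rw [← map_mul, mul_inv_cancel, map_one]
      simp only [hD, sub_mul, h3]
      noncomm_ring
    rwa [h2]
  refine ⟨{g | ∃ n, D g ∈ C n}, ⟨?_, ?_, ?_, ?_, ?_⟩, ?_⟩
  · rintro a ⟨m, ha⟩ b ⟨n, hb⟩
    refine ⟨min m n, hmod (huniq ha hb) ?_⟩
    have h1 : D (a * b) - (D a + D b) = D a * D b := by
      simp only [hD, map_mul]; noncomm_ring
    have h2 : D a * D b ∈ augmentation G ^ (m + 1 + (n + 1)) := by
      rw [pow_add]; exact Submodule.mul_mem_mul (hCV _ _ ha) (hCV _ _ hb)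
    rw [h1]
    rw [show m + 1 + (n + 1) = (m + n + 1) + 1 by ring] at h2
    exact augmentation_pow_le (by omega) h2
  · rintro ⟨n, hn⟩
    refine hCU _ _ hn ?_
    simp only [hD, map_one, sub_self]
    exact Submodule.zero_mem _
  · rintro a ⟨m, ha⟩ ⟨n, hb⟩
    have h1 : -D a ∈ C n := by
      refine hmod hb ?_
      have hm : D a⁻¹ - -D a ∈ augmentation G ^ (n + 2) := by
        have h2 := hinv a⁻¹ n (hCV _ _ hb)
        rw [inv_inv] at h2
        have : D a⁻¹ - -D a = D a - -D a⁻¹ := by abel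
        rwa [this]
      have := Submodule.neg_mem _ hm
      rwa [neg_sub] at this
    have h2 := huniq ha h1
    rw [add_neg_cancel] at h2
    exact hCU _ _ h2 (Submodule.zero_mem _)
  · intro a
    by_cases ha : a = 1
    · exact Or.inr (Or.inr ha)
    · classical
      -- The least index whose power misses D a gives the level. It is not 0, since every D a lies
      -- in the first power.
      have hn := Nat.find_spec (hres a ha)
      have hmin := fun m => Nat.find_min (m := m) (hres a ha)
      set N := Nat.find (hres a ha)
      obtain _ | N := N
      · exact absurd (by simpa using of_sub_one_mem_augmentation a) hn
      · have hV : D a ∈ augmentation G ^ (N + 1) := not_not.1 (hmin N (Nat.lt_succ_self N))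
        rcases hCtot N (D a) hV hn with h1 | h1
        · exact Or.inl ⟨N, h1⟩
        · exact Or.inr (Or.inl ⟨N, hmod h1 (hinv a N hV)⟩)
  · rintro a ⟨n, ha⟩ g
    refine ⟨n, hmod ha ?_⟩
    -- Multiplication by a group element on either side is trivial on the filtration quotients, so
    -- conjugation does not move the leading class.
    have h1 := of_mul_sub_mem (hCV _ _ ha) g⁻¹
    have h2 := mul_of_sub_mem (hmod ha h1 |> hCV _ _) g
    have h3 : D (g⁻¹ * a * g) - D a = (MonoidAlgebra.of ℝ G g⁻¹ * D a * MonoidAlgebra.of ℝ G g -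
        MonoidAlgebra.of ℝ G g⁻¹ * D a) + (MonoidAlgebra.of ℝ G g⁻¹ * D a - D a) := by
      have h3 : MonoidAlgebra.of ℝ G g⁻¹ * MonoidAlgebra.of ℝ G g = 1 := by
        rw [← map_mul, inv_mul_cancel, map_one]
      simp only [hD, map_mul, mul_sub, sub_mul, mul_one, h3]
      abel
    change D (g⁻¹ * a * g) - D a ∈ _
    rw [h3]
    exact Submodule.add_mem _ h2 h1
  · rintro a ⟨n, ha⟩
    refine ⟨n, ?_⟩
    have := hCφ _ _ ha
    rwa [AlgHom.toLinearMap_apply, groupAlgebraMap_of_sub_one] at this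

end Augmentation

/-! ### The free group of rank two -/

/-- The free group of rank two. -/
abbrev F2 : Type := FreeGroup (Fin 2)

namespace F2

/-- The first generator. -/
abbrev a : F2 := FreeGroup.of 0

/-- The second generator. -/
abbrev b : F2 := FreeGroup.of 1

/-- The commutator of the generators. -/
abbrev c : F2 := a * b * a⁻¹ * b⁻¹

/-- The exponent sum of a generator. -/
def exponentSum (i : Fin 2) : F2 →* Multiplicative ℤ :=
  FreeGroup.lift fun j => Multiplicative.ofAdd (if i = j then 1 else 0)

/-- The action of an endomorphism on the abelianization. -/
def exponentMatrix (φ : F2 →* F2) : Matrix (Fin 2) (Fin 2) ℤ :=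
  fun i j => (exponentSum i (φ (FreeGroup.of j))).toAdd

theorem exponentSum_of (i j : Fin 2) :
    (exponentSum i (FreeGroup.of j)).toAdd = if i = j then 1 else 0 := by
  simp [exponentSum]

theorem hom_ext {G : Type*} [Group G] {f g : F2 →* G} (ha : f a = g a) (hb : f b = g b) : f = g := by
  ext i
  fin_cases i
  · exact ha
  · exact hb

theorem exponentSum_map (φ : F2 →* F2) (i : Fin 2) (g : F2) :
    (exponentSum i (φ g)).toAdd = ∑ j, exponentMatrix φ i j * (exponentSum j g).toAdd := by
  induction g using FreeGroup.induction_on with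
  | C1 => simp
  | of x => simp [exponentSum_of, exponentMatrix]
  | inv_of x ih => simp only [map_inv, toAdd_inv, ih, mul_neg, Finset.sum_neg_distrib]
  | mul x y hx hy => simp only [map_mul, toAdd_mul, hx, hy, mul_add, Finset.sum_add_distrib]

theorem exponentMatrix_comp (φ ψ : F2 →* F2) :
    exponentMatrix (φ.comp ψ) = exponentMatrix φ * exponentMatrix ψ := by
  ext i j
  rw [Matrix.mul_apply]
  exact exponentSum_map φ i (ψ (FreeGroup.of j))

theorem exponentMatrix_id : exponentMatrix (MonoidHom.id F2) = 1 := by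
  ext i j
  simp [exponentMatrix, exponentSum_of, Matrix.one_apply]

/-- A homomorphism to an abelian group is determined by the exponent sums. -/
theorem hom_apply_eq {A : Type*} [CommGroup A] (f : F2 →* A) (g : F2) :
    f g = f a ^ (exponentSum 0 g).toAdd * f b ^ (exponentSum 1 g).toAdd := by
  induction g using FreeGroup.induction_on with
  | C1 => simp
  | of x => fin_cases x <;> simp [exponentSum_of]
  | inv_of x ih => rw [map_inv, ih]; simp [mul_comm]
  | mul x y hx hy =>
    rw [map_mul, hx, hy]
    simp only [map_mul, toAdd_mul, zpow_add]
    exact mul_mul_mul_comm _ _ _ _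

/-! ### A faithful linear representation -/

/-- The unipotent matrices generating a free group. -/
def unipotent {R : Type*} [CommRing R] (x : R) : Fin 2 → SL(2, R) :=
  ![⟨!![1, x; 0, 1], by simp [Matrix.det_fin_two]⟩, ⟨!![1, 0; x, 1], by simp [Matrix.det_fin_two]⟩]

theorem unipotent_map {R S : Type*} [CommRing R] [CommRing S] (f : R →+* S) (x : R) (i : Fin 2) :
    Matrix.SpecialLinearGroup.map f (unipotent x i) = unipotent (f x) i := by
  apply Subtype.ext
  fin_cases i
  · change (!![1, x; 0, 1] : Matrix (Fin 2) (Fin 2) R).map f = !![1, f x; 0, 1]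
    simp [Matrix.map_apply, ← Matrix.ext_iff, Fin.forall_fin_two]
  · change (!![1, 0; x, 1] : Matrix (Fin 2) (Fin 2) R).map f = !![1, 0; f x, 1]
    simp [Matrix.map_apply, ← Matrix.ext_iff, Fin.forall_fin_two]

theorem lift_unipotent_map {R S : Type*} [CommRing R] [CommRing S] (f : R →+* S) (x : R) (g : F2) :
    Matrix.SpecialLinearGroup.map f (FreeGroup.lift (unipotent x) g) =
      FreeGroup.lift (unipotent (f x)) g := by
  rw [← MonoidHom.comp_apply]
  congr 1
  ext i : 1
  simp [unipotent_map]

theorem unipotent_inv {R : Type*} [CommRing R] (x : R) (i : Fin 2) :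
    (unipotent x i)⁻¹ = unipotent (-x) i := by
  apply Subtype.ext
  fin_cases i
  · change (!![1, x; 0, 1] : Matrix (Fin 2) (Fin 2) R).adjugate = !![1, -x; 0, 1]
    simp [Matrix.adjugate_fin_two]
  · change (!![1, 0; x, 1] : Matrix (Fin 2) (Fin 2) R).adjugate = !![1, 0; -x, 1]
    simp [Matrix.adjugate_fin_two]

open UpperHalfPlane in
theorem re_unipotent_zero_smul (t : ℝ) (z : ℍ) : (unipotent t 0 • z).re = z.re + t := by
  have : ((unipotent t 0 • z : ℍ) : ℂ) = z + t := by
    rw [UpperHalfPlane.specialLinearGroup_apply]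
    simp [unipotent]
  simpa using congrArg Complex.re this

open UpperHalfPlane in
/-- In the coordinate `-1 / z` the lower unipotent matrices act by translations. -/
theorem re_unipotent_one_smul (t : ℝ) (z : ℍ) : ∃ r : ℝ, 0 < r ∧
    (unipotent t 1 • z).re = r * (z.re + t * Complex.normSq z) ∧
    Complex.normSq (unipotent t 1 • z : ℍ) = r * Complex.normSq z := by
  have h : ((unipotent t 1 • z : ℍ) : ℂ) = z / (t * z + 1) := by
    rw [UpperHalfPlane.specialLinearGroup_apply]
    simp [unipotent]
  have hne : (t * z + 1 : ℂ) ≠ 0 := by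
    intro h0
    have him := congrArg Complex.im h0
    have hre := congrArg Complex.re h0
    simp at him hre
    rcases him with rfl | him
    · simp at hre
    · exact z.im_ne_zero him
  refine ⟨(Complex.normSq (t * z + 1))⁻¹, inv_pos.2 (Complex.normSq_pos.2 hne), ?_, ?_⟩
  · have : (unipotent t 1 • z).re = ((unipotent t 1 • z : ℍ) : ℂ).re := rfl
    rw [this, h, Complex.div_re]
    simp [Complex.normSq_apply]
    ring
  · rw [h, Complex.normSq_div, div_eq_inv_mul]

open UpperHalfPlane Pointwise in
theorem injective_lift_unipotent_four :
    Function.Injective (FreeGroup.lift (unipotent (4 : ℝ))) := by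
  have hpos : ∀ z : ℍ, 0 < Complex.normSq z ∧ z.re ^ 2 ≤ Complex.normSq z := fun z =>
    ⟨z.normSq_pos, by
      rw [Complex.normSq_apply]; change (z : ℂ).re ^ 2 ≤ _; nlinarith [sq_nonneg (z : ℂ).im]⟩
  -- The second pair is the first one in the coordinate 1 / z, where the lower unipotent matrix also
  -- translates by 4. Translation by 4 moves real parts above -2 to real parts above 2.
  let X : Fin 2 → Set ℍ := ![{z | 2 ≤ z.re}, {z | 2 * Complex.normSq z ≤ z.re}]
  let Y : Fin 2 → Set ℍ := ![{z | z.re ≤ -2}, {z | z.re ≤ -2 * Complex.normSq z}]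
  have hX0 : X 0 = {z | 2 ≤ z.re} := rfl
  have hX1 : X 1 = {z : ℍ | 2 * Complex.normSq z ≤ z.re} := rfl
  have hY0 : Y 0 = {z | z.re ≤ -2} := rfl
  have hY1 : Y 1 = {z : ℍ | z.re ≤ -2 * Complex.normSq z} := rfl
  refine FreeGroup.injective_lift_of_ping_pong (unipotent (4 : ℝ)) (α := ℍ) X Y ?_ ?_ ?_ ?_ ?_ ?_
  · intro i
    fin_cases i
    · exact ⟨⟨⟨2, 1⟩, by simp⟩, by simp [X]⟩
    · refine ⟨⟨⟨1 / 4, 1 / 4⟩, by simp⟩, ?_⟩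
      change 2 * Complex.normSq ⟨1 / 4, 1 / 4⟩ ≤ (1 / 4 : ℝ)
      rw [Complex.normSq_apply]
      norm_num
  · intro i j hij
    rw [Function.onFun, Set.disjoint_left]
    intro z hi hj
    obtain ⟨h1, h2⟩ := hpos z
    fin_cases i <;> fin_cases j <;> simp [X] at hi hj hij <;> nlinarith
  · intro i j hij
    rw [Function.onFun, Set.disjoint_left]
    intro z hi hj
    obtain ⟨h1, h2⟩ := hpos z
    fin_cases i <;> fin_cases j <;> simp [Y] at hi hj hij <;> nlinarith
  · intro i j
    rw [Set.disjoint_left]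
    intro z hi hj
    obtain ⟨h1, h2⟩ := hpos z
    fin_cases i <;> fin_cases j <;> simp [X, Y] at hi hj <;> nlinarith
  · rintro i _ ⟨z, hz, rfl⟩
    fin_cases i
    · simp only [Fin.zero_eta, hY0, hX0, Set.mem_compl_iff, Set.mem_ofPred_eq, not_le] at hz ⊢
      rw [re_unipotent_zero_smul]
      linarith
    · simp only [Fin.mk_one, hY1, hX1, Set.mem_compl_iff, Set.mem_ofPred_eq, not_le] at hz ⊢
      obtain ⟨r, hr, h1, h2⟩ := re_unipotent_one_smul 4 z
      rw [h1, h2]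
      nlinarith [mul_lt_mul_of_pos_left hz hr]
  · rintro i _ ⟨z, hz, rfl⟩
    simp only [Pi.inv_apply, unipotent_inv]
    fin_cases i
    · simp only [Fin.zero_eta, hY0, hX0, Set.mem_compl_iff, Set.mem_ofPred_eq, not_le] at hz ⊢
      rw [re_unipotent_zero_smul]
      linarith
    · simp only [Fin.mk_one, hY1, hX1, Set.mem_compl_iff, Set.mem_ofPred_eq, not_le] at hz ⊢
      obtain ⟨r, hr, h1, h2⟩ := re_unipotent_one_smul (-4) z
      rw [h1, h2]
      nlinarith [mul_lt_mul_of_pos_left hz hr]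

/-- The linear extension of the representation over the polynomial ring to the group algebra. -/
noncomputable def polynomialRep :
    MonoidAlgebra ℝ F2 →ₐ[ℝ] Matrix (Fin 2) (Fin 2) (Polynomial ℝ) :=
  MonoidAlgebra.lift ℝ _ _ (Matrix.SpecialLinearGroup.coeMonoidHom.comp
    (FreeGroup.lift (unipotent Polynomial.X)))

theorem polynomialRep_of (g : F2) : polynomialRep (MonoidAlgebra.of ℝ F2 g) =
    (FreeGroup.lift (unipotent Polynomial.X) g : SL(2, Polynomial ℝ)).1 := by
  rw [polynomialRep, MonoidAlgebra.lift_of]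
  rfl

/-- At X = 0 both generators become the identity, so the augmentation ideal maps to matrices with
entries divisible by X, and powers follow. -/
theorem X_pow_dvd_polynomialRep (n : ℕ) {v : MonoidAlgebra ℝ F2}
    (hv : v ∈ augmentation F2 ^ (n + 1)) (i j : Fin 2) :
    (Polynomial.X : Polynomial ℝ) ^ (n + 1) ∣ polynomialRep v i j := by
  have h1 : ∀ v ∈ augmentation F2, ∀ i j : Fin 2, (Polynomial.X : Polynomial ℝ) ∣
      polynomialRep v i j := by
    intro v hv
    induction hv using Submodule.span_induction with
    | mem x hx =>
      obtain ⟨g, rfl⟩ := hx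
      intro i j
      have h0 := lift_unipotent_map (Polynomial.evalRingHom (0 : ℝ)) Polynomial.X g
      have h2 : FreeGroup.lift (unipotent (Polynomial.evalRingHom (0 : ℝ) Polynomial.X)) g = 1 := by
        have : FreeGroup.lift (unipotent (Polynomial.evalRingHom (0 : ℝ) Polynomial.X)) =
            (1 : F2 →* SL(2, ℝ)) := by
          ext i : 1
          apply Subtype.ext
          fin_cases i <;> simp [unipotent, Matrix.one_fin_two]
        rw [this, MonoidHom.one_apply]
      rw [h2] at h0
      have h3 := congrArg (fun m : SL(2, ℝ) => m.1 i j) h0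
      have hX : ∀ p : Polynomial ℝ, p.eval 0 = 0 → Polynomial.X ∣ p := fun p hp => by
        simpa using Polynomial.dvd_iff_isRoot.2 hp
      rw [map_sub, map_one, polynomialRep_of, Matrix.sub_apply]
      refine hX _ ?_
      rw [Polynomial.eval_sub, sub_eq_zero]
      refine Eq.trans (b := (1 : Matrix (Fin 2) (Fin 2) ℝ) i j) h3 ?_
      rw [Matrix.one_apply, Matrix.one_apply]
      split_ifs <;> simp
    | zero => simp
    | add x y _ _ hx hy => intro i j; rw [map_add]; exact dvd_add (hx i j) (hy i j)
    | smul r x _ hx =>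
      intro i j
      rw [map_smul, Matrix.smul_apply, Polynomial.smul_eq_C_mul]
      exact Dvd.dvd.mul_left (hx i j) _
  induction n generalizing v i j with
  | zero => simpa using h1 v (by simpa using hv) i j
  | succ n ih =>
    rw [pow_succ] at hv
    induction hv using Submodule.mul_induction_on' with
    | mem_mul_mem x hx y hy =>
      rw [map_mul, Matrix.mul_apply, pow_succ]
      exact Finset.dvd_sum fun k _ => mul_dvd_mul (ih hx i k) (h1 y hy k j)
    | add x _ y _ hx hy => rw [map_add]; exact dvd_add hx hy

/-- An element lying in all powers would have matrix entries minus those of the identity divisible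
by more than their degree allows, hence zero. Specializing X to 4, where the representation is
faithful, shows that it is trivial. -/
theorem exists_of_sub_one_notMem_augmentation_pow (g : F2) (hg : g ≠ 1) :
    ∃ n : ℕ, MonoidAlgebra.of ℝ F2 g - 1 ∉ augmentation F2 ^ (n + 1) := by
  by_contra! h
  apply hg
  apply injective_lift_unipotent_four
  rw [map_one]
  have h1 : FreeGroup.lift (unipotent (Polynomial.X : Polynomial ℝ)) g = 1 := by
    apply Subtype.ext
    rw [← polynomialRep_of, ← sub_eq_zero, Matrix.SpecialLinearGroup.coe_one,
      ← map_one polynomialRep, ← map_sub]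
    ext i j : 1
    by_contra hne
    have := X_pow_dvd_polynomialRep _ (h (polynomialRep (MonoidAlgebra.of ℝ F2 g - 1) i j).natDegree)
      i j
    have h2 := Polynomial.natDegree_le_of_dvd this hne
    simp at h2
  have h2 := lift_unipotent_map (Polynomial.evalRingHom (4 : ℝ)) Polynomial.X g
  rw [h1, map_one] at h2
  simpa using h2.symm

/-! ### The invariant standard order -/

/-- Modulo the square of the augmentation ideal, g ↦ g - 1 is additive, so it factors through the
exponent sums. -/
theorem of_sub_one_mem_span_sup (g : F2) :
    MonoidAlgebra.of ℝ F2 g - 1 - (((exponentSum 0 g).toAdd : ℝ) • (MonoidAlgebra.of ℝ F2 a - 1) +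
      ((exponentSum 1 g).toAdd : ℝ) • (MonoidAlgebra.of ℝ F2 b - 1)) ∈ augmentation F2 ^ 2 := by
  set D : F2 → MonoidAlgebra ℝ F2 := fun g => MonoidAlgebra.of ℝ F2 g - 1 with hD
  change D g - (((exponentSum 0 g).toAdd : ℝ) • D a + ((exponentSum 1 g).toAdd : ℝ) • D b) ∈ _
  have hmul : ∀ x y, D x * D y ∈ augmentation F2 ^ 2 := fun x y => by
    rw [pow_two]
    exact Submodule.mul_mem_mul (of_sub_one_mem_augmentation _) (of_sub_one_mem_augmentation _)
  induction g using FreeGroup.induction_on with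
  | C1 =>
    have : D 1 = 0 := by simp only [hD, map_one, sub_self]
    simp [this]
  | of x => fin_cases x <;> simp [exponentSum_of]
  | inv_of x ih =>
    have h := hmul (FreeGroup.of x) (FreeGroup.of x)⁻¹
    have h1 : D (FreeGroup.of x) * D (FreeGroup.of x)⁻¹ =
        -(D (FreeGroup.of x) + D (FreeGroup.of x)⁻¹) := by
      have : MonoidAlgebra.of ℝ F2 (FreeGroup.of x) * MonoidAlgebra.of ℝ F2 (FreeGroup.of x)⁻¹ = 1 := by
        rw [← map_mul, mul_inv_cancel, map_one]
      simp only [hD, mul_sub, sub_mul, this]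
      noncomm_ring
    rw [h1] at h
    have := Submodule.sub_mem _ (Submodule.neg_mem _ h) ih
    convert this using 1
    simp only [map_inv, toAdd_inv, Int.cast_neg, neg_smul]
    abel
  | mul x y hx hy =>
    have h1 : D (x * y) = D x + D y + D x * D y := by
      simp only [hD, map_mul]; noncomm_ring
    have := Submodule.add_mem _ (Submodule.add_mem _ hx hy) (hmul x y)
    convert this using 1
    rw [h1]
    simp only [map_mul, toAdd_mul, Int.cast_add, add_smul]
    abel

/-- An endomorphism of the free group whose action on the abelianization has two independent
eigenvectors with positive eigenvalues preserves a bi-order. -/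
theorem exists_invariant_standard_cone (φ : F2 →* F2) (v w : Fin 2 → ℝ) (r s : ℝ)
    (hr : 0 < r) (hs : 0 < s)
    (hv : ((exponentMatrix φ).map (Int.cast : ℤ → ℝ)).mulVec v = r • v)
    (hw : ((exponentMatrix φ).map (Int.cast : ℤ → ℝ)).mulVec w = s • w)
    (hvw : v 0 * w 1 - v 1 * w 0 ≠ 0) :
    ∃ P : Set F2, IsPositiveCone P ∧ ∀ g ∈ P, φ g ∈ P := by
  refine exists_invariant_positiveCone φ exists_of_sub_one_notMem_augmentation_pow ?_
  set D : F2 → MonoidAlgebra ℝ F2 := fun g => MonoidAlgebra.of ℝ F2 g - 1 with hD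
  have hDJ : ∀ g, D g ∈ augmentation F2 := of_sub_one_mem_augmentation
  have heig : ∀ (u : Fin 2 → ℝ) (t : ℝ), 0 < t →
      ((exponentMatrix φ).map (Int.cast : ℤ → ℝ)).mulVec u = t • u →
      u 0 • D a + u 1 • D b ∈ augmentationEigen φ 0 := by
    intro u t ht hu
    refine ⟨?_, t, ht, ?_⟩
    · simpa using Submodule.add_mem _ (Submodule.smul_mem _ (u 0) (hDJ a))
        (Submodule.smul_mem _ (u 1) (hDJ b))
    · have e0 := congrFun hu 0
      have e1 := congrFun hu 1
      simp only [Matrix.mulVec, dotProduct, Fin.sum_univ_two, Matrix.map_apply, Pi.smul_apply,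
        smul_eq_mul] at e0 e1
      have ha := Submodule.smul_mem _ (u 0) (of_sub_one_mem_span_sup (φ a))
      have hb := Submodule.smul_mem _ (u 1) (of_sub_one_mem_span_sup (φ b))
      have hab := Submodule.add_mem _ ha hb
      rw [AlgHom.toLinearMap_apply, map_add, map_smul, map_smul, groupAlgebraMap_of_sub_one,
        groupAlgebraMap_of_sub_one]
      convert hab using 1
      change u 0 • D (φ a) + u 1 • D (φ b) - t • (u 0 • D a + u 1 • D b) =
        u 0 • (D (φ a) - ((exponentMatrix φ 0 0 : ℝ) • D a + (exponentMatrix φ 1 0 : ℝ) • D b)) +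
        u 1 • (D (φ b) - ((exponentMatrix φ 0 1 : ℝ) • D a + (exponentMatrix φ 1 1 : ℝ) • D b))
      rw [smul_add, smul_smul, smul_smul, ← e0, ← e1]
      module
  have hv' := Submodule.subset_span (R := ℝ) (heig v r hr hv)
  have hw' := Submodule.subset_span (R := ℝ) (heig w s hs hw)
  set d := v 0 * w 1 - v 1 * w 0 with hd
  -- Cramer's rule with determinant `d` recovers the two generators from the two eigenvectors.
  have ha : D a ∈ Submodule.span ℝ (augmentationEigen φ 0) := by
    have := Submodule.sub_mem _ (Submodule.smul_mem _ (d⁻¹ * w 1) hv')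
      (Submodule.smul_mem _ (d⁻¹ * v 1) hw')
    convert this using 1
    have h1 : (d⁻¹ * w 1) • (v 0 • D a + v 1 • D b) - (d⁻¹ * v 1) • (w 0 • D a + w 1 • D b) =
      (d⁻¹ * d) • D a := by rw [hd]; module
    rw [h1, inv_mul_cancel₀ hvw, one_smul]
  have hb : D b ∈ Submodule.span ℝ (augmentationEigen φ 0) := by
    have := Submodule.sub_mem _ (Submodule.smul_mem _ (d⁻¹ * v 0) hw')
      (Submodule.smul_mem _ (d⁻¹ * w 0) hv')
    convert this using 1
    have h1 : (d⁻¹ * v 0) • (w 0 • D a + w 1 • D b) - (d⁻¹ * w 0) • (v 0 • D a + v 1 • D b) =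
      (d⁻¹ * d) • D b := by rw [hd]; module
    rw [h1, inv_mul_cancel₀ hvw, one_smul]
  conv_lhs => rw [augmentation]
  rw [Submodule.span_le]
  rintro _ ⟨g, rfl⟩
  have h1 := of_sub_one_mem_span_sup g
  have h2 := Submodule.add_mem_sup (Submodule.add_mem _
    (Submodule.smul_mem _ ((exponentSum 0 g).toAdd : ℝ) ha)
    (Submodule.smul_mem _ ((exponentSum 1 g).toAdd : ℝ) hb)) h1
  simp only [hD, add_sub_cancel] at h2
  exact h2

end F2

/-! ### Fox calculus with values in Hahn series -/

/-- Hahn series with real exponents and integer coefficients. -/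
abbrev RealHahn : Type := HahnSeries ℝ ℤ

namespace RealHahn

theorem pos_iff_toLex {x : RealHahn} : 0 < x.leadingCoeff ↔ 0 < toLex x :=
  HahnSeries.leadingCoeff_pos_iff (x := toLex x)

theorem leadingCoeff_add_pos {x y : RealHahn} (hx : 0 < x.leadingCoeff) (hy : 0 < y.leadingCoeff) :
    0 < (x + y).leadingCoeff := by
  rw [pos_iff_toLex] at *
  exact add_pos hx hy

theorem leadingCoeff_pos_or (x : RealHahn) : 0 < x.leadingCoeff ∨ 0 < (-x).leadingCoeff ∨ x = 0 := by
  rw [pos_iff_toLex, pos_iff_toLex]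
  rcases lt_trichotomy 0 (toLex x) with h | h | h
  · exact Or.inl h
  · exact Or.inr (Or.inr (toLex_eq_zero.1 h.symm))
  · exact Or.inr (Or.inl (neg_pos.2 h))

theorem not_leadingCoeff_neg_pos {x : RealHahn} (hx : 0 < x.leadingCoeff) :
    ¬ 0 < (-x).leadingCoeff := by
  rw [pos_iff_toLex] at *
  exact fun h => lt_asymm hx (neg_pos.1 h)

/-- Multiplication of all exponents by a positive real number. -/
noncomputable def scale (r : ℝ) (hr : 0 < r) : RealHahn →+* RealHahn :=
  HahnSeries.embDomainRingHom (AddMonoidHom.mulLeft r) (mul_right_injective₀ hr.ne')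
    fun _ _ => mul_le_mul_iff_right₀ hr

theorem scale_single (r : ℝ) (hr : 0 < r) (s : ℝ) (n : ℤ) :
    scale r hr (HahnSeries.single s n) = HahnSeries.single (r * s) n :=
  HahnSeries.embDomain_single

theorem leadingCoeff_scale_pos (r : ℝ) (hr : 0 < r) {x : RealHahn} (hx : 0 < x.leadingCoeff) :
    0 < (scale r hr x).leadingCoeff := by
  let f : ℝ ↪o ℝ := ⟨⟨fun s => r * s, mul_right_injective₀ hr.ne'⟩, mul_le_mul_iff_right₀ hr⟩
  rw [pos_iff_toLex] at *
  have h := (HahnSeries.embDomainOrderEmbedding (R := ℤ) f).strictMono hx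
  have h0 : HahnSeries.embDomainOrderEmbedding (R := ℤ) f 0 = 0 := by simp
  rw [h0] at h
  exact h

end RealHahn

namespace F2

/-- The monomial attached to a group element by a homomorphism to the real numbers. -/
noncomputable def monomial (l : F2 →* Multiplicative ℝ) : F2 →* RealHahn where
  toFun g := HahnSeries.single (l g).toAdd 1
  map_one' := by simp
  map_mul' g h := by simp

theorem monomial_apply (l : F2 →* Multiplicative ℝ) (g : F2) :
    monomial l g = HahnSeries.single (l g).toAdd 1 := rfl

theorem monomial_mul_inv (l : F2 →* Multiplicative ℝ) (g : F2) :
    monomial l g * monomial l g⁻¹ = 1 := by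
  rw [← map_mul, mul_inv_cancel, map_one]

theorem leadingCoeff_monomial (l : F2 →* Multiplicative ℝ) (g : F2) :
    (monomial l g).leadingCoeff = 1 := HahnSeries.leadingCoeff_of_single

/-- The affine transformation of Hahn series with given linear part and translation part. -/
noncomputable def affinePerm (l : F2 →* Multiplicative ℝ) (g : F2) (m : RealHahn) :
    Equiv.Perm RealHahn where
  toFun x := monomial l g * x + m
  invFun x := monomial l g⁻¹ * (x - m)
  left_inv x := by
    dsimp only
    rw [add_sub_cancel_right, ← mul_assoc, mul_comm (monomial l g⁻¹), monomial_mul_inv, one_mul]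
  right_inv x := by dsimp only; rw [← mul_assoc, monomial_mul_inv, one_mul, sub_add_cancel]

/-- The affine action of the free group defining the Fox derivative. -/
noncomputable def foxAction (l : F2 →* Multiplicative ℝ) : F2 →* Equiv.Perm RealHahn :=
  FreeGroup.lift ![affinePerm l a 1, affinePerm l b 0]

/-- The Fox derivative with respect to the first generator. -/
noncomputable def fox (l : F2 →* Multiplicative ℝ) (g : F2) : RealHahn := foxAction l g 0

theorem foxAction_apply (l : F2 →* Multiplicative ℝ) (g : F2) (x : RealHahn) :
    foxAction l g x = monomial l g * x + fox l g := by
  induction g using FreeGroup.induction_on generalizing x with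
  | C1 => simp [fox]
  | of i => fin_cases i <;> simp [fox, foxAction, affinePerm]
  | inv_of i ih =>
    set g : F2 := FreeGroup.of i
    apply (foxAction l g).injective
    have h1 : ∀ y, foxAction l g (foxAction l g⁻¹ y) = y := fun y => by
      rw [← Equiv.Perm.mul_apply, ← map_mul, mul_inv_cancel, map_one, Equiv.Perm.one_apply]
    have h2 : monomial l g * fox l g⁻¹ + fox l g = 0 := by
      rw [← ih]; exact h1 0
    rw [h1, ih, mul_add, ← mul_assoc, monomial_mul_inv, one_mul, add_assoc, h2, add_zero]
  | mul g h hg hh =>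
    have h2 : fox l (g * h) = monomial l g * fox l h + fox l g := by
      rw [fox, map_mul, Equiv.Perm.mul_apply, hg]; rfl
    rw [map_mul, Equiv.Perm.mul_apply, hg, hh, h2, map_mul]
    ring

/-- The product rule of Fox calculus. On the kernel of `l` the monomial is 1, so the derivative is
additive there. -/
theorem fox_mul (l : F2 →* Multiplicative ℝ) (g h : F2) :
    fox l (g * h) = fox l g + monomial l g * fox l h := by
  rw [fox, map_mul, Equiv.Perm.mul_apply, foxAction_apply, add_comm]
  rfl

theorem fox_one (l : F2 →* Multiplicative ℝ) : fox l 1 = 0 := by simp [fox]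

theorem fox_a (l : F2 →* Multiplicative ℝ) : fox l a = 1 := by
  simp [fox, foxAction, affinePerm]

theorem fox_b (l : F2 →* Multiplicative ℝ) : fox l b = 0 := by
  simp [fox, foxAction, affinePerm]

theorem fox_inv (l : F2 →* Multiplicative ℝ) (g : F2) :
    fox l g⁻¹ = -(monomial l g⁻¹ * fox l g) := by
  have h := fox_mul l g⁻¹ g
  rw [inv_mul_cancel, fox_one] at h
  exact eq_neg_of_add_eq_zero_left h.symm

/-- A monomial factor has leading coefficient 1; this is what makes the sign of the leading
coefficient a conjugation invariant. -/
theorem fox_conj (l : F2 →* Multiplicative ℝ) (g f : F2) (hf : l f = 1) :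
    fox l (g * f * g⁻¹) = monomial l g * fox l f := by
  have h1 : monomial l f = 1 := by rw [monomial_apply, hf]; simp
  rw [fox_mul, fox_mul, fox_inv, map_mul, h1, mul_one, mul_neg, ← mul_assoc, monomial_mul_inv]
  ring

theorem l_c (l : F2 →* Multiplicative ℝ) : l c = 1 := by
  simp only [map_mul, map_inv]
  rw [mul_comm (l a), mul_inv_cancel_right, mul_inv_cancel]

theorem fox_c (l : F2 →* Multiplicative ℝ) : fox l c = 1 - monomial l b := by
  rw [fox_mul, fox_mul, fox_mul, fox_inv, fox_inv, fox_a, fox_b, map_mul]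
  have := monomial_mul_inv l a
  linear_combination (-monomial l b) * this

/-- Crossed homomorphisms are determined by their values on the generators. -/
theorem crossedHom_ext {K : Type*} [CommRing K] (β : F2 →* K) {D E : F2 → K}
    (hD : ∀ g h, D (g * h) = D g + β g * D h) (hE : ∀ g h, E (g * h) = E g + β g * E h)
    (ha : D a = E a) (hb : D b = E b) (g : F2) : D g = E g := by
  have hone : ∀ {D : F2 → K}, (∀ g h, D (g * h) = D g + β g * D h) → D 1 = 0 := by
    intro D hD
    have := hD 1 1
    simpa using this
  induction g using FreeGroup.induction_on with
  | C1 => rw [hone hD, hone hE]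
  | of i => fin_cases i; exacts [ha, hb]
  | inv_of i ih =>
    have h1 := hD (FreeGroup.of i)⁻¹ (FreeGroup.of i)
    have h2 := hE (FreeGroup.of i)⁻¹ (FreeGroup.of i)
    rw [inv_mul_cancel, hone hD] at h1
    rw [inv_mul_cancel, hone hE] at h2
    rw [ih] at h1
    exact add_right_cancel (h1.symm.trans h2)
  | mul g h hg hh => rw [hD, hE, hg, hh]

/-- The Fox derivative is equivariant, up to a unit, under an endomorphism that fixes the
commutator of the generators up to conjugation. -/
theorem fox_map (l : F2 →* Multiplicative ℝ) (φ : F2 →* F2) (r : ℝ) (hr : 0 < r)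
    (hl : ∀ g, (l (φ g)).toAdd = r * (l g).toAdd) (hb : (l b).toAdd ≠ 0)
    (u : F2) (hu : φ c = u * c * u⁻¹) (f : F2) (hf : l f = 1) :
    fox l (φ f) * RealHahn.scale r hr (1 - monomial l b) =
      RealHahn.scale r hr (fox l f) * (monomial l u * (1 - monomial l b)) := by
  set σ := RealHahn.scale r hr with hσ
  have hmon : ∀ g, σ (monomial l g) = monomial l (φ g) := fun g => by
    rw [monomial_apply, RealHahn.scale_single, ← hl, monomial_apply]
  have hb1 : σ (1 - monomial l b) ≠ 0 := by
    rw [map_sub, map_one, hmon, sub_ne_zero, monomial_apply, hl]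
    intro h
    have := congrArg HahnSeries.order h
    rw [HahnSeries.order_one, HahnSeries.order_single one_ne_zero] at this
    exact mul_ne_zero hr.ne' hb this.symm
  -- Over a commutative ring a crossed homomorphism, once multiplied by 1 - β(b), is a multiple of
  -- the derivative plus a principal crossed homomorphism. The coefficients `m` and `w` are those
  -- forced by the values at `b` and `a`.
  set m : RealHahn := -fox l (φ b) with hm
  set w : RealHahn := fox l (φ a) * σ (1 - monomial l b) - (σ (monomial l a) - 1) * m with hw
  have key : ∀ f, fox l (φ f) * σ (1 - monomial l b) =
      σ (fox l f) * w + (σ (monomial l f) - 1) * m := by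
    refine crossedHom_ext ((σ : RealHahn →* RealHahn).comp (monomial l)) ?_ ?_ ?_ ?_
    · intro g h
      simp only [map_mul, fox_mul, MonoidHom.comp_apply, MonoidHom.coe_coe, hmon]
      ring
    · intro g h
      simp only [fox_mul, map_mul, map_add, MonoidHom.comp_apply, MonoidHom.coe_coe]
      ring
    · rw [fox_a, map_one, hw]; ring
    · rw [fox_b, map_zero, hm, map_sub, map_one]; ring
  have hker : ∀ f, l f = 1 → σ (monomial l f) = 1 := fun f hf => by
    rw [monomial_apply, hf]; simp
  -- The principal part vanishes on the kernel of `l`, so evaluation at the commutator identifies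
  -- `w` with the derivative of φ(c).
  have hwc : w = monomial l u * (1 - monomial l b) := by
    have h1 := key c
    rw [hker c (l_c l), sub_self, zero_mul, add_zero, fox_c, mul_comm] at h1
    have h2 := mul_left_cancel₀ hb1 h1
    rw [← h2, hu, fox_conj l u c (l_c l), fox_c]
  rw [key, hker f hf, sub_self, zero_mul, add_zero, hwc]

/-! ### The non-standard order -/

theorem leadingCoeff_one_sub_monomial (l : F2 →* Multiplicative ℝ) (hb : 0 < (l b).toAdd) :
    (1 - monomial l b).leadingCoeff = 1 := by
  rw [sub_eq_add_neg, HahnSeries.leadingCoeff_add_eq_left]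
  · simp
  · rw [HahnSeries.orderTop_neg, monomial_apply, HahnSeries.orderTop_single one_ne_zero,
      HahnSeries.orderTop_one]
    exact_mod_cast hb

/-- The element of the third term of the lower central series bounding the commutator. -/
abbrev w : F2 := b⁻¹ * (b⁻¹ * c * b⁻¹⁻¹ * c⁻¹) * b⁻¹⁻¹

/-- The order on the free group that compares first by `l`, then by the Fox derivative and
finally by a given cone. -/
def foxCone (l : F2 →* Multiplicative ℝ) (P : Set F2) : Set F2 :=
  {g | 0 < (l g).toAdd ∨ (l g = 1 ∧ (0 < (fox l g).leadingCoeff ∨ (fox l g = 0 ∧ g ∈ P)))}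

/-- A lexicographic cone: `l` is a homomorphism, the derivative is one on the kernel of `l`, and `P`
orders what is left. -/
theorem isPositiveCone_foxCone (l : F2 →* Multiplicative ℝ) {P : Set F2} (hP : IsPositiveCone P) :
    IsPositiveCone (foxCone l P) := by
  have hl1 : ∀ {g}, l g = 1 → (l g).toAdd = 0 := fun h => by rw [h]; rfl
  have hmon : ∀ {g}, l g = 1 → monomial l g = 1 := fun h => by rw [monomial_apply, h]; simp
  have hmul : ∀ {g h}, l g = 1 → fox l (g * h) = fox l g + fox l h := fun hg => by
    rw [fox_mul, hmon hg, one_mul]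
  have hinv : ∀ {g}, l g = 1 → fox l g⁻¹ = -fox l g := fun {g} hg => by
    rw [fox_inv, hmon (by rw [map_inv, hg, inv_one]), one_mul]
  refine ⟨?_, ?_, ?_, ?_, ?_⟩
  · rintro g hg h hh
    rcases hg with hg | ⟨hg, hg'⟩ <;> rcases hh with hh | ⟨hh, hh'⟩
    · left; rw [map_mul, toAdd_mul]; exact add_pos hg hh
    · left; rw [map_mul, hh, mul_one]; exact hg
    · left; rw [map_mul, hg, one_mul]; exact hh
    · right
      refine ⟨by rw [map_mul, hg, hh, one_mul], ?_⟩
      rw [hmul hg]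
      rcases hg' with hg' | ⟨hg', hg''⟩ <;> rcases hh' with hh' | ⟨hh', hh''⟩
      · exact Or.inl (RealHahn.leadingCoeff_add_pos hg' hh')
      · left; rwa [hh', add_zero]
      · left; rwa [hg', zero_add]
      · exact Or.inr ⟨by rw [hg', hh', add_zero], hP.mul_mem _ hg'' _ hh''⟩
  · rintro (h | ⟨-, h | ⟨-, h⟩⟩)
    · simp at h
    · rw [fox_one] at h; simp at h
    · exact hP.one_notMem h
  · rintro g hg hg1
    rcases hg with hg | ⟨hg, hg'⟩
    · rcases hg1 with h | ⟨h, -⟩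
      · rw [map_inv, toAdd_inv] at h; linarith
      · have := hl1 h
        rw [map_inv, toAdd_inv] at this; linarith
    · rcases hg1 with h | ⟨-, h⟩
      · rw [map_inv, hg] at h; simp at h
      · rw [hinv hg] at h
        rcases hg' with hg' | ⟨hg', hg''⟩
        · rcases h with h | ⟨h, -⟩
          · exact RealHahn.not_leadingCoeff_neg_pos hg' h
          · rw [neg_eq_zero.1 h] at hg'; simp at hg'
        · rcases h with h | ⟨-, h⟩
          · rw [hg'] at h; simp at h
          · exact hP.inv_notMem _ hg'' h
  · intro g
    rcases lt_trichotomy 0 (l g).toAdd with h | h | h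
    · exact Or.inl (Or.inl h)
    · have hg : l g = 1 := h.symm
      have hg' : l g⁻¹ = 1 := by rw [map_inv, hg, inv_one]
      rcases RealHahn.leadingCoeff_pos_or (fox l g) with h1 | h1 | h1
      · exact Or.inl (Or.inr ⟨hg, Or.inl h1⟩)
      · exact Or.inr (Or.inl (Or.inr ⟨hg', Or.inl (by rwa [hinv hg])⟩))
      · rcases hP.total g with h2 | h2 | h2
        · exact Or.inl (Or.inr ⟨hg, Or.inr ⟨h1, h2⟩⟩)
        · exact Or.inr (Or.inl (Or.inr ⟨hg', Or.inr ⟨by rw [hinv hg, h1, neg_zero], h2⟩⟩))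
        · exact Or.inr (Or.inr h2)
    · refine Or.inr (Or.inl (Or.inl ?_))
      rw [map_inv, toAdd_inv]; linarith
  · rintro f hf g
    have hlf : l (g⁻¹ * f * g) = l f := by rw [map_mul, map_mul, map_inv]; simp
    rcases hf with h | ⟨h, h'⟩
    · left; rwa [hlf]
    · right
      have h1 : fox l (g⁻¹ * f * g) = monomial l g⁻¹ * fox l f := by
        simpa using fox_conj l g⁻¹ f h
      refine ⟨hlf.trans h, ?_⟩
      rw [h1]
      rcases h' with h' | ⟨h', h''⟩
      · left
        rwa [HahnSeries.leadingCoeff_mul, leadingCoeff_monomial, one_mul]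
      · exact Or.inr ⟨by rw [h', mul_zero], hP.conj_mem _ h'' g⟩

/-- Compare leading coefficients in `fox_map`: those of the two correction factors are positive, and
scaling exponents by a positive number preserves signs. -/
theorem map_mem_foxCone (l : F2 →* Multiplicative ℝ) {P : Set F2} (φ : F2 →* F2) (r : ℝ)
    (hr : 0 < r) (hl : ∀ g, (l (φ g)).toAdd = r * (l g).toAdd) (hb : 0 < (l b).toAdd)
    (u : F2) (hu : φ c = u * c * u⁻¹) (hP : ∀ g ∈ P, φ g ∈ P) {g : F2} (hg : g ∈ foxCone l P) :
    φ g ∈ foxCone l P := by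
  rcases hg with hg | ⟨hg, hg'⟩
  · left; rw [hl]; exact mul_pos hr hg
  · right
    have hφg : l (φ g) = 1 := by
      have := hl g
      rw [hg] at this
      simpa using this
    have key := fox_map l φ r hr hl hb.ne' u hu g hg
    have hb1 : 0 < (RealHahn.scale r hr (1 - monomial l b)).leadingCoeff :=
      RealHahn.leadingCoeff_scale_pos r hr (by rw [leadingCoeff_one_sub_monomial l hb]; exact one_pos)
    refine ⟨hφg, ?_⟩
    rcases hg' with hg' | ⟨hg', hg''⟩
    · left
      have h1 := congrArg HahnSeries.leadingCoeff key
      rw [HahnSeries.leadingCoeff_mul, HahnSeries.leadingCoeff_mul, HahnSeries.leadingCoeff_mul,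
        leadingCoeff_monomial, leadingCoeff_one_sub_monomial l hb, one_mul, mul_one] at h1
      have h2 := RealHahn.leadingCoeff_scale_pos r hr hg'
      rw [← h1] at h2
      exact pos_of_mul_pos_left h2 hb1.le
    · right
      refine ⟨?_, hP _ hg''⟩
      rw [hg', map_zero, zero_mul] at key
      refine (mul_eq_zero.1 key).resolve_right ?_
      intro h
      rw [h] at hb1
      simp at hb1

theorem c_mem_foxCone (l : F2 →* Multiplicative ℝ) (P : Set F2) (hb : 0 < (l b).toAdd) :
    c ∈ foxCone l P := by
  refine Or.inr ⟨l_c l, Or.inl ?_⟩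
  rw [fox_c, leadingCoeff_one_sub_monomial l hb]
  exact one_pos

/-- With β = `l b` > 0 the derivative is (1 - T^β)(T^(-2β) - T^(-β) - 1), whose lowest exponent -2β
has coefficient 1. -/
theorem w_mem_foxCone (l : F2 →* Multiplicative ℝ) (P : Set F2) (hb : 0 < (l b).toAdd) :
    c⁻¹ * w ∈ foxCone l P := by
  have hlc : l c⁻¹ = 1 := by rw [map_inv, l_c, inv_one]
  have h1 : l (b⁻¹ * c * b⁻¹⁻¹) = 1 := by rw [map_mul, map_mul, l_c]; simp
  have h2 : l (b⁻¹ * c * b⁻¹⁻¹ * c⁻¹) = 1 := by rw [map_mul, h1, hlc, one_mul]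
  have h3 : l w = 1 := by rw [map_mul, map_mul, h2]; simp
  have hmon : ∀ {g}, l g = 1 → monomial l g = 1 := fun h => by rw [monomial_apply, h]; simp
  refine Or.inr ⟨by rw [map_mul, hlc, h3, one_mul], Or.inl ?_⟩
  have h4 : fox l (c⁻¹ * w) =
      (1 - monomial l b) * (monomial l (b⁻¹ * b⁻¹) - (monomial l b⁻¹ + 1)) := by
    rw [fox_mul, fox_conj l b⁻¹ _ h2, fox_mul, fox_conj l b⁻¹ _ (l_c l), fox_inv, hmon hlc, hmon h1,
      fox_c, map_mul]
    ring
  rw [h4, HahnSeries.leadingCoeff_mul, leadingCoeff_one_sub_monomial l hb, one_mul, sub_eq_add_neg,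
    HahnSeries.leadingCoeff_add_eq_left, leadingCoeff_monomial]
  · exact one_pos
  · rw [HahnSeries.orderTop_neg]
    have h5 : (monomial l b⁻¹ + 1).orderTop = (monomial l b⁻¹).orderTop := by
      apply HahnSeries.orderTop_add_eq_left
      rw [monomial_apply, HahnSeries.orderTop_single one_ne_zero, HahnSeries.orderTop_one]
      rw [map_inv, toAdd_inv]
      exact_mod_cast neg_lt_zero.2 hb
    rw [h5, monomial_apply, monomial_apply, HahnSeries.orderTop_single one_ne_zero,
      HahnSeries.orderTop_single one_ne_zero]
    simp only [map_mul, map_inv, toAdd_mul, toAdd_inv]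
    exact_mod_cast (by linarith : -(l b).toAdd + -(l b).toAdd < -(l b).toAdd)

end F2

/-! ### The lower central series and the order for a hyperbolic matrix. -/

theorem map_mem_lcs {G K : Type*} [Group G] [Group K] (f : G →* K) {n : ℕ} {g : G}
    (hg : g ∈ lcs G n) : f g ∈ lcs K n := by
  have h : f g ∈ (lcs G n).map f := Subgroup.mem_map_of_mem f hg
  rw [lcs, Subgroup.map_lowerCentralSeries] at h
  exact Subgroup.lowerCentralSeries_mono n le_top h

namespace F2

theorem w_mem_lcs : w ∈ lcs F2 2 := by
  have hn : ∀ n, (lcs F2 n).Normal := fun n => inferInstance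
  have hc : c ∈ lcs F2 1 := by
    rw [lcs, Subgroup.lowerCentralSeries_succ]
    exact Subgroup.commutator_mem_commutator (Subgroup.mem_top a) (Subgroup.mem_top b)
  have hbc : b⁻¹ * c * b⁻¹⁻¹ * c⁻¹ ∈ lcs F2 2 := by
    have h : c * b⁻¹ * c⁻¹ * b⁻¹⁻¹ ∈ lcs F2 2 := by
      rw [lcs, Subgroup.lowerCentralSeries_succ]
      exact Subgroup.commutator_mem_commutator hc (Subgroup.mem_top b⁻¹)
    have h' := (lcs F2 2).inv_mem h
    convert h' using 1
    group
  exact (hn 2).conj_mem _ hbc b⁻¹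

/-- The dihedral group of order eight is nilpotent of class two and generated by two elements that
do not commute, so it detects the commutator modulo the third term (index 2 here). -/
theorem c_notMem_lcs : c ∉ lcs F2 2 := by
  intro h
  let f : F2 →* DihedralGroup 4 := FreeGroup.lift ![DihedralGroup.r 1, DihedralGroup.sr 0]
  have h1 : lcs (DihedralGroup 4) 2 = ⊥ := by
    have h0 : ∀ x y z : DihedralGroup 4, z * (x * y * x⁻¹ * y⁻¹) = (x * y * x⁻¹ * y⁻¹) * z := by
      decide
    refine Subgroup.lowerCentralSeries_succ_eq_bot _ ?_
    rw [Subgroup.lowerCentralSeries_succ, Subgroup.commutator_le]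
    intro x _ y _
    exact Subgroup.mem_center_iff.2 fun z => h0 x y z
  have h2 : f c ∈ lcs (DihedralGroup 4) 2 := map_mem_lcs f h
  rw [h1, Subgroup.mem_bot] at h2
  have h3 : f c = DihedralGroup.r 1 * DihedralGroup.sr 0 * (DihedralGroup.r 1)⁻¹ *
    (DihedralGroup.sr 0)⁻¹ := by simp [f]
  rw [h3] at h2
  exact absurd h2 (by decide)

/-- The bi-order on the free group preserved by a hyperbolic automorphism. -/
theorem exists_nonstandard_cone (φ : F2 →* F2) (hdet : (exponentMatrix φ).det = 1)
    (htr : 3 ≤ (exponentMatrix φ).trace) (u : F2) (hu : φ c = u * c * u⁻¹) :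
    ∃ P : Set F2, IsPositiveCone P ∧ (∀ g ∈ P, φ g ∈ P) ∧ c ∈ P ∧ c⁻¹ * w ∈ P := by
  obtain ⟨M, hM⟩ : ∃ M, M = exponentMatrix φ := ⟨_, rfl⟩
  rw [← hM, Matrix.det_fin_two] at hdet
  rw [← hM, Matrix.trace_fin_two] at htr
  -- Otherwise the diagonal entries are both 1 or both -1, and the trace is below 3.
  have hq : (M 0 1 : ℝ) ≠ 0 := by
    intro h
    have h0 : M 0 1 = 0 := by exact_mod_cast h
    rw [h0] at hdet
    have h1 : M 0 0 * M 1 1 = 1 := by linarith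
    rcases Int.eq_one_or_neg_one_of_mul_eq_one' h1 with ⟨h2, h3⟩ | ⟨h2, h3⟩ <;> omega
  have hdet' : (M 0 0 : ℝ) * M 1 1 - M 0 1 * M 1 0 = 1 := by exact_mod_cast hdet
  have htr' : (3 : ℝ) ≤ M 0 0 + M 1 1 := by exact_mod_cast htr
  set t : ℝ := M 0 0 + M 1 1 with ht
  have hdisc : 0 < t ^ 2 - 4 := by nlinarith
  set d : ℝ := Real.sqrt (t ^ 2 - 4) with hd
  have hd2 : d ^ 2 = t ^ 2 - 4 := Real.sq_sqrt hdisc.le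
  have hd0 : 0 < d := Real.sqrt_pos.2 hdisc
  set x : ℝ := (t + d) / 2 with hx
  set y : ℝ := (t - d) / 2 with hy
  have hx2 : x ^ 2 - t * x + 1 = 0 := by rw [hx]; linear_combination (1 / 4) * hd2
  have hy2 : y ^ 2 - t * y + 1 = 0 := by rw [hy]; linear_combination (1 / 4) * hd2
  have hx0 : 0 < x := by positivity
  have hxy : x * y = 1 := by rw [hx, hy]; linear_combination (-1 / 4) * hd2
  have hy0 : 0 < y := pos_of_mul_pos_right (by rw [hxy]; exact one_pos) hx0.le
  have heig : ∀ z : ℝ, z ^ 2 - t * z + 1 = 0 →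
      ((exponentMatrix φ).map (Int.cast : ℤ → ℝ)).mulVec ![(M 0 1 : ℝ), z - M 0 0] =
        z • ![(M 0 1 : ℝ), z - M 0 0] := by
    intro z hz
    rw [← hM]
    ext i
    fin_cases i
    · simp [Matrix.mulVec, dotProduct]
      ring
    · simp [Matrix.mulVec, dotProduct]
      linear_combination -hdet' - hz + z * ht
  obtain ⟨P, hP, hφP⟩ := exists_invariant_standard_cone φ _ _ x y hx0 hy0 (heig x hx2) (heig y hy2)
    (by
      have : (![(M 0 1 : ℝ), x - M 0 0] 0) * (![(M 0 1 : ℝ), y - M 0 0] 1) -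
          (![(M 0 1 : ℝ), x - M 0 0] 1) * (![(M 0 1 : ℝ), y - M 0 0] 0) = -(M 0 1 * d) := by
        simp [hx, hy]; ring
      rw [this]
      exact neg_ne_zero.2 (mul_ne_zero hq hd0.ne'))
  -- The row (e, 1) is a left eigenvector for `x`, normalized so that `l b` is 1.
  let e : ℝ := (x - M 1 1) / M 0 1
  let l : F2 →* Multiplicative ℝ := FreeGroup.lift ![Multiplicative.ofAdd e, Multiplicative.ofAdd 1]
  have he : e * M 0 1 = x - M 1 1 := div_mul_cancel₀ _ hq
  have hlg : ∀ g, (l g).toAdd = e * (exponentSum 0 g).toAdd + (exponentSum 1 g).toAdd := by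
    intro g
    rw [hom_apply_eq l g]
    simp [l, mul_comm, add_comm]
  have hl : ∀ g, (l (φ g)).toAdd = x * (l g).toAdd := by
    intro g
    rw [hlg, hlg, exponentSum_map, exponentSum_map, ← hM]
    simp only [Fin.sum_univ_two, Int.cast_add, Int.cast_mul]
    have h1 : e * M 0 0 + M 1 0 = x * e := by
      apply mul_right_cancel₀ hq
      linear_combination (M 0 0 - x) * he - hdet' - hx2 + x * ht
    linear_combination ((exponentSum 0 g).toAdd : ℝ) * h1 + ((exponentSum 1 g).toAdd : ℝ) * he
  have hb : 0 < (l b).toAdd := by simp [l]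
  exact ⟨foxCone l P, isPositiveCone_foxCone l hP,
    fun g hg => map_mem_foxCone l φ x hx0 hl hb u hu hφP hg, c_mem_foxCone l P hb,
    w_mem_foxCone l P hb⟩

end F2

/-! ### Orders on extensions -/

theorem isBiOrder_of_isPositiveCone {G : Type*} [Group G] {P : Set G} (hP : IsPositiveCone P) :
    IsBiOrder fun x y : G => x⁻¹ * y ∈ P where
  strictTotal :=
    { trichotomous := fun x y h1 h2 => by
        rcases hP.total (x⁻¹ * y) with h | h | h
        · exact absurd h h1
        · rw [mul_inv_rev, inv_inv] at h
          exact absurd h h2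
        · exact inv_mul_eq_one.1 h
      irrefl := fun x h => hP.one_notMem (by simpa using h)
      trans := fun x y z hxy hyz => by simpa [mul_assoc] using hP.mul_mem _ hxy _ hyz }
  mul_left x y z h := by simpa [mul_assoc] using h
  mul_right x y z h := by simpa [mul_assoc] using hP.conj_mem _ h z

/-- In a standard order the sign of g is read off at a level before `n`, where multiplication by f
changes nothing. There g⁻¹f has the class inverse to that of g, so the two cannot both be positive.
-/
theorem not_isStandardBiOrder_of_lt {G : Type*} [Group G] {lt : G → G → Prop} (hlt : IsBiOrder lt)
    {g f : G} {n : ℕ} (hf : f ∈ lcs G n) (hg : g ∉ lcs G n) (h1 : lt 1 g) (h2 : lt g f) :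
    ¬ IsStandardBiOrder lt := by
  rintro ⟨-, P, hP, hPg⟩
  have h3 : lt 1 (g⁻¹ * f) := by simpa using hlt.mul_left _ _ g⁻¹ h2
  obtain ⟨m, hgm, hgm', hgP⟩ := (hPg g).1 h1
  obtain ⟨k, hfk, hfk', hfP⟩ := (hPg _).1 h3
  have hanti : Antitone (lcs G) := Subgroup.lowerCentralSeries_antitone _
  have hmn : m + 1 ≤ n := by
    by_contra h
    exact hg (hanti (by omega) hgm)
  have hfm : f ∈ lcs G (m + 1) := hanti hmn hf
  have hfm' : f ∈ lcs G m := hanti (Nat.le_succ m) hfm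
  have hk : k = m := by
    rcases lt_trichotomy k m with h | h | h
    · exact absurd (hanti h ((lcs G m).mul_mem ((lcs G m).inv_mem hgm) hfm')) hfk'
    · exact h
    · have h4 := hanti h hfk
      refine absurd ?_ hgm'
      have h5 := (lcs G (m + 1)).mul_mem hfm ((lcs G (m + 1)).inv_mem h4)
      simpa using h5
  subst hk
  refine (hP k).inv_notMem _ hgP ?_
  convert hfP using 1
  rw [← QuotientGroup.mk_inv, QuotientGroup.eq, Subgroup.mem_subgroupOf]
  simpa using hfm

/-- A cone on the free group preserved by an endomorphism `φ` extends to a bi-order of an extension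
of the integers in which a generator acts by `φ`. -/
theorem exists_nonstandard_biOrder_of_extension {E : Type*} [Group E] (i : F2 →* E)
    (hi : Function.Injective i) (H : Subgroup E) (hH : i.range = H) (p : E →* Multiplicative ℤ)
    (hp : p.ker = H) (t : E) (ht : p t = Multiplicative.ofAdd 1) (φ : F2 →* F2)
    (hφ : ∀ f, t * i f * t⁻¹ = i (φ f)) (P : Set F2) (hP : IsPositiveCone P)
    (hφP : ∀ g ∈ P, φ g ∈ P) (hc : F2.c ∈ P) (hw : F2.c⁻¹ * F2.w ∈ P) :
    ∃ lt : E → E → Prop, IsBiOrder lt ∧ ¬ IsStandardBiOrder (restrictOrder lt H) ∧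
      ¬ IsConvexSubgroup (restrictOrder lt H) (lcs H 2) := by
  have hker : ∀ g, p g = 1 ↔ ∃ f, i f = g := fun g => by
    rw [← MonoidHom.mem_ker, hp, ← hH]; exact MonoidHom.mem_range
  have hpi : ∀ f, p (i f) = 1 := fun f => (hker _).2 ⟨f, rfl⟩
  -- The elements whose conjugation preserves the cone. It is to be shown that they are all of `E`.
  let N : Submonoid E :=
    { carrier := {g | ∀ f ∈ P, ∃ f' ∈ P, i f' = g⁻¹ * i f * g}
      one_mem' := fun f hf => ⟨f, hf, by simp⟩
      mul_mem' := by
        rintro g h hg hh f hf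
        obtain ⟨f', hf', e⟩ := hg f hf
        obtain ⟨f'', hf'', e'⟩ := hh f' hf'
        exact ⟨f'', hf'', by rw [e', e]; group⟩ }
  have hNi : ∀ f, i f ∈ N := fun f g hg => ⟨_, hP.conj_mem g hg f, by simp⟩
  have hNt' : t⁻¹ ∈ N := fun f hf => ⟨φ f, hφP f hf, by rw [← hφ, inv_inv]⟩
  -- A total order preserved by φ is also preserved by its inverse: a negative preimage would have a
  -- negative image.
  have hNt : t ∈ N := by
    intro f hf
    obtain ⟨f', hf'⟩ := (hker (t⁻¹ * i f * t)).1 (by simp [hpi])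
    refine ⟨f', ?_, hf'⟩
    have h1 : φ f' = f := hi (by rw [← hφ, hf']; group)
    rcases hP.total f' with h | h | h
    · exact h
    · refine absurd (hφP _ h) ?_
      rw [map_inv, h1]
      exact hP.inv_notMem f hf
    · rw [h, map_one] at h1
      exact absurd (h1 ▸ hf) hP.one_notMem
  have hN : ∀ g, g ∈ N := by
    intro g
    have htn : ∀ n : ℤ, t ^ n ∈ N := by
      intro n
      obtain ⟨n, rfl | rfl⟩ := n.eq_nat_or_neg
      · rw [zpow_natCast]; exact N.pow_mem hNt n
      · rw [zpow_neg, zpow_natCast, ← inv_pow]; exact N.pow_mem hNt' n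
    obtain ⟨f, hf⟩ := (hker (g * t ^ (-(p g).toAdd))).1 (by
      rw [map_mul, map_zpow, ht, ← ofAdd_zsmul]
      simp)
    have h1 : g = i f * t ^ (p g).toAdd := by rw [hf]; simp
    rw [h1]
    exact N.mul_mem (hNi f) (htn _)
  -- Lexicographic order of the extension, with the integer quotient compared first.
  let Q : Set E := {g | 0 < (p g).toAdd ∨ ∃ f ∈ P, i f = g}
  have hQ : IsPositiveCone Q := by
    refine ⟨?_, ?_, ?_, ?_, ?_⟩
    · rintro g (hg | ⟨f, hf, rfl⟩) h (hh | ⟨f', hf', rfl⟩)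
      · left; rw [map_mul, toAdd_mul]; exact add_pos hg hh
      · left; rw [map_mul, hpi, mul_one]; exact hg
      · left; rw [map_mul, hpi, one_mul]; exact hh
      · exact Or.inr ⟨f * f', hP.mul_mem _ hf _ hf', map_mul _ _ _⟩
    · rintro (h | ⟨f, hf, h⟩)
      · simp at h
      · rw [← map_one i] at h
        exact hP.one_notMem (hi h ▸ hf)
    · rintro g (hg | ⟨f, hf, rfl⟩) (h | ⟨f', hf', h⟩)
      · rw [map_inv, toAdd_inv] at h; omega
      · have := hpi f'
        rw [h, map_inv, inv_eq_one] at this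
        rw [this] at hg; simp at hg
      · rw [map_inv, hpi] at h; simp at h
      · rw [← map_inv] at h
        exact hP.inv_notMem f hf (hi h ▸ hf')
    · intro g
      rcases lt_trichotomy 0 (p g).toAdd with h | h | h
      · exact Or.inl (Or.inl h)
      · obtain ⟨f, rfl⟩ := (hker g).1 h.symm
        rcases hP.total f with h1 | h1 | h1
        · exact Or.inl (Or.inr ⟨f, h1, rfl⟩)
        · exact Or.inr (Or.inl (Or.inr ⟨_, h1, map_inv _ _⟩))
        · exact Or.inr (Or.inr (by rw [h1, map_one]))
      · refine Or.inr (Or.inl (Or.inl ?_))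
        rw [map_inv, toAdd_inv]; omega
    · rintro g (hg | ⟨f, hf, rfl⟩) h
      · left
        rw [map_mul p, map_mul p, map_inv p, inv_mul_cancel_comm]
        exact hg
      · exact Or.inr (hN h f hf)
  have hlt := isBiOrder_of_isPositiveCone hQ
  refine ⟨_, hlt, ?_⟩
  have hltH : IsBiOrder (restrictOrder (fun x y : E => x⁻¹ * y ∈ Q) H) := by
    have hst := hlt.strictTotal
    refine ⟨{ trichotomous := ?_, irrefl := ?_, trans := ?_ }, ?_, ?_⟩
    · intro x y h1 h2; exact Subtype.ext (hst.trichotomous _ _ h1 h2)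
    · intro x; exact hst.irrefl x.1
    · intro x y z; exact hst.trans x.1 y.1 z.1
    · intro x y z; exact hlt.mul_left x.1 y.1 z.1
    · intro x y z; exact hlt.mul_right x.1 y.1 z.1
  let e : F2 ≃* H := (MonoidHom.ofInjective hi).trans (MulEquiv.subgroupCongr hH)
  have he : ∀ f, (e f : E) = i f := fun f => rfl
  have hcH : e F2.c ∉ lcs H 2 := by
    intro h
    have h2 : e.symm (e F2.c) ∈ lcs F2 2 := map_mem_lcs e.symm.toMonoidHom h
    rw [e.symm_apply_apply] at h2
    exact F2.c_notMem_lcs h2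
  have hwH : e F2.w ∈ lcs H 2 :=
    map_mem_lcs e.toMonoidHom F2.w_mem_lcs
  have h1 : restrictOrder (fun x y : E => x⁻¹ * y ∈ Q) H 1 (e F2.c) :=
    Or.inr ⟨F2.c, hc, by simp [he]⟩
  have h2 : restrictOrder (fun x y : E => x⁻¹ * y ∈ Q) H (e F2.c) (e F2.w) :=
    Or.inr ⟨_, hw, by rw [map_mul, map_inv]; rfl⟩
  exact ⟨not_isStandardBiOrder_of_lt hltH hwH hcH h1 h2, fun h =>
    hcH (h 1 (Subgroup.one_mem _) _ hwH _ h1 h2)⟩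

/-! ### The word metric of a free group -/

namespace FreeGroup

theorem IsReduced.of_contiguous {α : Type*} {L₁ L₂ : List (α × Bool)} (h : IsReduced L₂)
    (hL : L₁ <:+: L₂) : IsReduced L₁ := by
  obtain ⟨s, t, rfl⟩ := hL
  exact (List.IsChain.left_of_append h).right_of_append

variable {α : Type*} [DecidableEq α]

/-- Twice the number of letters that cancel in a product. -/
def cancellation (x y : FreeGroup α) : ℤ := x.norm + y.norm - (x * y).norm

theorem norm_inv_mul_le {x y : FreeGroup α} {p r s : List (α × Bool)} (hx : x.toWord = p ++ r)
    (hy : y.toWord = p ++ s) : (x⁻¹ * y).norm ≤ r.length + s.length := by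
  have hx' : x = mk p * mk r := by rw [mul_mk, ← hx, mk_toWord]
  have hy' : y = mk p * mk s := by rw [mul_mk, ← hy, mk_toWord]
  have : x⁻¹ * y = mk (invRev r ++ s) := by
    rw [hx', hy', ← mul_mk, ← inv_mk]; group
  rw [this]
  refine norm_mk_le.trans ?_
  simp

/-- After the longest common prefix is removed the two remainders begin with different letters, so
nothing more cancels. -/
theorem exists_commonStart_of_isReduced (L M : List (α × Bool)) (hL : IsReduced L) (hM : IsReduced M) :
    ∃ p r s : List (α × Bool), L = p ++ r ∧ M = p ++ s ∧
      ((mk L)⁻¹ * mk M).norm = r.length + s.length := by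
  induction L generalizing M with
  | nil =>
    refine ⟨[], [], M, rfl, rfl, ?_⟩
    have : ((mk ([] : List (α × Bool)))⁻¹ * mk M) = mk M := by rw [← one_eq_mk]; simp
    rw [this, norm, toWord_mk, hM.reduce_eq]
    simp
  | cons h L ih =>
    cases M with
    | nil =>
      refine ⟨[], h :: L, [], rfl, rfl, ?_⟩
      rw [← one_eq_mk, mul_one, norm_inv_eq, norm, toWord_mk, hL.reduce_eq]
      simp
    | cons k M =>
      by_cases hk : h = k
      · subst hk
        obtain ⟨p, r, s, h1, h2, h3⟩ := ih M hL.tail hM.tail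
        refine ⟨h :: p, r, s, by rw [h1]; rfl, by rw [h2]; rfl, ?_⟩
        rw [← h3]
        congr 1
        rw [← List.singleton_append, ← List.singleton_append (l := M), ← mul_mk, ← mul_mk]
        group
      · refine ⟨[], h :: L, k :: M, rfl, rfl, ?_⟩
        rw [inv_mk, mul_mk, norm, toWord_mk]
        have hinv : IsReduced (invRev (h :: L)) := by
          rw [isReduced_iff_reduce_eq, reduce_invRev, hL.reduce_eq]
        have hred : IsReduced (invRev (h :: L) ++ k :: M) := by
          refine List.IsChain.append hinv hM ?_
          intro x hx y hy
          rw [invRev_cons] at hx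
          simp [invRev] at hx hy
          subst hx hy
          intro h1
          by_contra h2
          apply hk
          refine Prod.ext h1 ?_
          simpa using h2
        rw [hred.reduce_eq]
        simp

theorem exists_commonStart (x y : FreeGroup α) : ∃ p r s : List (α × Bool),
    x.toWord = p ++ r ∧ y.toWord = p ++ s ∧ (x⁻¹ * y).norm = r.length + s.length := by
  obtain ⟨p, r, s, h1, h2, h3⟩ :=
    exists_commonStart_of_isReduced x.toWord y.toWord isReduced_toWord isReduced_toWord
  rw [mk_toWord, mk_toWord] at h3
  exact ⟨p, r, s, h1, h2, h3⟩

/-- This is the doubled Gromov product in the Cayley tree: x⁻¹ and y share an initial segment, and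
exactly this segment cancels in xy. -/
theorem exists_cancellation_eq (x y : FreeGroup α) : ∃ p r s : List (α × Bool),
    x⁻¹.toWord = p ++ r ∧ y.toWord = p ++ s ∧ cancellation x y = 2 * p.length := by
  obtain ⟨p, r, s, h1, h2, h3⟩ := exists_commonStart x⁻¹ y
  refine ⟨p, r, s, h1, h2, ?_⟩
  rw [inv_inv] at h3
  have e1 : x.norm = p.length + r.length := by rw [← norm_inv_eq, norm, h1, List.length_append]
  have e2 : y.norm = p.length + s.length := by rw [norm, h2, List.length_append]
  rw [cancellation, h3, e1, e2]
  push_cast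
  ring

theorem cancellation_nonneg (x y : FreeGroup α) : 0 ≤ cancellation x y := by
  obtain ⟨p, r, s, -, -, h⟩ := exists_cancellation_eq x y
  omega

/-- The word metric satisfies the four point condition of a tree. -/
theorem min_cancellation_le (x y z : FreeGroup α) :
    min (cancellation x y) (cancellation y⁻¹ z) ≤ cancellation x z := by
  obtain ⟨p, r, s, h1, h2, h3⟩ := exists_cancellation_eq x y
  obtain ⟨p', r', s', h1', h2', h3'⟩ := exists_cancellation_eq y⁻¹ z
  rw [inv_inv] at h1'
  have key : ∀ q t u : List (α × Bool), x⁻¹.toWord = q ++ t → z.toWord = q ++ u →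
      2 * (q.length : ℤ) ≤ cancellation x z := by
    intro q t u ht hu
    have h := norm_inv_mul_le ht hu
    rw [inv_inv] at h
    have e1 : x.norm = q.length + t.length := by rw [← norm_inv_eq, norm, ht, List.length_append]
    have e2 : z.norm = q.length + u.length := by rw [norm, hu, List.length_append]
    rw [cancellation, e1, e2]
    push_cast
    omega
  rcases le_total p.length p'.length with hle | hle
  · obtain ⟨q, rfl⟩ : p <+: p' := List.prefix_of_prefix_length_le ⟨s, h2.symm⟩ ⟨r', h1'.symm⟩ hle
    rw [List.append_assoc] at h2'
    exact (min_le_left _ _).trans (h3 ▸ key p r _ h1 h2')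
  · obtain ⟨q, rfl⟩ : p' <+: p := List.prefix_of_prefix_length_le ⟨r', h1'.symm⟩ ⟨s, h2.symm⟩ hle
    rw [List.append_assoc] at h1
    exact (min_le_right _ _).trans (h3' ▸ key p' _ s' h1 h2')

theorem cancellation_inv_rev (x y : FreeGroup α) : cancellation y⁻¹ x⁻¹ = cancellation x y := by
  rw [cancellation, cancellation, ← mul_inv_rev, norm_inv_eq, norm_inv_eq, norm_inv_eq]
  ring

/-- If x and x⁻¹ agreed on at least half of their length, the overlap `q` would equal its own
inverse. Free groups have no torsion, so `q` is empty, and then x = 1. -/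
theorem cancellation_self_lt {x : FreeGroup α} (hx : x ≠ 1) : cancellation x x < x.norm := by
  obtain ⟨p, r, s, h1, h2, h3⟩ := exists_cancellation_eq x x
  rw [h3]
  by_contra hlt
  push Not at hlt
  rw [toWord_inv] at h1
  have h4 := congrArg invRev h1
  rw [invRev_invRev, invRev_append] at h4
  have hlen : p.length + s.length = x.norm := by rw [norm, h2, List.length_append]
  have hlen' : p.length + r.length = x.norm := by
    rw [norm, h4, List.length_append, invRev_length, invRev_length]; ring
  have hsp : s.length ≤ p.length := by omega
  rw [h4] at h2
  obtain ⟨q, hq⟩ : invRev r <+: p := List.prefix_of_prefix_length_le (l₃ := p ++ s)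
    ⟨invRev p, h2⟩ ⟨s, rfl⟩ (by rw [invRev_length]; omega)
  have hxq : invRev p = q ++ s := by
    have h5 := h2
    rw [← hq, List.append_assoc, List.append_cancel_left_eq] at h5
    rw [← hq, h5]
  have h6 : p = invRev s ++ invRev q := by
    have := congrArg invRev hxq
    rwa [invRev_invRev, invRev_append] at this
  have h7 : invRev r ++ q = invRev s ++ invRev q := hq.trans h6
  obtain ⟨-, h8⟩ := List.append_inj h7 (by simp; omega)
  have h9 : q = [] := by
    have hqred : mk q * mk q = 1 := by
      nth_rw 2 [h8]
      rw [← inv_mk, mul_inv_cancel]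
    have hq1 : mk q = 1 := by
      have h10 : (mk q) ^ 2 = 1 := by rw [pow_two]; exact hqred
      exact (pow_eq_one_iff_left (by norm_num)).1 h10
    have hqinf : IsReduced q := by
      refine (isReduced_toWord (x := x)).of_contiguous ⟨invRev r, s, ?_⟩
      rw [hq, h4, h2]
    have := congrArg toWord hq1
    rwa [toWord_mk, hqinf.reduce_eq, toWord_one] at this
  subst h9
  apply hx
  rw [← mk_toWord (x := x), h4, ← mul_mk, ← hq, List.append_nil, ← inv_mk (L := invRev r),
    mul_inv_cancel]

/-- A homomorphism between free groups such that less than half of the image of each generator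
cancels on the average does not decrease word length. -/
theorem norm_le_norm_map {β : Type*} [DecidableEq β] (φ : FreeGroup β →* FreeGroup α)
    (h1 : ∀ x y : β × Bool, (x.1 = y.1 → x.2 = y.2) →
      cancellation (φ (mk [x])) (φ (mk [y])) ≤ (φ (mk [y])).norm)
    (h2 : ∀ x y z : β × Bool, (x.1 = y.1 → x.2 = y.2) → (y.1 = z.1 → y.2 = z.2) →
      cancellation (φ (mk [x])) (φ (mk [y])) + cancellation (φ (mk [y])) (φ (mk [z])) <
        2 * (φ (mk [y])).norm) (g : FreeGroup β) : g.norm ≤ (φ g).norm := by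
  -- The induction carries two claims: cancellation at a junction sees only the image of the last
  -- letter, and each earlier letter leaves at least one letter of its image.
  have key : ∀ (l : List (β × Bool)) (x : β × Bool), IsReduced (l ++ [x]) →
      (l = [] ∨ ∃ l' y, l = l' ++ [y] ∧
        cancellation (φ (mk l)) (φ (mk [x])) = cancellation (φ (mk [y])) (φ (mk [x]))) ∧
      2 * (l.length : ℤ) + 2 * (φ (mk [x])).norm - cancellation (φ (mk l)) (φ (mk [x])) ≤
        2 * (φ (mk (l ++ [x]))).norm := by
    intro l
    induction l using List.reverseRecOn with
    | nil =>
      intro x _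
      refine ⟨Or.inl rfl, ?_⟩
      have := cancellation_nonneg (φ (mk [])) (φ (mk [x]))
      simp only [List.length_nil, List.nil_append]
      push_cast
      omega
    | append_singleton l y ih =>
      intro x hred
      have hredy : IsReduced (l ++ [y]) := hred.of_contiguous ⟨[], [x], rfl⟩
      obtain ⟨hA, hB⟩ := ih y hredy
      have hyx : y.1 = x.1 → y.2 = x.2 := by
        have := hred.of_contiguous (L₁ := [y, x]) ⟨l, [], by simp⟩
        simpa [IsReduced] using this
      set V := φ (mk (l ++ [y])) with hV
      set V' := φ (mk l) with hV'
      set X := φ (mk [x]) with hX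
      set Y := φ (mk [y]) with hY
      have hVV : V = V' * Y := by rw [hV, ← mul_mk, _root_.map_mul]
      have hlt : cancellation V' Y + cancellation Y X < 2 * Y.norm := by
        rcases hA with rfl | ⟨l', k, rfl, hk⟩
        · have e : cancellation V' Y = 0 := by
            rw [hV', ← one_eq_mk, _root_.map_one]; simp [cancellation]
          have := h2 y y x (fun _ => rfl) hyx
          have h3 := cancellation_nonneg (φ (mk [y])) (φ (mk [y]))
          rw [e]
          simp only [← hX, ← hY] at this h3
          omega
        · rw [hk]
          refine h2 k y x ?_ hyx
          have := hredy.of_contiguous (L₁ := [k, y]) ⟨l', [], by simp⟩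
          simpa [IsReduced] using this
      have hVY : cancellation V Y⁻¹ = 2 * Y.norm - cancellation V' Y := by
        have : V * Y⁻¹ = V' := by rw [hVV]; group
        rw [cancellation, cancellation, this, norm_inv_eq, hVV]
        ring
      -- The four point condition, used twice: the images `V` and `Y` share a longer final segment
      -- than the part of `Y` that cancels against `X`, so they cancel equally against it.
      have hcan : cancellation V X = cancellation Y X := by
        have e1 := min_cancellation_le V Y⁻¹ X
        have e2 := min_cancellation_le Y V⁻¹ X
        rw [inv_inv] at e1 e2
        have e3 : cancellation Y V⁻¹ = cancellation V Y⁻¹ := by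
          rw [← cancellation_inv_rev, inv_inv]
        rw [e3] at e2
        omega
      refine ⟨Or.inr ⟨l, y, rfl, hcan⟩, ?_⟩
      -- Cancellations are even, so the strict inequality improves to a gap of 2.
      have hpar : 2 ≤ 2 * (Y.norm : ℤ) - cancellation V' Y - cancellation Y X := by
        obtain ⟨p, -, -, -, -, e1⟩ := exists_cancellation_eq V' Y
        obtain ⟨q, -, -, -, -, e2⟩ := exists_cancellation_eq Y X
        omega
      have hnorm : ((φ (mk (l ++ [y] ++ [x]))).norm : ℤ) = V.norm + X.norm - cancellation V X := by
        rw [← mul_mk, _root_.map_mul, cancellation]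
        ring
      rw [hnorm, List.length_append]
      push_cast
      simp only [List.length_singleton]
      push_cast
      omega
  rcases List.eq_nil_or_concat g.toWord with h | ⟨l, x, h⟩
  · rw [norm, h]; simp
  · rw [List.concat_eq_append] at h
    have hred : IsReduced (l ++ [x]) := h ▸ isReduced_toWord
    obtain ⟨hA, hB⟩ := key l x hred
    have hg : g = mk (l ++ [x]) := by rw [← h, mk_toWord]
    have hgn : g.norm = l.length + 1 := by rw [norm, h]; simp
    rw [← hg] at hB
    have hX : 0 < (φ (mk [x])).norm := by
      have := h2 x x x (fun _ => rfl) (fun _ => rfl)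
      have h3 := cancellation_nonneg (φ (mk [x])) (φ (mk [x]))
      omega
    have hc : cancellation (φ (mk l)) (φ (mk [x])) ≤ (φ (mk [x])).norm := by
      rcases hA with rfl | ⟨l', y, rfl, hy⟩
      · rw [← one_eq_mk, _root_.map_one]; simp [cancellation]
      · rw [hy]
        refine h1 y x ?_
        have := hred.of_contiguous (L₁ := [y, x]) ⟨l', [], by simp⟩
        simpa [IsReduced] using this
    omega

end FreeGroup

/-! ### Automorphisms of the free group of rank two -/

namespace F2

open FreeGroup (mk cancellation)

/-- The action of an automorphism on the abelianization. -/
def autMatrix : MulAut F2 →* Matrix (Fin 2) (Fin 2) ℤ where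
  toFun φ := exponentMatrix φ.toMonoidHom
  map_one' := exponentMatrix_id
  map_mul' φ ψ := exponentMatrix_comp φ.toMonoidHom ψ.toMonoidHom

theorem aut_ext {φ ψ : MulAut F2} (ha : φ a = ψ a) (hb : φ b = ψ b) : φ = ψ := by
  have : φ.toMonoidHom = ψ.toMonoidHom := hom_ext ha hb
  ext x
  exact DFunLike.congr_fun this x

/-- The endomorphism with given values on the generators. -/
abbrev endo (x y : F2) : F2 →* F2 := FreeGroup.lift ![x, y]

/-- The automorphism `a ↦ ab`, `b ↦ b`. -/
def twistA : MulAut F2 :=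
  MonoidHom.toMulEquiv (endo (a * b) b) (endo (a * b⁻¹) b)
    (hom_ext (by simp) (by simp)) (hom_ext (by simp) (by simp))

/-- The automorphism `a ↦ a`, `b ↦ ba`. -/
def twistB : MulAut F2 :=
  MonoidHom.toMulEquiv (endo a (b * a)) (endo a (b * a⁻¹))
    (hom_ext (by simp) (by simp)) (hom_ext (by simp) (by simp))

@[simp] theorem twistA_a : twistA a = a * b := by simp [twistA]
@[simp] theorem twistA_b : twistA b = b := by simp [twistA]
@[simp] theorem twistB_a : twistB a = a := by simp [twistB]
@[simp] theorem twistB_b : twistB b = b * a := by simp [twistB]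
@[simp] theorem twistA_inv_a : twistA⁻¹ a = a * b⁻¹ := by
  rw [MulAut.inv_apply, MulEquiv.symm_apply_eq]; simp
@[simp] theorem twistA_inv_b : twistA⁻¹ b = b := by
  rw [MulAut.inv_apply, MulEquiv.symm_apply_eq]; simp
@[simp] theorem twistB_inv_a : twistB⁻¹ a = a := by
  rw [MulAut.inv_apply, MulEquiv.symm_apply_eq]; simp
@[simp] theorem twistB_inv_b : twistB⁻¹ b = b * a⁻¹ := by
  rw [MulAut.inv_apply, MulEquiv.symm_apply_eq]; simp

/-- The group generated by the inner automorphisms and the two twists. -/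
def twistGroup : Subgroup (MulAut F2) :=
  Subgroup.closure (Set.range MulAut.conj ∪ {twistA, twistB})

theorem conj_mem_twistGroup (g : F2) : MulAut.conj g ∈ twistGroup :=
  Subgroup.subset_closure (Or.inl ⟨g, rfl⟩)

theorem twistA_mem : twistA ∈ twistGroup := Subgroup.subset_closure (Or.inr (Or.inl rfl))

theorem twistB_mem : twistB ∈ twistGroup := Subgroup.subset_closure (Or.inr (Or.inr rfl))

theorem autMatrix_conj (g : F2) : autMatrix (MulAut.conj g) = 1 := by
  ext i j
  change (exponentSum i (g * _ * g⁻¹)).toAdd = _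
  simp [exponentSum_of, Matrix.one_apply]

theorem autMatrix_twistA : autMatrix twistA = !![1, 0; 1, 1] := by
  ext i j
  change (exponentSum i (twistA (FreeGroup.of j))).toAdd = _
  fin_cases i <;> fin_cases j <;> simp [exponentSum_of]

theorem autMatrix_twistB : autMatrix twistB = !![1, 1; 0, 1] := by
  ext i j
  change (exponentSum i (twistB (FreeGroup.of j))).toAdd = _
  fin_cases i <;> fin_cases j <;> simp [exponentSum_of]

theorem det_autMatrix_of_mem {ψ : MulAut F2} (hψ : ψ ∈ twistGroup) : (autMatrix ψ).det = 1 := by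
  refine Subgroup.closure_induction (p := fun ψ _ => (autMatrix ψ).det = 1) ?_ ?_ ?_ ?_ hψ
  · rintro _ (⟨g, rfl⟩ | rfl | rfl)
    · rw [autMatrix_conj]; simp
    · rw [autMatrix_twistA]; simp [Matrix.det_fin_two]
    · rw [autMatrix_twistB]; simp [Matrix.det_fin_two]
  · simp
  · intro x y _ _ hx hy
    rw [map_mul, Matrix.det_mul, hx, hy, one_mul]
  · intro x _ hx
    have h : (autMatrix (x⁻¹ * x)).det = 1 := by simp
    rwa [map_mul, Matrix.det_mul, hx, mul_one] at h

theorem mk_false (i : Fin 2) : (mk [(i, false)] : F2) = (FreeGroup.of i)⁻¹ := rfl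

theorem mk_true (i : Fin 2) : (mk [(i, true)] : F2) = FreeGroup.of i := rfl

theorem exists_transvection_of {i j : Fin 2} (hij : i ≠ j) (e : Bool) :
    ∃ ψ ∈ twistGroup, ψ (FreeGroup.of i) = FreeGroup.of i * mk [(j, e)] ∧
      ψ (FreeGroup.of j) = FreeGroup.of j := by
  fin_cases i <;> fin_cases j <;> first | exact absurd rfl hij | skip
  · cases e
    · exact ⟨twistA⁻¹, inv_mem twistA_mem, twistA_inv_a, twistA_inv_b⟩
    · exact ⟨twistA, twistA_mem, twistA_a, twistA_b⟩
  · cases e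
    · exact ⟨twistB⁻¹, inv_mem twistB_mem, twistB_inv_b, twistB_inv_a⟩
    · exact ⟨twistB, twistB_mem, twistB_b, twistB_a⟩

theorem exists_transvection {x z : Fin 2 × Bool} (hxz : z.1 ≠ x.1) :
    ∃ ψ ∈ twistGroup, ψ (mk [z]) = mk [z] * mk [x] ∧ ψ (mk [x]) = mk [x] := by
  obtain ⟨i, e⟩ := z
  obtain ⟨j, f⟩ := x
  have hfix : ∀ ψ : MulAut F2, ψ (FreeGroup.of j) = FreeGroup.of j →
      ∀ f : Bool, ψ (mk [(j, f)]) = mk [(j, f)] := by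
    rintro ψ h (_ | _)
    · rw [mk_false, map_inv, h]
    · exact h
  cases e
  · obtain ⟨ψ, h1, h2, h3⟩ := exists_transvection_of hxz (!f)
    have hinv : (mk [(j, !f)] : F2) = (mk [(j, f)])⁻¹ := by simp [FreeGroup.inv_mk, FreeGroup.invRev]
    have h4 := hfix ψ h3
    -- For an inverse letter z the twist gives xz; conjugation by x⁻¹ turns this into zx and fixes
    -- x.
    refine ⟨MulAut.conj (mk [(j, f)])⁻¹ * ψ, mul_mem (conj_mem_twistGroup _) h1, ?_, ?_⟩
    · have h2' : ψ (FreeGroup.of i) = FreeGroup.of i * mk [(j, !f)] := h2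
      rw [MulAut.mul_apply, mk_false, map_inv ψ, h2', hinv, MulAut.conj_apply]
      group
    · rw [MulAut.mul_apply, h4, MulAut.conj_apply]
      group
  · obtain ⟨ψ, h1, h2, h3⟩ := exists_transvection_of hxz f
    exact ⟨ψ, h1, h2, hfix ψ h3 f⟩

/-- The sum of the lengths of the images of the generators. -/
def totalLength (φ : MulAut F2) : ℕ := (φ a).norm + (φ b).norm

theorem norm_map_letter (φ : MulAut F2) (i : Fin 2) (e : Bool) :
    (φ (mk [(i, e)])).norm = (φ (FreeGroup.of i)).norm := by
  cases e
  · rw [mk_false, map_inv, FreeGroup.norm_inv_eq]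
  · rfl

theorem totalLength_eq (φ : MulAut F2) {x z : Fin 2 × Bool} (hxz : z.1 ≠ x.1) :
    totalLength φ = (φ (mk [z])).norm + (φ (mk [x])).norm := by
  obtain ⟨i, e⟩ := z
  obtain ⟨j, f⟩ := x
  rw [norm_map_letter, norm_map_letter, totalLength]
  fin_cases i <;> fin_cases j <;> first | exact absurd rfl hxz | skip
  · rfl
  · exact add_comm _ _

theorem map_letter_ne_one (φ : MulAut F2) (x : Fin 2 × Bool) : φ (mk [x]) ≠ 1 := by
  intro h
  rw [map_eq_one_iff φ φ.injective] at h
  have := congrArg FreeGroup.norm h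
  simp [FreeGroup.norm, FreeGroup.toWord_mk] at this

/-- Replacing z by zx changes only one of the two lengths, so minimality forbids that zx has a
shorter image than z. -/
theorem cancellation_le_of_minimal {φ : MulAut F2}
    (hφ : ∀ ψ ∈ twistGroup, totalLength φ ≤ totalLength (φ * ψ))
    {x z : Fin 2 × Bool} (hxz : z.1 ≠ x.1) :
    cancellation (φ (mk [z])) (φ (mk [x])) ≤ (φ (mk [x])).norm := by
  obtain ⟨ψ, h1, h2, h3⟩ := exists_transvection hxz
  have := hφ ψ h1
  rw [totalLength_eq φ hxz, totalLength_eq (φ * ψ) hxz, MulAut.mul_apply, MulAut.mul_apply, h2, h3,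
    map_mul] at this
  rw [cancellation]
  omega

theorem cancellation_le_of_minimal' {φ : MulAut F2}
    (hφ : ∀ ψ ∈ twistGroup, totalLength φ ≤ totalLength (φ * ψ))
    {x z : Fin 2 × Bool} (hxz : z.1 ≠ x.1) :
    cancellation (φ (mk [z])) (φ (mk [x])) ≤ (φ (mk [z])).norm := by
  have h := cancellation_le_of_minimal hφ (x := (z.1, !z.2)) (z := (x.1, !x.2)) hxz.symm
  have hinv : ∀ y : Fin 2 × Bool, (mk [(y.1, !y.2)] : F2) = (mk [y])⁻¹ := by
    intro y; simp [FreeGroup.inv_mk, FreeGroup.invRev]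
  rwa [hinv, hinv, map_inv, map_inv, FreeGroup.cancellation_inv_rev, FreeGroup.norm_inv_eq] at h

/-- The tie of Nielsen reduction: both halves of X cancel against Z. Then X = p'p⁻¹ and Z = p m
p'⁻¹. Passing from Z to ZX and conjugating by p leaves m and p⁻¹p', of total length smaller by |X|.
Inner automorphisms in the group make this move available. -/
theorem not_half_cancellation_of_minimal {φ : MulAut F2}
    (hφ : ∀ ψ ∈ twistGroup, totalLength φ ≤ totalLength (φ * ψ))
    {x z : Fin 2 × Bool} (hxz : z.1 ≠ x.1)
    (h1 : cancellation (φ (mk [z])) (φ (mk [x])) = (φ (mk [x])).norm)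
    (h2 : cancellation (φ (mk [x])) (φ (mk [z])) = (φ (mk [x])).norm) : False := by
  have hle := cancellation_le_of_minimal' hφ hxz
  have hX : φ (mk [x]) ≠ 1 := map_letter_ne_one φ x
  obtain ⟨ψ, hψ, hψ1, hψ2⟩ := exists_transvection hxz
  have hmin : ∀ q : F2, (φ (mk [z])).norm + (φ (mk [x])).norm ≤
      (q⁻¹ * (φ (mk [z]) * φ (mk [x])) * q).norm + (q⁻¹ * φ (mk [x]) * q).norm := by
    intro q
    have := hφ (MulAut.conj (φ⁻¹ q⁻¹) * ψ) (mul_mem (conj_mem_twistGroup _) hψ)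
    rw [totalLength_eq φ hxz, totalLength_eq _ hxz] at this
    simp only [MulAut.mul_apply, hψ1, hψ2, MulAut.conj_apply, MulAut.conj_inv_apply, map_mul,
      map_inv, MulAut.apply_inv_self] at this
    convert this using 2
    group
  generalize φ (mk [x]) = X at *
  generalize φ (mk [z]) = Z at *
  obtain ⟨p, r, s, e1, e2, e3⟩ := FreeGroup.exists_cancellation_eq X Z
  obtain ⟨p', r', s', f1, f2, f3⟩ := FreeGroup.exists_cancellation_eq Z X
  have hXl : X.norm = p.length + r.length := by
    rw [← FreeGroup.norm_inv_eq, FreeGroup.norm, e1, List.length_append]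
  have hXl' : X.norm = p'.length + s'.length := by rw [FreeGroup.norm, f2, List.length_append]
  have hZl : Z.norm = p.length + s.length := by rw [FreeGroup.norm, e2, List.length_append]
  have hZl' : Z.norm = p'.length + r'.length := by
    rw [← FreeGroup.norm_inv_eq, FreeGroup.norm, f1, List.length_append]
  have hXe : X = mk p' * (mk p)⁻¹ := by
    have g1 : X.toWord = FreeGroup.invRev r ++ FreeGroup.invRev p := by
      have := congrArg FreeGroup.invRev e1
      rwa [FreeGroup.toWord_inv, FreeGroup.invRev_invRev, FreeGroup.invRev_append] at this
    rw [f2] at g1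
    obtain ⟨-, g2⟩ := List.append_inj g1 (by simp; omega)
    rw [← FreeGroup.mk_toWord (x := X), f2, g2, ← FreeGroup.mul_mk, FreeGroup.inv_mk]
  have hZw : Z.toWord = FreeGroup.invRev r' ++ FreeGroup.invRev p' := by
    have := congrArg FreeGroup.invRev f1
    rwa [FreeGroup.toWord_inv, FreeGroup.invRev_invRev, FreeGroup.invRev_append] at this
  obtain ⟨m, hm⟩ : p <+: FreeGroup.invRev r' := List.prefix_of_prefix_length_le
    (l₃ := Z.toWord) ⟨s, e2.symm⟩ ⟨_, hZw.symm⟩ (by simp; omega)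
  have hml : p.length + m.length = r'.length := by
    have := congrArg List.length hm
    simpa using this
  have hZe : Z = mk p * mk m * (mk p')⁻¹ := by
    rw [← FreeGroup.mk_toWord (x := Z), hZw, ← hm, ← FreeGroup.mul_mk, ← FreeGroup.mul_mk,
      FreeGroup.inv_mk]
  have hq := hmin (mk p)
  have g1 : (mk p)⁻¹ * (Z * X) * mk p = mk m := by rw [hZe, hXe]; group
  have g2 : (mk p)⁻¹ * X * mk p = (mk p)⁻¹ * mk p' := by rw [hXe]; group
  rw [g1, g2] at hq
  have g3 : (mk m : F2).norm ≤ m.length := FreeGroup.norm_mk_le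
  have g4 : ((mk p)⁻¹ * mk p' : F2).norm ≤ p.length + p'.length :=
    (FreeGroup.norm_mul_le _ _).trans (add_le_add
      (by rw [FreeGroup.norm_inv_eq]; exact FreeGroup.norm_mk_le) FreeGroup.norm_mk_le)
  have hX0 : X.norm ≠ 0 := by rwa [ne_eq, FreeGroup.norm_eq_zero]
  omega

/-- Minimality bounds each cancellation by half of either factor. The strict bound needed at a
middle letter can fail only if both its halves cancel, and every such configuration is excluded. -/
theorem norm_le_norm_of_minimal {φ : MulAut F2}
    (hφ : ∀ ψ ∈ twistGroup, totalLength φ ≤ totalLength (φ * ψ)) (g : F2) : g.norm ≤ (φ g).norm := by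
  have hinv : ∀ y : Fin 2 × Bool, (mk [(y.1, !y.2)] : F2) = (mk [y])⁻¹ := by
    intro y; simp [FreeGroup.inv_mk, FreeGroup.invRev]
  have N1 : ∀ x y : Fin 2 × Bool, (x.1 = y.1 → x.2 = y.2) →
      cancellation (φ (mk [x])) (φ (mk [y])) ≤ (φ (mk [y])).norm := by
    intro x y h
    by_cases hxy : x.1 = y.1
    · rw [Prod.ext hxy (h hxy)]
      exact (FreeGroup.cancellation_self_lt (map_letter_ne_one φ y)).le
    · exact cancellation_le_of_minimal hφ hxy
  have N1' : ∀ x y : Fin 2 × Bool, (x.1 = y.1 → x.2 = y.2) →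
      cancellation (φ (mk [x])) (φ (mk [y])) ≤ (φ (mk [x])).norm := by
    intro x y h
    by_cases hxy : x.1 = y.1
    · rw [Prod.ext hxy (h hxy)]
      exact (FreeGroup.cancellation_self_lt (map_letter_ne_one φ y)).le
    · exact cancellation_le_of_minimal' hφ hxy
  refine FreeGroup.norm_le_norm_map φ.toMonoidHom N1 ?_ g
  intro x y z hxy hyz
  change cancellation (φ (mk [x])) (φ (mk [y])) + cancellation (φ (mk [y])) (φ (mk [z])) <
    2 * (φ (mk [y])).norm
  have i1 := N1 x y hxy
  have i2 := N1' y z hyz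
  have hself := FreeGroup.cancellation_self_lt (map_letter_ne_one φ y)
  by_contra hlt
  have j1 : cancellation (φ (mk [x])) (φ (mk [y])) = (φ (mk [y])).norm := by omega
  have j2 : cancellation (φ (mk [y])) (φ (mk [z])) = (φ (mk [y])).norm := by omega
  by_cases h1 : x.1 = y.1
  · rw [Prod.ext h1 (hxy h1)] at j1
    omega
  by_cases h2 : y.1 = z.1
  · rw [← Prod.ext h2 (hyz h2)] at j2
    omega
  have h3 : x.1 = z.1 := by omega
  by_cases h4 : x.2 = z.2
  · have h5 : x = z := Prod.ext h3 h4
    subst h5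
    exact not_half_cancellation_of_minimal hφ h1 j1 j2
  -- If the outer letters are mutually inverse, the four point condition makes the middle image
  -- cancel against itself by half, which is impossible.
  · have h5 : x = (z.1, !z.2) := Prod.ext h3 (by cases hx : x.2 <;> cases hz : z.2 <;> simp_all)
    rw [h5, hinv, map_inv] at j1
    have := FreeGroup.min_cancellation_le (φ (mk [y])) (φ (mk [z])) (φ (mk [y]))
    omega

theorem exists_letter_of_norm_eq_one {g : F2} (hg : g.norm = 1) : ∃ x, g = mk [x] := by
  obtain ⟨x, hx⟩ := List.length_eq_one_iff.1 hg
  exact ⟨x, by rw [← hx, FreeGroup.mk_toWord]⟩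

/-- The automorphism `a ↦ b`, `b ↦ a⁻¹` of order four. -/
def quarterTurn : MulAut F2 := MulAut.conj a⁻¹ * (twistB⁻¹ * twistA * twistB⁻¹)

@[simp] theorem quarterTurn_a : quarterTurn a = b := by
  simp only [quarterTurn, MulAut.mul_apply, twistB_inv_a, twistB_inv_b, twistA_a, twistA_b, map_mul,
    map_inv, MulAut.conj_inv_apply]
  group

@[simp] theorem quarterTurn_b : quarterTurn b = a⁻¹ := by
  simp only [quarterTurn, MulAut.mul_apply, twistB_inv_a, twistB_inv_b, twistA_a, twistA_b, map_mul,
    map_inv, MulAut.conj_inv_apply]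
  group

theorem quarterTurn_mem : quarterTurn ∈ twistGroup :=
  mul_mem (conj_mem_twistGroup _) (mul_mem (mul_mem (inv_mem twistB_mem) twistA_mem)
    (inv_mem twistB_mem))

/-- An automorphism of determinant one is a product of inner automorphisms and twists. -/
theorem mem_twistGroup_of_det_eq_one (φ : MulAut F2) (hdet : (autMatrix φ).det = 1) :
    φ ∈ twistGroup := by
  obtain ⟨ψ, hψ, hmin⟩ : ∃ ψ ∈ twistGroup, ∀ ψ' ∈ twistGroup,
      totalLength (φ * ψ) ≤ totalLength (φ * ψ') := by
    obtain ⟨ψ, h1, h2⟩ := WellFounded.has_min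
      (InvImage.wf (fun ψ => totalLength (φ * ψ)) Nat.lt_wfRel.wf)
      (twistGroup : Set (MulAut F2)) ⟨1, one_mem _⟩
    exact ⟨ψ, h1, fun ψ' h' => not_lt.1 (h2 ψ' h')⟩
  have hmin' : ∀ ψ' ∈ twistGroup, totalLength (φ * ψ) ≤ totalLength (φ * ψ * ψ') := by
    intro ψ' h'
    rw [mul_assoc]
    exact hmin _ (mul_mem hψ h')
  suffices h : φ * ψ ∈ twistGroup by
    have := mul_mem h (inv_mem hψ)
    rwa [mul_inv_cancel_right] at this
  have hdet' : (autMatrix (φ * ψ)).det = 1 := by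
    rw [map_mul, Matrix.det_mul, hdet, det_autMatrix_of_mem hψ, one_mul]
  generalize φ * ψ = θ at *
  clear hmin hdet
  -- Lengths do not decrease under θ, so preimages of the generators are single letters.
  have hnorm := norm_le_norm_of_minimal hmin'
  have hone : ∀ i : Fin 2, ∃ x, θ⁻¹ (FreeGroup.of i) = mk [x] := by
    intro i
    refine exists_letter_of_norm_eq_one ?_
    have h1 := hnorm (θ⁻¹ (FreeGroup.of i))
    rw [MulAut.apply_inv_self, FreeGroup.norm_of] at h1
    have h2 : (θ⁻¹ (FreeGroup.of i)).norm ≠ 0 := by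
      rw [ne_eq, FreeGroup.norm_eq_zero]
      exact map_letter_ne_one θ⁻¹ (i, true)
    omega
  have hdet2 : (autMatrix θ⁻¹).det = 1 := by
    have h : (autMatrix (θ⁻¹ * θ)).det = 1 := by simp
    rwa [map_mul, Matrix.det_mul, hdet', mul_one] at h
  rw [← inv_mem_iff]
  generalize θ⁻¹ = η at *
  obtain ⟨x, hx⟩ := hone 0
  obtain ⟨y, hy⟩ := hone 1
  have hm : ∀ i, autMatrix η i 0 = (exponentSum i (mk [x])).toAdd ∧
      autMatrix η i 1 = (exponentSum i (mk [y])).toAdd := fun i =>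
    ⟨congrArg (fun g => (exponentSum i g).toAdd) hx, congrArg (fun g => (exponentSum i g).toAdd) hy⟩
  rw [Matrix.det_fin_two, (hm 0).1, (hm 0).2, (hm 1).1, (hm 1).2] at hdet2
  have q2 := mul_mem quarterTurn_mem quarterTurn_mem
  have q3 := mul_mem q2 quarterTurn_mem
  -- Signed permutations of the generators of determinant one are the four powers of the quarter
  -- turn.
  have hmem : η = 1 ∨ η = quarterTurn ∨ η = quarterTurn * quarterTurn ∨
      η = quarterTurn * quarterTurn * quarterTurn := by
    obtain ⟨i, e⟩ := x
    obtain ⟨j, f⟩ := y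
    fin_cases i <;> fin_cases j <;> cases e <;> cases f <;>
      simp [mk_true, mk_false, exponentSum_of] at hdet2 hx hy
    · exact Or.inr (Or.inr (Or.inl (aut_ext (by simpa using hx) (by simpa using hy))))
    · exact Or.inl (aut_ext (by simpa using hx) (by simpa using hy))
    · exact Or.inr (Or.inr (Or.inr (aut_ext (by simpa using hx) (by simpa using hy))))
    · exact Or.inr (Or.inl (aut_ext (by simpa using hx) (by simpa using hy)))
  rcases hmem with rfl | rfl | rfl | rfl
  · exact one_mem _
  · exact quarterTurn_mem
  · exact q2
  · exact q3

/-- An automorphism of determinant one maps the commutator of the generators to a conjugate. -/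
theorem exists_map_commutator_eq (φ : MulAut F2) (hdet : (autMatrix φ).det = 1) :
    ∃ u, φ c = u * c * u⁻¹ := by
  refine Subgroup.closure_induction (p := fun φ _ => ∃ u, φ c = u * c * u⁻¹) ?_ ⟨1, by simp⟩ ?_ ?_
    (mem_twistGroup_of_det_eq_one φ hdet)
  · rintro _ (⟨g, rfl⟩ | rfl | rfl)
    · exact ⟨g, rfl⟩
    -- Both twists fix the commutator itself.
    · exact ⟨1, by simp only [map_mul, map_inv, twistA_a, twistA_b]; group⟩
    · exact ⟨1, by simp only [map_mul, map_inv, twistB_a, twistB_b]; group⟩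
  · rintro x y _ _ ⟨u, hu⟩ ⟨v, hv⟩
    refine ⟨x v * u, ?_⟩
    rw [MulAut.mul_apply, hv, map_mul, map_mul, hu, map_inv]
    group
  · rintro x _ ⟨u, hu⟩
    refine ⟨(x⁻¹ u)⁻¹, ?_⟩
    apply x.injective
    simp only [MulAut.apply_inv_self, map_mul x (x⁻¹ u)⁻¹, map_mul x ((x⁻¹ u)⁻¹ * c), map_inv x, hu]
    generalize c = k
    group

end F2

/-! ### Outer automorphisms of the free group of rank two -/

/-- A normal form in central extensions of `PSL(2, ℤ) = ℤ/2 * ℤ/3`. -/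
theorem exists_modular_normalForm {Q : Type*} [Group Q] {S U z : Q} (hS : S * S = z)
    (hz : z * z = 1) (hU : U * U * U = 1) (hzU : z * U = U * z) {g : Q}
    (hg : g ∈ Subgroup.closure {S, U}) :
    ∃ e u W s : Q, (e = 1 ∨ e = z) ∧ (u = 1 ∨ u = U ∨ u = U⁻¹) ∧
      W ∈ Submonoid.closure {S * U, z * (S * U⁻¹)} ∧ (s = 1 ∨ s = S) ∧ g = e * (u * (W * s)) := by
  have hzS : z * S = S * z := by rw [← hS, mul_assoc]
  have hUi : U * U = U⁻¹ := eq_inv_of_mul_eq_one_left hU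
  have hzUi : z * U⁻¹ = U⁻¹ * z := by rw [← hUi, ← mul_assoc, hzU, mul_assoc, hzU, mul_assoc]
  have hee : ∀ e : Q, e = 1 ∨ e = z → z * e = 1 ∨ z * e = z := by
    rintro _ (rfl | rfl)
    · exact Or.inr (mul_one _)
    · exact Or.inl hz
  have heS : ∀ e : Q, e = 1 ∨ e = z → S * e = e * S := by
    rintro _ (rfl | rfl)
    · simp
    · exact hzS.symm
  have heU : ∀ e : Q, e = 1 ∨ e = z → U * e = e * U := by
    rintro _ (rfl | rfl)
    · simp
    · exact hzU.symm
  have hez : ∀ e : Q, e = 1 ∨ e = z → e * z = z * e := by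
    rintro _ (rfl | rfl) <;> simp
  -- The shape is stable under left multiplication by either generator. Left multiplication by S
  -- splits a leading syllable of W, or forms a new one with `u`; the central factor `e` absorbs S²
  -- = z.
  have stepU : ∀ y : Q, (∃ e u W s : Q, (e = 1 ∨ e = z) ∧ (u = 1 ∨ u = U ∨ u = U⁻¹) ∧
      W ∈ Submonoid.closure {S * U, z * (S * U⁻¹)} ∧ (s = 1 ∨ s = S) ∧ y = e * (u * (W * s))) →
      ∃ e u W s : Q, (e = 1 ∨ e = z) ∧ (u = 1 ∨ u = U ∨ u = U⁻¹) ∧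
      W ∈ Submonoid.closure {S * U, z * (S * U⁻¹)} ∧ (s = 1 ∨ s = S) ∧
      U * y = e * (u * (W * s)) := by
    rintro _ ⟨e, u, W, s, he, hu, hW, hs, rfl⟩
    refine ⟨e, U * u, W, s, he, ?_, hW, hs, ?_⟩
    · rcases hu with rfl | rfl | rfl
      · simp
      · exact Or.inr (Or.inr hUi)
      · simp
    · rw [← mul_assoc, heU e he]; simp only [mul_assoc]
  have stepS : ∀ y : Q, (∃ e u W s : Q, (e = 1 ∨ e = z) ∧ (u = 1 ∨ u = U ∨ u = U⁻¹) ∧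
      W ∈ Submonoid.closure {S * U, z * (S * U⁻¹)} ∧ (s = 1 ∨ s = S) ∧ y = e * (u * (W * s))) →
      ∃ e u W s : Q, (e = 1 ∨ e = z) ∧ (u = 1 ∨ u = U ∨ u = U⁻¹) ∧
      W ∈ Submonoid.closure {S * U, z * (S * U⁻¹)} ∧ (s = 1 ∨ s = S) ∧
      S * y = e * (u * (W * s)) := by
    rintro _ ⟨e, u, W, s, he, hu, hW, hs, rfl⟩
    rw [← mul_assoc S e, heS e he, mul_assoc e S]
    rcases hu with rfl | rfl | rfl
    · rw [one_mul]
      induction hW using Submonoid.closure_induction_left with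
      | one =>
        rcases hs with rfl | rfl
        · exact ⟨e, 1, 1, S, he, Or.inl rfl, one_mem _, Or.inr rfl, by simp⟩
        · exact ⟨z * e, 1, 1, 1, hee e he, Or.inl rfl, one_mem _, Or.inl rfl, by
            rw [one_mul, hS, hez e he]; simp⟩
      | mul_left x hx W hW _ =>
        rcases hx with rfl | rfl
        · refine ⟨z * e, U, W, s, hee e he, Or.inr (Or.inl rfl), hW, hs, ?_⟩
          rw [← hez e he, ← hS]
          simp only [mul_assoc]
        · refine ⟨e, U⁻¹, W, s, he, Or.inr (Or.inr rfl), hW, hs, ?_⟩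
          have : S * (z * (S * U⁻¹)) = U⁻¹ := by
            rw [← mul_assoc, ← hzS, mul_assoc, ← mul_assoc S, hS, ← mul_assoc, hz, one_mul]
          calc _ = e * (S * (z * (S * U⁻¹)) * (W * s)) := by simp only [mul_assoc]
            _ = _ := by rw [this]
    · refine ⟨e, 1, S * u * W, s, he, Or.inl rfl, mul_mem (Submonoid.subset_closure (Or.inl rfl)) hW,
        hs, ?_⟩
      simp only [mul_assoc, one_mul]
    · refine ⟨z * e, 1, z * (S * U⁻¹) * W, s, hee e he, Or.inl rfl,
        mul_mem (Submonoid.subset_closure (Or.inr rfl)) hW, hs, ?_⟩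
      have : z * e * z = e := by rw [mul_assoc, hez e he, ← mul_assoc, hz, one_mul]
      conv_lhs => rw [← this]
      simp only [mul_assoc, one_mul]
  induction hg using Subgroup.closure_induction_left with
  | one => exact ⟨1, 1, 1, 1, Or.inl rfl, Or.inl rfl, one_mem _, Or.inl rfl, by simp⟩
  | mul_left x hx y _ ih =>
    rcases hx with rfl | rfl
    · exact stepS y ih
    · exact stepU y ih
  | inv_mul_cancel x hx y _ ih =>
    rcases hx with rfl | rfl
    · have : x⁻¹ = x * (x * x) := by
        rw [inv_eq_iff_mul_eq_one, hS, ← mul_assoc, hS, hz]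
      rw [this, mul_assoc, mul_assoc]
      exact stepS _ (stepS _ (stepS _ ih))
    · have : x⁻¹ * y = x * (x * y) := by rw [← hUi, mul_assoc]
      rw [this]
      exact stepU _ (stepU _ ih)

namespace F2

/-- The group of inner automorphisms. -/
abbrev inner : Subgroup (MulAut F2) := (MulAut.conj : F2 →* MulAut F2).range

instance : inner.Normal where
  conj_mem := by
    rintro _ ⟨g, rfl⟩ φ
    exact ⟨φ g, by ext x; simp [MulAut.mul_apply]⟩

/-- The matrix of an outer automorphism. -/
def outMatrix : MulAut F2 ⧸ inner →* Matrix (Fin 2) (Fin 2) ℤ :=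
  QuotientGroup.lift inner autMatrix (by rintro _ ⟨g, rfl⟩; exact autMatrix_conj g)

theorem autMatrix_quarterTurn : autMatrix quarterTurn = !![0, -1; 1, 0] := by
  ext i j
  change (exponentSum i (quarterTurn (FreeGroup.of j))).toAdd = _
  fin_cases i <;> fin_cases j <;> simp [exponentSum_of]

/-- The automorphism `a ↦ b⁻¹`, `b ↦ ab⁻¹` of order three. -/
def thirdTurn : MulAut F2 := quarterTurn⁻¹ * twistB

@[simp] theorem quarterTurn_inv_a : quarterTurn⁻¹ a = b⁻¹ := by
  rw [MulAut.inv_apply, MulEquiv.symm_apply_eq]; simp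

@[simp] theorem quarterTurn_inv_b : quarterTurn⁻¹ b = a := by
  rw [MulAut.inv_apply, MulEquiv.symm_apply_eq]; simp

@[simp] theorem thirdTurn_a : thirdTurn a = b⁻¹ := by
  rw [thirdTurn, MulAut.mul_apply, twistB_a, quarterTurn_inv_a]

@[simp] theorem thirdTurn_b : thirdTurn b = a * b⁻¹ := by
  rw [thirdTurn, MulAut.mul_apply, twistB_b, map_mul, quarterTurn_inv_a, quarterTurn_inv_b]

theorem autMatrix_thirdTurn : autMatrix thirdTurn = !![0, 1; -1, -1] := by
  ext i j
  change (exponentSum i (thirdTurn (FreeGroup.of j))).toAdd = _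
  fin_cases i <;> fin_cases j <;> simp [exponentSum_of]

theorem thirdTurn_pow_three : thirdTurn * thirdTurn * thirdTurn = 1 :=
  aut_ext (by simp [MulAut.mul_apply]) (by simp [MulAut.mul_apply])

theorem quarterTurn_pow_four :
    quarterTurn * quarterTurn * (quarterTurn * quarterTurn) = 1 :=
  aut_ext (by simp [MulAut.mul_apply]) (by simp [MulAut.mul_apply])

theorem halfTurn_mul_thirdTurn : quarterTurn * quarterTurn * thirdTurn =
    MulAut.conj b⁻¹ * (thirdTurn * (quarterTurn * quarterTurn)) :=
  aut_ext (by simp [MulAut.mul_apply, -map_inv, map_inv thirdTurn, map_inv quarterTurn])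
    (by simp [MulAut.mul_apply, -map_inv, map_inv thirdTurn, map_inv quarterTurn, mul_assoc])

/-- The two monoid generators have the elementary matrices with rows (1, 1), (0, 1) and (1, 0), (1,
1). A nonempty product is nonnegative with a nonzero off-diagonal entry, so it is visibly not the
identity. -/
theorem outMatrix_positive {W : MulAut F2 ⧸ inner}
    (hW : W ∈ Submonoid.closure {((quarterTurn : MulAut F2) : MulAut F2 ⧸ inner) * (thirdTurn : MulAut F2),
      ((quarterTurn * quarterTurn : MulAut F2) : MulAut F2 ⧸ inner) *
        (((quarterTurn : MulAut F2) : MulAut F2 ⧸ inner) *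
          ((thirdTurn : MulAut F2) : MulAut F2 ⧸ inner)⁻¹)}) :
    1 ≤ outMatrix W 0 0 ∧ 1 ≤ outMatrix W 1 1 ∧ 0 ≤ outMatrix W 0 1 ∧ 0 ≤ outMatrix W 1 0 ∧
      (W = 1 ∨ 1 ≤ outMatrix W 0 1 + outMatrix W 1 0) := by
  have h1 : outMatrix ((quarterTurn : MulAut F2) : MulAut F2 ⧸ inner) = !![0, -1; 1, 0] :=
    autMatrix_quarterTurn
  have h2 : outMatrix ((thirdTurn : MulAut F2) : MulAut F2 ⧸ inner) = !![0, 1; -1, -1] :=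
    autMatrix_thirdTurn
  have h3 : outMatrix ((thirdTurn : MulAut F2) : MulAut F2 ⧸ inner)⁻¹ = !![-1, -1; 1, 0] := by
    have : ((thirdTurn : MulAut F2) : MulAut F2 ⧸ inner)⁻¹ =
        (thirdTurn * thirdTurn : MulAut F2) := by
      rw [← QuotientGroup.mk_inv]
      congr 1
      exact (eq_inv_of_mul_eq_one_left thirdTurn_pow_three).symm
    rw [this, QuotientGroup.mk_mul, map_mul, h2]
    decide
  induction hW using Submonoid.closure_induction_left with
  | one => rw [map_one]; simp
  | mul_left x hx W hW ih =>
    obtain ⟨i1, i2, i3, i4, -⟩ := ih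
    rw [map_mul]
    rcases hx with rfl | rfl
    · simp only [QuotientGroup.mk_mul, map_mul, h1, h2, Matrix.mul_apply, Fin.sum_univ_two]
      simp
      refine ⟨?_, ?_, ?_, ?_, Or.inr ?_⟩ <;> omega
    · simp only [QuotientGroup.mk_mul, map_mul, h1, h3, Matrix.mul_apply, Fin.sum_univ_two]
      simp
      refine ⟨?_, ?_, ?_, ?_, Or.inr ?_⟩ <;> omega

/-- An automorphism that acts trivially on the abelianization is inner. -/
theorem exists_eq_conj (φ : MulAut F2) (hφ : autMatrix φ = 1) : ∃ g, φ = MulAut.conj g := by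
  set S : MulAut F2 ⧸ inner := QuotientGroup.mk quarterTurn with hSdef
  set U : MulAut F2 ⧸ inner := QuotientGroup.mk thirdTurn with hUdef
  have hB : ((twistB : MulAut F2) : MulAut F2 ⧸ inner) = S * U := by
    rw [hSdef, hUdef, ← QuotientGroup.mk_mul, thirdTurn, mul_inv_cancel_left]
  have hA : ((twistA : MulAut F2) : MulAut F2 ⧸ inner) = S * U * S * (S * U) := by
    have h : S = ((twistB : MulAut F2) : MulAut F2 ⧸ inner)⁻¹ * (twistA : MulAut F2) *
        ((twistB : MulAut F2) : MulAut F2 ⧸ inner)⁻¹ := by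
      have h1 : ((MulAut.conj a⁻¹ : MulAut F2) : MulAut F2 ⧸ inner) = 1 :=
        (QuotientGroup.eq_one_iff _).2 ⟨_, rfl⟩
      rw [hSdef, quarterTurn, QuotientGroup.mk_mul, h1, one_mul]
      rfl
    rw [← hB]
    nth_rw 1 [h]
    group
  have hS : S ∈ Subgroup.closure {S, U} := Subgroup.subset_closure (Or.inl rfl)
  have hU : U ∈ Subgroup.closure {S, U} := Subgroup.subset_closure (Or.inr rfl)
  have hmem : (φ : MulAut F2 ⧸ inner) ∈ Subgroup.closure {S, U} := by
    have hφ' : φ ∈ twistGroup := mem_twistGroup_of_det_eq_one φ (by rw [hφ]; simp)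
    have hle : twistGroup ≤ (Subgroup.closure {S, U}).comap (QuotientGroup.mk' inner) := by
      rw [twistGroup, Subgroup.closure_le]
      rintro _ (⟨g, rfl⟩ | rfl | rfl)
      · have h1 : ((MulAut.conj g : MulAut F2) : MulAut F2 ⧸ inner) = 1 :=
          (QuotientGroup.eq_one_iff _).2 ⟨_, rfl⟩
        change ((MulAut.conj g : MulAut F2) : MulAut F2 ⧸ inner) ∈ Subgroup.closure {S, U}
        rw [h1]
        exact one_mem _
      · change ((twistA : MulAut F2) : MulAut F2 ⧸ inner) ∈ Subgroup.closure {S, U}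
        rw [hA]
        exact mul_mem (mul_mem (mul_mem hS hU) hS) (mul_mem hS hU)
      · change ((twistB : MulAut F2) : MulAut F2 ⧸ inner) ∈ Subgroup.closure {S, U}
        rw [hB]
        exact mul_mem hS hU
    exact hle hφ'
  obtain ⟨e, u, W, s, he, hu, hW, hs, hprod⟩ := exists_modular_normalForm
    (z := ((quarterTurn * quarterTurn : MulAut F2) : MulAut F2 ⧸ inner)) rfl
    (congrArg QuotientGroup.mk quarterTurn_pow_four)
    (congrArg QuotientGroup.mk thirdTurn_pow_three)
    (by
      have h1 : ((MulAut.conj b⁻¹ : MulAut F2) : MulAut F2 ⧸ inner) = 1 :=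
        (QuotientGroup.eq_one_iff _).2 ⟨_, rfl⟩
      have := congrArg (QuotientGroup.mk (s := inner)) halfTurn_mul_thirdTurn
      rwa [QuotientGroup.mk_mul inner (MulAut.conj b⁻¹), h1, one_mul] at this) hmem
  obtain ⟨i1, i2, i3, i4, i5⟩ := outMatrix_positive hW
  have hS1 : outMatrix S = !![0, -1; 1, 0] := autMatrix_quarterTurn
  have hU1 : outMatrix U = !![0, 1; -1, -1] := autMatrix_thirdTurn
  have hU2 : outMatrix U⁻¹ = !![-1, -1; 1, 0] := by
    have : U⁻¹ = U * U := (eq_inv_of_mul_eq_one_left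
      (congrArg (QuotientGroup.mk (s := inner)) thirdTurn_pow_three)).symm
    rw [this, map_mul, hU1]
    decide
  have hz1 : outMatrix ((quarterTurn * quarterTurn : MulAut F2) : MulAut F2 ⧸ inner) =
      !![-1, 0; 0, -1] := by
    change outMatrix (S * S) = _
    rw [map_mul, hS1]
    decide
  have hmat : outMatrix e * (outMatrix u * (outMatrix W * outMatrix s)) = 1 := by
    rw [← map_mul, ← map_mul, ← map_mul, ← hprod]
    exact hφ
  -- Of the twelve choices of `e`, `u` and `s`, only the trivial one is compatible with a
  -- nonnegative matrix of `W`, and then its off-diagonal part must vanish.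
  have hall : e = 1 ∧ u = 1 ∧ s = 1 ∧ W = 1 := by
    have e00 := congrFun (congrFun hmat 0) 0
    have e01 := congrFun (congrFun hmat 0) 1
    have e10 := congrFun (congrFun hmat 1) 0
    have e11 := congrFun (congrFun hmat 1) 1
    rcases he with rfl | rfl <;> rcases hu with rfl | rfl | rfl <;> rcases hs with rfl | rfl <;>
      simp only [hS1, hU1, hU2, hz1, map_one, one_mul, mul_one, Matrix.mul_apply, Fin.sum_univ_two,
        Matrix.one_apply] at e00 e01 e10 e11 <;> simp at e00 e01 e10 e11 <;>
      first
        | (exfalso; omega)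
        | exact ⟨rfl, rfl, rfl, i5.resolve_right (by omega)⟩
  obtain ⟨rfl, rfl, rfl, rfl⟩ := hall
  simp only [mul_one] at hprod
  obtain ⟨g, hg⟩ := (QuotientGroup.eq_one_iff φ).1 hprod
  exact ⟨g, hg.symm⟩

/-! ### Elliptic and parabolic outer automorphisms. -/

theorem autMatrix_sq (φ : MulAut F2) (hdet : (autMatrix φ).det = 1) :
    autMatrix φ * autMatrix φ = (autMatrix φ).trace • autMatrix φ - 1 := by
  rw [Matrix.det_fin_two] at hdet
  ext i j
  fin_cases i <;> fin_cases j <;>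
    simp only [Matrix.mul_apply, Fin.sum_univ_two, Matrix.trace_fin_two, Matrix.sub_apply,
      Matrix.smul_apply, smul_eq_mul, Matrix.one_apply] <;> simp <;> linarith

/-- An automorphism of determinant one and trace `-1`, `0` or `1` has finite order up to inner
automorphisms. -/
theorem exists_pow_eq_conj (φ : MulAut F2) (hdet : (autMatrix φ).det = 1)
    (h1 : -1 ≤ (autMatrix φ).trace) (h2 : (autMatrix φ).trace ≤ 1) :
    ∃ g, φ ^ 12 = MulAut.conj g := by
  apply exists_eq_conj
  rw [map_pow]
  have h := autMatrix_sq φ hdet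
  generalize autMatrix φ = A at *
  -- By Cayley-Hamilton the traces -1, 0, 1 give A³ = 1, A² = -1, A³ = -1; the exponent 12 serves
  -- all three orders 3, 4, 6.
  have hA : A ^ 12 = (A * A) * (A * A) * (A * A) * ((A * A) * (A * A) * (A * A)) := by noncomm_ring
  obtain ht | ht | ht : A.trace = -1 ∨ A.trace = 0 ∨ A.trace = 1 := by omega
  · rw [ht] at h
    have h3 : A * A * A = 1 := by rw [h, sub_mul]; simp [h]
    have : A ^ 12 = (A * A * A) * (A * A * A) * ((A * A * A) * (A * A * A)) := by noncomm_ring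
    rw [this, h3]; simp
  · rw [ht] at h
    rw [hA, h]; simp
  · rw [ht] at h
    have h3 : A * A * A = -1 := by rw [h, sub_mul]; simp [h]
    have : A ^ 12 = (A * A * A) * (A * A * A) * ((A * A * A) * (A * A * A)) := by noncomm_ring
    rw [this, h3]; simp

theorem exists_autMatrix_eq (B : SL(2, ℤ)) : ∃ ψ : MulAut F2, autMatrix ψ = B.1 := by
  have hB : B ∈ Subgroup.closure {ModularGroup.S, ModularGroup.T} := by
    rw [SpecialLinearGroup.SL2Z_generators]; trivial
  induction hB using Subgroup.closure_induction with
  | mem x hx =>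
    rcases hx with rfl | rfl
    · exact ⟨quarterTurn, autMatrix_quarterTurn⟩
    · exact ⟨twistB, autMatrix_twistB⟩
  | one => exact ⟨1, map_one _⟩
  | mul x y _ _ hx hy =>
    obtain ⟨ψ, hψ⟩ := hx
    obtain ⟨θ, hθ⟩ := hy
    exact ⟨ψ * θ, by rw [map_mul, hψ, hθ]; rfl⟩
  | inv x _ hx =>
    obtain ⟨ψ, hψ⟩ := hx
    refine ⟨ψ⁻¹, ?_⟩
    have h1 : autMatrix ψ⁻¹ * x.1 = 1 := by rw [← hψ, ← map_mul]; simp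
    have h2 : x.1 * (x⁻¹).1 = 1 := by
      have := congrArg Subtype.val (mul_inv_cancel x)
      exact this
    calc autMatrix ψ⁻¹ = autMatrix ψ⁻¹ * (x.1 * (x⁻¹).1) := by rw [h2, mul_one]
      _ = (x⁻¹).1 := by rw [← mul_assoc, h1, one_mul]

/-- Determinant 1 and trace 2 make 1 an eigenvalue. A primitive integral eigenvector extends to an
integral basis by Bézout, and in that basis the matrix is unipotent. -/
theorem exists_conj_unipotent (A : Matrix (Fin 2) (Fin 2) ℤ) (hdet : A.det = 1)
    (htr : A.trace = 2) : ∃ (B : SL(2, ℤ)) (n : ℤ), A * B.1 = B.1 * !![1, n; 0, 1] := by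
  obtain ⟨v, hv, hAv⟩ : ∃ v : Fin 2 → ℤ, IsCoprime (v 0) (v 1) ∧ A.mulVec v = v := by
    have hsing : (A - 1).det = 0 := by
      rw [Matrix.det_fin_two] at hdet ⊢
      rw [Matrix.trace_fin_two] at htr
      simp
      linarith
    obtain ⟨w, hw, hAw⟩ := Matrix.exists_mulVec_eq_zero_iff.2 hsing
    have hg : (Int.gcd (w 0) (w 1) : ℤ) ≠ 0 := by
      intro h0
      have := Int.gcd_eq_zero_iff.1 (by exact_mod_cast h0)
      exact hw (funext fun i => by fin_cases i; exacts [this.1, this.2])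
    obtain ⟨x, hx⟩ := Int.gcd_dvd_left (w 0) (w 1)
    obtain ⟨y, hy⟩ := Int.gcd_dvd_right (w 0) (w 1)
    have hwe : w = (Int.gcd (w 0) (w 1) : ℤ) • ![x, y] := by
      ext i; fin_cases i
      · simpa using hx
      · simpa using hy
    refine ⟨![x, y], ?_, ?_⟩
    · have hb := Int.gcd_eq_gcd_ab (w 0) (w 1)
      generalize Int.gcdA (w 0) (w 1) = α at hb
      generalize Int.gcdB (w 0) (w 1) = β at hb
      generalize (Int.gcd (w 0) (w 1) : ℤ) = d at *
      refine ⟨α, β, mul_left_cancel₀ hg ?_⟩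
      rw [hx, hy] at hb
      simp only [Matrix.cons_val_zero, Matrix.cons_val_one]
      linarith
    · rw [hwe, Matrix.mulVec_smul, smul_eq_zero] at hAw
      have := hAw.resolve_left hg
      rw [Matrix.sub_mulVec, Matrix.one_mulVec, sub_eq_zero] at this
      exact this
  obtain ⟨s, t, hst⟩ := hv
  have h0 := congrFun hAv 0
  have h1 := congrFun hAv 1
  simp only [Matrix.mulVec, dotProduct, Fin.sum_univ_two] at h0 h1
  rw [Matrix.det_fin_two] at hdet
  rw [Matrix.trace_fin_two] at htr
  have hl : v 0 * (-A 1 0 * t + A 1 1 * s) - v 1 * (-A 0 0 * t + A 0 1 * s) = 1 := by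
    linear_combination (A 1 0 * t - A 1 1 * s) * h0 + (-A 0 0 * t + A 0 1 * s) * h1 +
      (s * v 0 + t * v 1) * hdet + hst
  -- The second column comes from the Bézout relation, and `n` is the upper right entry of B⁻¹AB.
  refine ⟨⟨!![v 0, -t; v 1, s], by simp [Matrix.det_fin_two]; linarith⟩,
    s * (-A 0 0 * t + A 0 1 * s) + t * (-A 1 0 * t + A 1 1 * s), ?_⟩
  ext i j
  fin_cases i <;> fin_cases j <;> simp [Matrix.mul_apply, Fin.sum_univ_two]
  · linarith
  · linear_combination (-(-A 0 0 * t + A 0 1 * s)) * hst - t * hl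
  · linarith
  · linear_combination (-(-A 1 0 * t + A 1 1 * s)) * hst + s * hl

theorem autMatrix_twistB_zpow (n : ℤ) : autMatrix (twistB ^ n) = !![1, n; 0, 1] := by
  have hone : ∀ k : ℤ, autMatrix (twistB ^ k) * !![1, 1; 0, 1] = autMatrix (twistB ^ (k + 1)) := by
    intro k
    rw [← autMatrix_twistB, ← map_mul, zpow_add_one]
  have hcancel : (!![1, 1; 0, 1] : Matrix (Fin 2) (Fin 2) ℤ) * !![1, -1; 0, 1] = 1 := by decide
  induction n using Int.induction_on with
  | zero => rw [zpow_zero, map_one]; decide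
  | succ k ih => rw [← hone, ih]; simp [add_comm]
  | pred k ih =>
    have := hone (-k - 1)
    rw [sub_add_cancel, ih] at this
    calc _ = autMatrix (twistB ^ (-(k : ℤ) - 1)) * (!![1, 1; 0, 1] * !![1, -1; 0, 1]) := by
          rw [hcancel, mul_one]
      _ = _ := by rw [← mul_assoc, this]; simp; ring

/-- An automorphism of determinant one and trace two is, up to inner automorphisms, conjugate to a
power of a twist. -/
theorem exists_conj_twist (φ : MulAut F2) (hdet : (autMatrix φ).det = 1)
    (htr : (autMatrix φ).trace = 2) :
    ∃ (ψ : MulAut F2) (n : ℤ) (g : F2), φ * ψ = ψ * (MulAut.conj g * twistB ^ n) := by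
  obtain ⟨B, n, hB⟩ := exists_conj_unipotent _ hdet htr
  obtain ⟨ψ, hψ⟩ := exists_autMatrix_eq B
  rw [← hψ, ← autMatrix_twistB_zpow, ← map_mul, ← map_mul] at hB
  obtain ⟨g, hg⟩ := exists_eq_conj (ψ⁻¹ * (φ * ψ) * (twistB ^ n)⁻¹) (by
    rw [map_mul, map_mul, hB, ← map_mul, ← map_mul]
    simp)
  refine ⟨ψ, n, g, ?_⟩
  rw [← hg]
  group

end F2

/-! ### Commutative transitive groups -/

/-- Commuting is a transitive relation on the nontrivial elements of the group. -/
def IsCommutativeTransitive (G : Type*) [Group G] : Prop :=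
  ∀ x y z : G, y ≠ 1 → Commute x y → Commute y z → Commute x z

theorem IsCommutativeTransitive.of_injective {G H : Type*} [Group G] [Group H]
    (hH : IsCommutativeTransitive H) (f : G →* H) (hf : Function.Injective f) :
    IsCommutativeTransitive G := by
  intro x y z hy hxy hyz
  have h := hH (f x) (f y) (f z) (by rwa [ne_eq, map_eq_one_iff f hf]) (hxy.map f) (hyz.map f)
  exact hf (by rw [map_mul, map_mul]; exact h)

theorem IsCommutativeTransitive.mulOpposite {G : Type*} [Group G]
    (h : IsCommutativeTransitive G) : IsCommutativeTransitive Gᵐᵒᵖ := by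
  intro x y z hy hxy hyz
  have := h x.unop y.unop z.unop (by simpa using hy) hxy.unop hyz.unop
  exact this.op

/-- Modulo scalars, a 2 × 2 matrix commuting with a nonscalar y is a multiple of y, so any two such
matrices commute. -/
theorem Matrix.commute_of_commute_nonscalar {K : Type*} [Field K] {x y z : Matrix (Fin 2) (Fin 2) K}
    (hy : ∀ r : K, y ≠ Matrix.scalar (Fin 2) r) (hxy : x * y = y * x) (hzy : z * y = y * z) :
    x * z = z * x := by
  have hne : y 0 1 ≠ 0 ∨ y 1 0 ≠ 0 ∨ y 0 0 - y 1 1 ≠ 0 := by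
    by_contra hcon
    push Not at hcon
    apply hy (y 0 0)
    ext i j
    fin_cases i <;> fin_cases j <;> simp [hcon.1, hcon.2.1]
    linear_combination -hcon.2.2
  have key : ∀ w : Matrix (Fin 2) (Fin 2) K, w * y = y * w →
      ∃ k, w 0 1 = k * y 0 1 ∧ w 1 0 = k * y 1 0 ∧ w 0 0 - w 1 1 = k * (y 0 0 - y 1 1) := by
    intro w hw
    have e00 := congrFun (congrFun hw 0) 0
    have e01 := congrFun (congrFun hw 0) 1
    have e10 := congrFun (congrFun hw 1) 0
    simp only [Matrix.mul_apply, Fin.sum_univ_two] at e00 e01 e10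
    rcases hne with h | h | h
    · refine ⟨w 0 1 / y 0 1, ?_, ?_, ?_⟩ <;> rw [div_mul_eq_mul_div, eq_div_iff h]
      · linear_combination -e00
      · linear_combination e01
    · refine ⟨w 1 0 / y 1 0, ?_, ?_, ?_⟩ <;> rw [div_mul_eq_mul_div, eq_div_iff h]
      · linear_combination e00
      · linear_combination -e10
    · refine ⟨(w 0 0 - w 1 1) / (y 0 0 - y 1 1), ?_, ?_, ?_⟩ <;>
        rw [div_mul_eq_mul_div, eq_div_iff h]
      · linear_combination -e01
      · linear_combination e10
  obtain ⟨k, x1, x2, x3⟩ := key x hxy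
  obtain ⟨l, z1, z2, z3⟩ := key z hzy
  have g1 : x 0 1 * z 1 0 = z 0 1 * x 1 0 := by rw [x1, x2, z1, z2]; ring
  have g2 : (x 0 0 - x 1 1) * z 0 1 = x 0 1 * (z 0 0 - z 1 1) := by rw [x1, x3, z1, z3]; ring
  have g3 : (x 0 0 - x 1 1) * z 1 0 = x 1 0 * (z 0 0 - z 1 1) := by rw [x2, x3, z2, z3]; ring
  ext i j
  fin_cases i <;> fin_cases j <;> simp [Matrix.mul_apply, Fin.sum_univ_two]
  · linear_combination g1
  · linear_combination g2
  · linear_combination -g3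
  · linear_combination -g1

namespace HyperbolicThreeSpace

/-- A positive definite matrix, scaled to determinant one. -/
theorem exists_smul_mem {X : Matrix (Fin 2) (Fin 2) ℂ} (hX : X.PosDef) :
    ∃ r : ℝ, 0 < r ∧ ((r : ℂ) • X).PosDef ∧ ((r : ℂ) • X).det = 1 := by
  have hd : 0 < X.det := hX.det_pos
  obtain ⟨d, hd0, hde⟩ : ∃ d : ℝ, 0 < d ∧ X.det = d := by
    rw [Complex.pos_iff] at hd
    exact ⟨X.det.re, hd.1, Complex.ext rfl (by simp [← hd.2])⟩
  refine ⟨(Real.sqrt d)⁻¹, by positivity, ?_, ?_⟩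
  · apply hX.smul
    rw [Complex.zero_lt_real]
    positivity
  · rw [Matrix.det_smul, hde, Fintype.card_fin, ← Complex.ofReal_pow, inv_pow, Real.sq_sqrt hd0.le,
      ← Complex.ofReal_mul, inv_mul_cancel₀ hd0.ne', Complex.ofReal_one]

/-- A rotation by a half turn has a fixed point. -/
theorem exists_smul_eq_self {γ : SL(2, ℂ)} (hγ : γ * γ = -1) :
    ∃ X : HyperbolicThreeSpace, γ • X = X := by
  -- The average over the group generated by γ: since γ² = -1, the map X ↦ γXγᴴ swaps 1 and γγᴴ and
  -- fixes their sum.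
  have hpos : (1 + γ.1 * γ.1.conjTranspose).PosDef :=
    Matrix.PosDef.one.add_posSemidef (Matrix.posSemidef_self_mul_conjTranspose _)
  obtain ⟨r, hr, h1, h2⟩ := exists_smul_mem hpos
  refine ⟨⟨_, h1, h2⟩, Subtype.ext ?_⟩
  change γ.1 * ((r : ℂ) • (1 + γ.1 * γ.1.conjTranspose)) * γ.1.conjTranspose = _
  have hγ' : γ.1 * γ.1 = -1 := by
    have := congrArg Subtype.val hγ
    exact this
  have hγ'' : γ.1.conjTranspose * γ.1.conjTranspose = -1 := by
    rw [← Matrix.conjTranspose_mul, hγ']; simp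
  rw [Matrix.mul_smul, Matrix.smul_mul]
  congr 1
  rw [mul_add, mul_one, add_mul, add_comm, ← mul_assoc, hγ', mul_assoc, hγ'']
  simp

end HyperbolicThreeSpace

/-- The group of isometries given by a subgroup of `SL(2, ℂ)` that acts freely on hyperbolic space
is commutative transitive. -/
theorem isCommutativeTransitive_range_toPermHom (Γ : Subgroup SL(2, ℂ))
    (hfree : ∀ γ ∈ Γ, ∀ X : HyperbolicThreeSpace, γ • X = X → γ = 1 ∨ γ = -1) :
    IsCommutativeTransitive (MulAction.toPermHom Γ HyperbolicThreeSpace).range := by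
  have hneg : ∀ X : HyperbolicThreeSpace, (-1 : SL(2, ℂ)) • X = X := by
    intro X
    apply Subtype.ext
    change (-1 : Matrix (Fin 2) (Fin 2) ℂ) * X.1 * (-1 : Matrix (Fin 2) (Fin 2) ℂ).conjTranspose = X.1
    simp
  have hpt : HyperbolicThreeSpace := ⟨1, Matrix.PosDef.one, Matrix.det_one⟩
  -- Commuting isometries have commuting lifts. Otherwise xy = -yx, so x has trace zero and x² = -1,
  -- and such an x has a fixed point, against freeness.
  have key : ∀ x y : Γ, Commute (MulAction.toPermHom Γ HyperbolicThreeSpace x)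
      (MulAction.toPermHom Γ HyperbolicThreeSpace y) → x.1 * y.1 = y.1 * x.1 := by
    intro x y hxy
    have h1 : (x * y).1 • hpt = (y * x).1 • hpt := by
      have := DFunLike.congr_fun hxy.eq hpt
      rw [← map_mul, ← map_mul] at this
      exact this
    have h2 : ((y * x).1)⁻¹ * (x * y).1 = 1 ∨ ((y * x).1)⁻¹ * (x * y).1 = -1 := by
      refine hfree _ (mul_mem (inv_mem (y * x).2) (x * y).2) hpt ?_
      rw [mul_smul, h1, inv_smul_smul]
    rcases h2 with h2 | h2
    · rw [inv_mul_eq_one] at h2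
      exact h2.symm
    · exfalso
      rw [inv_mul_eq_iff_eq_mul] at h2
      have h3 : x.1 * y.1 = -(y.1 * x.1) := by
        simpa using h2
      have htr : (x.1).1.trace = 0 := by
        have h4 : (x.1).1 * (y.1).1 = -((y.1).1 * (x.1).1) := congrArg Subtype.val h3
        have h5 : (x.1).1 = -((y.1).1 * (x.1).1 * (y.1⁻¹).1) := by
          have h6 : (y.1).1 * (y.1⁻¹).1 = 1 := congrArg Subtype.val (mul_inv_cancel y.1)
          calc (x.1).1 = (x.1).1 * ((y.1).1 * (y.1⁻¹).1) := by rw [h6, mul_one]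
            _ = _ := by rw [← mul_assoc, h4]; simp
        have h7 : (x.1).1.trace = -(x.1).1.trace := by
          conv_lhs => rw [h5]
          rw [Matrix.trace_neg, Matrix.trace_mul_comm, ← mul_assoc]
          have h6 : (y.1⁻¹).1 * (y.1).1 = 1 := congrArg Subtype.val (inv_mul_cancel y.1)
          rw [h6, one_mul]
        exact self_eq_neg.1 h7
      have hsq : x.1 * x.1 = -1 := by
        apply Subtype.ext
        change (x.1).1 * (x.1).1 = -1
        have hdet := (x.1).2
        rw [Matrix.det_fin_two] at hdet
        rw [Matrix.trace_fin_two] at htr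
        ext i j
        fin_cases i <;> fin_cases j <;> simp [Matrix.mul_apply, Fin.sum_univ_two]
        · linear_combination (x.1).1 0 0 * htr - hdet
        · linear_combination (x.1).1 0 1 * htr
        · linear_combination (x.1).1 1 0 * htr
        · linear_combination (x.1).1 1 1 * htr - hdet
      obtain ⟨X, hX⟩ := HyperbolicThreeSpace.exists_smul_eq_self hsq
      rcases hfree _ x.2 X hX with h | h
      all_goals
        rw [h] at h3
        have h4 := congrArg Subtype.val h3
        have h5 : (y.1).1 = 0 := by
          have h6 : (y.1).1 = -(y.1).1 := by
            first
              | simpa using h4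
              | simpa using h4.symm
          ext i j
          exact self_eq_neg.1 (congrFun (congrFun h6 i) j)
        have := (y.1).2
        rw [h5] at this
        simp at this
  rintro ⟨_, x, rfl⟩ ⟨_, y, rfl⟩ ⟨_, z, rfl⟩ hy hxy hyz
  have h1 := key x y (congrArg Subtype.val hxy.eq)
  have h2 := key y z (congrArg Subtype.val hyz.eq)
  have h3 : (x.1).1 * (z.1).1 = (z.1).1 * (x.1).1 := by
    refine Matrix.commute_of_commute_nonscalar (y := (y.1).1) ?_ (congrArg Subtype.val h1)
      (congrArg Subtype.val h2.symm)
    intro r hr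
    apply hy
    have hdet := (y.1).2
    have hr2 : r * r = 1 := by
      rw [hr] at hdet
      simpa [Matrix.det_fin_two, mul_self_eq_one_iff] using hdet
    have hy1 : y.1 = 1 ∨ y.1 = -1 := by
      rcases mul_self_eq_one_iff.1 hr2 with rfl | rfl
      · exact Or.inl (Subtype.ext (by rw [hr]; simp))
      · exact Or.inr (Subtype.ext (by rw [hr]; change _ = (-1 : Matrix (Fin 2) (Fin 2) ℂ); ext i j; fin_cases i <;> fin_cases j <;> simp))
    apply Subtype.ext
    ext1 X
    change y.1 • X = X
    rcases hy1 with h | h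
    · rw [h, one_smul]
    · rw [h, hneg]
  have h4 : x * z = z * x := Subtype.ext (Subtype.ext h3)
  apply Subtype.ext
  change MulAction.toPermHom Γ HyperbolicThreeSpace x * MulAction.toPermHom Γ HyperbolicThreeSpace z =
    MulAction.toPermHom Γ HyperbolicThreeSpace z * MulAction.toPermHom Γ HyperbolicThreeSpace x
  rw [← map_mul, h4, map_mul]

/-! ### Traces excluded by commutative transitivity. -/

namespace F2

theorem not_commute_a_b : ¬ Commute a b := by
  intro h
  have := congrArg FreeGroup.toWord h.eq
  revert this
  decide

theorem not_commute_conj : ¬ Commute a (b⁻¹ * a * b) := by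
  intro h
  have := congrArg FreeGroup.toWord h.eq
  revert this
  decide

theorem twistB_zpow_a (n : ℤ) : (twistB ^ n) a = a := by
  induction n using Int.induction_on with
  | zero => rfl
  | succ k ih => rw [zpow_add_one, MulAut.mul_apply, twistB_a, ih]
  | pred k ih => rw [zpow_sub_one, MulAut.mul_apply, twistB_inv_a, ih]

theorem twistB_zpow_b (n : ℤ) : (twistB ^ n) b = b * a ^ n := by
  induction n using Int.induction_on with
  | zero => simp
  | succ k ih => rw [zpow_add_one, MulAut.mul_apply, twistB_b, map_mul, ih, twistB_zpow_a, mul_assoc,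
      zpow_add_one]
  | pred k ih => rw [zpow_sub_one, MulAut.mul_apply, twistB_inv_b, map_mul, map_inv, ih,
      twistB_zpow_a, mul_assoc, zpow_sub_one]

/-- In a commutative transitive extension of the free group by an infinite cyclic group the
monodromy does not have trace `-1`, `0`, `1` or `2`. -/
theorem three_le_trace {E : Type*} [Group E] (hE : IsCommutativeTransitive E) (i : F2 →* E)
    (hi : Function.Injective i) (p : E →* Multiplicative ℤ) (hp : ∀ f, p (i f) = 1) (t : E)
    (ht : p t = Multiplicative.ofAdd 1) (φ : MulAut F2) (hφ : ∀ f, t * i f * t⁻¹ = i (φ f))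
    (hdet : (autMatrix φ).det = 1) (htr : -1 ≤ (autMatrix φ).trace) :
    3 ≤ (autMatrix φ).trace := by
  by_contra hlt
  push Not at hlt
  by_cases h2 : (autMatrix φ).trace = 2
  · obtain ⟨ψ, n, g, hψ⟩ := exists_conj_twist φ hdet h2
    set j : F2 →* E := i.comp ψ.toMonoidHom with hj
    have hji : Function.Injective j := hi.comp ψ.injective
    have hjp : ∀ f, p (j f) = 1 := fun f => hp _
    -- Corrected by an inner automorphism, the stable letter acts as a power of the twist and so
    -- commutes with the image of `a`.
    set s : E := (j g)⁻¹ * t with hs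
    have hs1 : s ≠ 1 := by
      intro h
      have := congrArg p h
      rw [hs, map_mul, map_inv, hjp, ht, map_one p] at this
      simp at this
    have hsj : ∀ f, s * j f * s⁻¹ = j ((twistB ^ n) f) := by
      intro f
      have h1 : t * j f * t⁻¹ = j (g * (twistB ^ n) f * g⁻¹) := by
        have h3 : (φ * ψ) f = (ψ * (MulAut.conj g * twistB ^ n)) f := by rw [hψ]
        rw [hj, MonoidHom.comp_apply, hφ]
        exact congrArg i h3
      have h4 : s * j f * s⁻¹ = (j g)⁻¹ * (t * j f * t⁻¹) * j g := by rw [hs]; group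
      rw [h4, h1, map_mul, map_mul, map_inv]
      group
    have ha := hsj a
    have hb := hsj b
    rw [twistB_zpow_a] at ha
    rw [twistB_zpow_b, map_mul, map_zpow] at hb
    have hca : Commute (j a) s := by
      have := mul_inv_eq_iff_eq_mul.1 ha
      exact this.symm
    have hbs : (j b)⁻¹ * s * j b = j a ^ n * s := by
      have h5 := mul_inv_eq_iff_eq_mul.1 hb
      rw [mul_assoc, h5]
      group
    -- As b⁻¹sb = aⁿs, this element commutes with a and also with b⁻¹ab. Transitivity would make a
    -- commute with b⁻¹ab.
    have h6 : Commute (j a) ((j b)⁻¹ * s * j b) := by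
      rw [hbs]
      exact ((Commute.refl _).zpow_right n).mul_right hca
    have h7 : Commute ((j b)⁻¹ * s * j b) ((j b)⁻¹ * j a * j b) := by
      have := (hca.symm).map (MulAut.conj (j b)⁻¹).toMonoidHom
      simpa using this
    have h8 := hE _ _ _ (by
      intro h
      apply hs1
      have : s = j b * ((j b)⁻¹ * s * j b) * (j b)⁻¹ := by group
      rw [this, h]
      group) h6 h7
    apply not_commute_conj
    apply hji
    simpa using h8.eq
  · obtain ⟨g, hg⟩ := exists_pow_eq_conj φ hdet htr (by omega)
    have hpow : ∀ (k : ℕ) (f : F2), t ^ k * i f * (t ^ k)⁻¹ = i ((φ ^ k) f) := by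
      intro k
      induction k with
      | zero => simp
      | succ k ih =>
        intro f
        rw [pow_succ, pow_succ, MulAut.mul_apply, ← ih, ← hφ]
        group
    -- This nontrivial element centralizes the free group, so transitivity would make the free group
    -- abelian.
    set s : E := (i g)⁻¹ * t ^ 12 with hs
    have hs1 : s ≠ 1 := by
      intro h
      have := congrArg p h
      rw [hs, map_mul, map_inv, hp, map_pow, ht, map_one p, inv_one, one_mul, ← ofAdd_nsmul] at this
      simp at this
    have hsi : ∀ f, Commute (i f) s := by
      intro f
      have h1 := hpow 12 f
      rw [hg, MulAut.conj_apply, map_mul, map_mul, map_inv] at h1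
      have h2 : s * i f * s⁻¹ = i f := by
        have h4 : s * i f * s⁻¹ = (i g)⁻¹ * (t ^ 12 * i f * (t ^ 12)⁻¹) * i g := by rw [hs]; group
        rw [h4, h1]
        group
      exact (mul_inv_eq_iff_eq_mul.1 h2).symm
    have h := hE _ _ _ hs1 (hsi a) (hsi b).symm
    apply not_commute_a_b
    apply hi
    simpa using h.eq

end F2

/-! ### Fundamental groups and open covers -/

section OpenCover

open Topology

variable {X κ : Type*} [TopologicalSpace X] {W : κ → Set X}

/-- A property of homotopy classes of paths that is closed under composition and holds for paths in
the members of an open cover holds for all paths. -/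
theorem path_induction (hW : ∀ i, IsOpen (W i)) (hcov : ∀ x, ∃ i, x ∈ W i)
    (C : ∀ ⦃x y : X⦄, Path.Homotopic.Quotient x y → Prop)
    (htrans : ∀ ⦃x y z : X⦄ (γ : Path.Homotopic.Quotient x y) (δ : Path.Homotopic.Quotient y z),
      C γ → C δ → C (γ.trans δ))
    (hsmall : ∀ i ⦃x y : X⦄ (γ : Path x y), (∀ t, γ t ∈ W i) → C (.mk γ))
    {x y : X} (γ : Path.Homotopic.Quotient x y) : C γ := by
  induction γ using Path.Homotopic.Quotient.ind with
  | mk γ =>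
    obtain ⟨f, rfl, rfl⟩ := γ
    set γ : Path (f.toFun 0) (f.toFun 1) := ⟨f, rfl, rfl⟩ with hγ
    obtain ⟨t, ht0, hmono, ⟨n, hn⟩, hsub⟩ := exists_monotone_Icc_subset_open_cover_unitInterval
      (c := fun i => γ ⁻¹' W i) (fun i => (hW i).preimage γ.continuous)
      (fun s _ => Set.mem_iUnion.2 (hcov (γ s)))
    have key : ∀ k, C (.mk (γ.subpath 0 (t k))) := by
      intro k
      induction k with
      | zero =>
        obtain ⟨i, hi⟩ := hcov (γ 0)
        refine hsmall i _ fun s => ?_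
        rw [ht0]
        have : γ.subpath 0 0 s ∈ Set.range (γ.subpath 0 0) := ⟨s, rfl⟩
        rw [Path.range_subpath, Set.uIcc_self, Set.image_singleton] at this
        rwa [Set.mem_singleton_iff.1 this]
      | succ k ih =>
        obtain ⟨i, hi⟩ := hsub k
        have h1 : C (.mk (γ.subpath (t k) (t (k + 1)))) := by
          refine hsmall i _ fun s => ?_
          have : γ.subpath (t k) (t (k + 1)) s ∈ Set.range (γ.subpath (t k) (t (k + 1))) := ⟨s, rfl⟩
          rw [Path.range_subpath_of_le _ _ _ (hmono k.le_succ)] at this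
          obtain ⟨u, hu, hu'⟩ := this
          rw [← hu']
          exact hi hu
        have h2 := htrans _ _ ih h1
        rw [← Path.Homotopic.Quotient.mk_trans] at h2
        rwa [Path.Homotopic.Quotient.eq.2 ⟨Path.Homotopy.subpathTransSubpath γ 0 (t k) (t (k + 1))⟩]
          at h2
    have h := key n
    rw [hn n le_rfl, Path.subpath_zero_one] at h
    exact h

/-- A locally constant cocycle given by a family of discontinuous functions determines a holonomy
action of the homotopy classes of paths. -/
theorem exists_holonomy {F : Type*} [Group F] (hW : ∀ i, IsOpen (W i)) (hcov : ∀ x, ∃ i, x ∈ W i)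
    (g : κ → X → F)
    (hg : ∀ i j, ∀ x ∈ W i ∩ W j, ∀ᶠ y in 𝓝 x, g j y * (g i y)⁻¹ = g j x * (g i x)⁻¹) :
    ∃ hol : ∀ ⦃x y : X⦄, Path.Homotopic.Quotient x y → F → F,
      (∀ ⦃x y z : X⦄ (γ : Path.Homotopic.Quotient x y) (δ : Path.Homotopic.Quotient y z) (v : F),
        hol (γ.trans δ) v = hol δ (hol γ v)) ∧
      ∀ i ⦃x y : X⦄ (γ : Path x y), (∀ t, γ t ∈ W i) → ∀ v,
        hol (.mk γ) v = (g i y)⁻¹ * g i x * v := by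
  let _ : TopologicalSpace F := ⊥
  have : DiscreteTopology F := ⟨rfl⟩
  choose ind hind using hcov
  -- The transition functions are locally constant, so with the discrete topology on the fiber this
  -- is a covering space, whose path lifting gives the holonomy.
  let Z : FiberBundleCore κ X F :=
    { baseSet := W
      isOpen_baseSet := hW
      indexAt := ind
      mem_baseSet_at := hind
      coordChange := fun i j x v => g j x * (g i x)⁻¹ * v
      coordChange_self := fun i x _ v => by simp
      continuousOn_coordChange := by
        intro i j
        rintro ⟨x, v⟩ ⟨hx, -⟩
        apply ContinuousAt.continuousWithinAt
        rw [ContinuousAt, nhds_discrete F, Filter.tendsto_pure, nhds_prod_eq, nhds_discrete F,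
          Filter.prod_pure, Filter.eventually_map]
        filter_upwards [hg i j x hx] with y hy
        rw [hy]
      coordChange_comp := fun i j k x _ v => by group }
  have cov : IsCoveringMap Z.proj := FiberBundle.isCoveringMap (F := F) (E := Z.Fiber)
  let sn : Z.TotalSpace → F := fun q => q.2
  -- A labelling of all fibers by `F`, not continuous in x, independent of the chart; in chart `i`
  -- the label v is read as g i x * v.
  let e : ∀ x, F → Z.proj ⁻¹' {x} := fun x v => ⟨⟨x, g (ind x) x * v⟩, rfl⟩
  let n : ∀ x, Z.proj ⁻¹' {x} → F := fun x q => (g (ind q.1.1) q.1.1)⁻¹ * sn q.1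
  have hen : ∀ x q, e x (n x q) = q := by
    rintro x ⟨⟨y, v⟩, hy⟩
    obtain rfl : y = x := hy
    apply Subtype.ext
    simp only [e, n]
    congr 1
    exact mul_inv_cancel_left (g (ind y) y) (v : F)
  refine ⟨fun x y γ v => n y (cov.monodromy γ (e x v)), ?_, ?_⟩
  · intro x y z γ δ v
    simp only [cov.monodromy_trans_apply, hen]
  · intro i x y γ hγ v
    have hco : ∀ q : Z.TotalSpace, (Z.localTriv i q).2 = g i q.1 * ((g (ind q.1) q.1)⁻¹ * sn q) := by
      intro q
      rw [Z.localTriv_apply]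
      exact mul_assoc _ _ _
    set Γ := cov.liftPath γ (e x v).1 (γ.source.trans (e x v).2.symm) with hΓ
    have hproj : ∀ t, (Γ t).1 = γ t := fun t =>
      congrFun (cov.liftPath_lifts γ (e x v).1 (γ.source.trans (e x v).2.symm)) t
    have hcont : Continuous fun t => (Z.localTriv i (Γ t)).2 := by
      refine continuous_snd.comp ?_
      rw [← continuousOn_univ]
      refine (Z.localTriv i).continuousOn.comp Γ.continuous.continuousOn ?_
      intro t _
      rw [Z.mem_localTriv_source]
      change (Γ t).1 ∈ W i
      rw [hproj]
      exact hγ t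
    -- Over a single chart the discrete coordinate of a lifted path is constant.
    have hconst : (Z.localTriv i (Γ 1)).2 = (Z.localTriv i (Γ 0)).2 :=
      PreconnectedSpace.constant inferInstance hcont
    have h0 : Γ 0 = (e x v).1 := cov.liftPath_zero ..
    rw [hco, hco, h0] at hconst
    have h1 : (Γ 1).1 = y := (hproj 1).trans γ.target
    change (g (ind (Γ 1).1) (Γ 1).1)⁻¹ * sn (Γ 1) = _
    rw [h1] at hconst ⊢
    have h2 : g i y * ((g (ind y) y)⁻¹ * sn (Γ 1)) = g i x * v := by
      rw [hconst]
      change g i x * ((g (ind x) x)⁻¹ * (g (ind x) x * v)) = _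
      group
    rw [mul_assoc, ← h2]
    group

open CategoryTheory in
/-- The fundamental group of a space that is the union of a simply connected open set `U` and of
disjoint simply connected open sets `V i`, each of which meets `U` in two path connected components,
is free. -/
theorem nonempty_freeGroup_mulEquiv_fundamentalGroup {ι : Type*} {U : Set X} {V A B : ι → Set X}
    (hU : IsOpen U) (hV : ∀ i, IsOpen (V i)) (hA : ∀ i, IsOpen (A i)) (hB : ∀ i, IsOpen (B i))
    (hcov : ∀ x, x ∈ U ∨ ∃ i, x ∈ V i) (hUV : ∀ i, U ∩ V i = A i ∪ B i)
    (hAB : ∀ i, Disjoint (A i) (B i)) (hVV : ∀ i j, i ≠ j → Disjoint (V i) (V j))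
    (hU1 : IsSimplyConnected U) (hV1 : ∀ i, IsSimplyConnected (V i))
    (hA1 : ∀ i, IsPathConnected (A i)) (hB1 : ∀ i, IsPathConnected (B i)) {x₀ : X} (hx₀ : x₀ ∈ U) :
    Nonempty (FreeGroup ι ≃* FundamentalGroup X x₀) := by
  classical
  let W : Option ι → Set X := fun o => o.elim U V
  have hWo : ∀ o, IsOpen (W o) := by
    rintro (_ | i)
    · exact hU
    · exact hV i
  have hWc : ∀ x, ∃ o, x ∈ W o := by
    intro x
    rcases hcov x with h | ⟨i, h⟩
    · exact ⟨none, h⟩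
    · exact ⟨some i, h⟩
  have hWs : ∀ o, IsSimplyConnected (W o) := by
    rintro (_ | i)
    · exact hU1
    · exact hV1 i
  replace hcov : ∀ x, x ∈ W none ∨ ∃ i, x ∈ W (some i) := hcov
  replace hUV : ∀ i, W none ∩ W (some i) = A i ∪ B i := hUV
  replace hVV : ∀ i j, i ≠ j → Disjoint (W (some i)) (W (some j)) := hVV
  replace hx₀ : x₀ ∈ W none := hx₀
  clear_value W
  have hpU : ∀ i x, x ∈ A i → x ∈ W none := fun i x hx => ((hUV i).symm.subset (Or.inl hx)).1
  have hpV : ∀ i x, x ∈ A i → x ∈ W (some i) := fun i x hx => ((hUV i).symm.subset (Or.inl hx)).2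
  have hqU : ∀ i x, x ∈ B i → x ∈ W none := fun i x hx => ((hUV i).symm.subset (Or.inr hx)).1
  have hqV : ∀ i x, x ∈ B i → x ∈ W (some i) := fun i x hx => ((hUV i).symm.subset (Or.inr hx)).2
  have huniq : ∀ o ⦃x y : X⦄ (γ δ : Path x y), (∀ t, γ t ∈ W o) → (∀ t, δ t ∈ W o) →
      Path.Homotopic.Quotient.mk γ = Path.Homotopic.Quotient.mk δ := by
    intro o x y γ δ hγ hδ
    have := (hWs o).simplyConnectedSpace
    have hx : x ∈ W o := by simpa using hγ 0
    have hy : y ∈ W o := by simpa using hγ 1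
    let γ' : Path (⟨x, hx⟩ : W o) ⟨y, hy⟩ :=
      ⟨⟨fun t => ⟨γ t, hγ t⟩, by fun_prop⟩, Subtype.ext γ.source, Subtype.ext γ.target⟩
    let δ' : Path (⟨x, hx⟩ : W o) ⟨y, hy⟩ :=
      ⟨⟨fun t => ⟨δ t, hδ t⟩, by fun_prop⟩, Subtype.ext δ.source, Subtype.ext δ.target⟩
    exact Path.Homotopic.Quotient.eq.2
      ((SimplyConnectedSpace.paths_homotopic γ' δ').map ⟨Subtype.val, continuous_subtype_val⟩)
  have hA' : ∀ i, ∃ p, p ∈ A i := fun i => (hA1 i).nonempty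
  have hB' : ∀ i, ∃ q, q ∈ B i := fun i => (hB1 i).nonempty
  choose p hp using hA'
  choose q hq using hB'
  -- the class of the paths between two points of a member of the cover
  have hjoin : ∀ o ⦃x y : X⦄, x ∈ W o → y ∈ W o →
      ∃ c : FundamentalGroupoid.mk x ⟶ FundamentalGroupoid.mk y,
        ∀ γ : Path x y, (∀ t, γ t ∈ W o) → FundamentalGroupoid.fromPath (.mk γ) = c := by
    intro o x y hx hy
    obtain ⟨γ, hγ⟩ := (hWs o).isPathConnected.joinedIn x hx y hy
    exact ⟨.mk γ, fun δ hδ => huniq o _ _ hδ hγ⟩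
  choose c hc using hjoin
  have hcex : ∀ o ⦃x y : X⦄ (hx : x ∈ W o) (hy : y ∈ W o), ∃ γ : Path x y, (∀ t, γ t ∈ W o) ∧
      c o hx hy = FundamentalGroupoid.fromPath (.mk γ) := by
    intro o x y hx hy
    obtain ⟨γ, hγ⟩ := (hWs o).isPathConnected.joinedIn x hx y hy
    exact ⟨γ, hγ, (hc o hx hy γ hγ).symm⟩
  have hctrans : ∀ o ⦃x y z : X⦄ (hx : x ∈ W o) (hy : y ∈ W o) (hz : z ∈ W o),
      c o hx hy ≫ c o hy hz = c o hx hz := by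
    intro o x y z hx hy hz
    obtain ⟨γ, hγ, e1⟩ := hcex o hx hy
    obtain ⟨δ, hδ, e2⟩ := hcex o hy hz
    rw [e1, e2, ← hc o hx hz (γ.trans δ)]
    · rfl
    · intro t
      rw [Path.trans_apply]
      split_ifs
      · exact hγ _
      · exact hδ _
  have hccommon : ∀ o o' ⦃x y : X⦄ (S : Set X), IsPathConnected S → ∀ (h : ∀ x, x ∈ S → x ∈ W o)
      (h' : ∀ x, x ∈ S → x ∈ W o')
      (hx : x ∈ S) (hy : y ∈ S), c o (h _ hx) (h _ hy) = c o' (h' _ hx) (h' _ hy) := by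
    intro o o' x y S hS h h' hx hy
    obtain ⟨γ, hγ⟩ := hS.joinedIn x hx y hy
    rw [← hc o (h _ hx) (h _ hy) γ fun t => h _ (hγ t), ← hc o' (h' _ hx) (h' _ hy) γ fun t => h' _ (hγ t)]
  -- The free generators: through `U` to `A i`, across `V i` to `B i`, and back through `U`.
  let s : ι → FundamentalGroup X x₀ := fun i =>
    c none hx₀ (hpU i _ (hp i)) ≫ c (some i) (hpV i _ (hp i)) (hqV i _ (hq i)) ≫ c none (hqU i _ (hq i)) hx₀
  -- injectivity
  let g : Option ι → X → FreeGroup ι := fun o x =>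
    o.elim 1 fun i => if x ∈ B i then (FreeGroup.of i)⁻¹ else 1
  have hgB : ∀ i x, x ∈ B i → g (some i) x = (FreeGroup.of i)⁻¹ := fun i x h => if_pos h
  have hgA : ∀ i x, x ∈ A i → g (some i) x = 1 := fun i x h =>
    if_neg fun h' => Set.disjoint_left.1 (hAB i) h h'
  have hgloc : ∀ i x, x ∈ W none ∩ W (some i) → ∀ᶠ y in 𝓝 x, g (some i) y = g (some i) x := by
    intro i x hx
    rcases (hUV i).subset hx with h | h
    · filter_upwards [(hA i).mem_nhds h] with y hy
      rw [hgA i y hy, hgA i x h]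
    · filter_upwards [(hB i).mem_nhds h] with y hy
      rw [hgB i y hy, hgB i x h]
  obtain ⟨hol, hol_trans, hol_small⟩ := exists_holonomy hWo hWc g (by
    rintro (_ | i) (_ | j) x ⟨hx, hx'⟩
    · exact Filter.Eventually.of_forall fun y => by simp
    · filter_upwards [hgloc j x ⟨hx, hx'⟩] with y hy
      rw [hy]
      rfl
    · filter_upwards [hgloc i x ⟨hx', hx⟩] with y hy
      rw [hy]
      rfl
    · by_cases hij : i = j
      · subst hij
        exact Filter.Eventually.of_forall fun y => by simp
      · exact absurd hx' (Set.disjoint_left.1 (hVV i j hij) hx))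
  have hol_c : ∀ o ⦃x y : X⦄ (hx : x ∈ W o) (hy : y ∈ W o) v,
      hol (c o hx hy) v = (g o y)⁻¹ * g o x * v := by
    intro o x y hx hy v
    obtain ⟨γ, hγ, e1⟩ := hcex o hx hy
    rw [e1]
    exact hol_small o γ hγ v
  -- A product in the fundamental group traverses its right factor first.
  have hol_mul : ∀ (α β : FundamentalGroup X x₀) v, hol (α * β) v = hol α (hol β v) :=
    fun α β v => hol_trans β α v
  have hol_one : ∀ v, hol (1 : FundamentalGroup X x₀) v = v := by
    intro v
    have := hol_small none (Path.refl x₀) (fun _ => hx₀) v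
    rw [inv_mul_cancel, one_mul] at this
    exact this
  have hol_s : ∀ i v, hol (s i) v = FreeGroup.of i * v := by
    intro i v
    have h1 := hol_trans (c none hx₀ (hpU i _ (hp i)))
      ((c (some i) (hpV i _ (hp i)) (hqV i _ (hq i))).trans (c none (hqU i _ (hq i)) hx₀)) v
    refine h1.trans ?_
    rw [hol_trans, hol_c, hol_c, hol_c, hgA i _ (hp i), hgB i _ (hq i)]
    simp [g]
  have hol_lift : ∀ (w : FreeGroup ι) v, hol (FreeGroup.lift s w) v = w * v := by
    intro w
    induction w using FreeGroup.induction_on with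
    | C1 => intro v; rw [_root_.map_one, hol_one, one_mul]
    | of i => intro v; rw [FreeGroup.lift_apply_of, hol_s]
    | inv_of i _ =>
      intro v
      rw [_root_.map_inv, FreeGroup.lift_apply_of, eq_inv_mul_iff_mul_eq, ← hol_s, ← hol_mul, mul_inv_cancel, hol_one]
    | mul x y hx hy => intro v; rw [_root_.map_mul, hol_mul, hx, hy, mul_assoc]
  have hinj : Function.Injective (FreeGroup.lift s) := by
    intro w w' h
    have h1 := hol_lift w 1
    rw [h, hol_lift, mul_one, mul_one] at h1
    exact h1.symm
  -- surjectivity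
  let S : Subgroup (FundamentalGroup X x₀) := (FreeGroup.lift s).range
  -- A connecting path to every point, inside `U` when possible and otherwise through `A i` into `V
  -- i`. Closing up a path inside one member of the cover then gives an element of `S`.
  have hbase : ∀ x : X, ∃ d : FundamentalGroupoid.mk x₀ ⟶ FundamentalGroupoid.mk x,
      (∀ hx : x ∈ W none, d = c none hx₀ hx) ∧
      ∀ i (hx : x ∈ W (some i)), (c none hx₀ (hpU i _ (hp i)) ≫ c (some i) (hpV i _ (hp i)) hx ≫ inv d :
        FundamentalGroup X x₀) ∈ S := by
    intro x
    by_cases hxU : x ∈ W none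
    · refine ⟨c none hx₀ hxU, fun _ => rfl, fun i hx => ?_⟩
      rcases (hUV i).subset ⟨hxU, hx⟩ with h | h
      · have e1 : c (some i) (hpV i _ (hp i)) hx = c none (hpU i _ (hp i)) hxU :=
          hccommon (some i) none (A i) (hA1 i) (hpV i) (hpU i) (hp i) h
        rw [e1, ← Category.assoc, hctrans, IsIso.hom_inv_id]
        exact one_mem S
      · have e1 : c (some i) (hqV i _ (hq i)) hx = c none (hqU i _ (hq i)) hxU :=
          hccommon (some i) none (B i) (hB1 i) (hqV i) (hqU i) (hq i) h
        have e2 : c none (hqU i _ (hq i)) hxU ≫ inv (c none hx₀ hxU) = c none (hqU i _ (hq i)) hx₀ := by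
          rw [IsIso.comp_inv_eq, hctrans]
        rw [← hctrans (some i) (hpV i _ (hp i)) (hqV i _ (hq i)) hx, e1, Category.assoc, e2]
        exact ⟨FreeGroup.of i, FreeGroup.lift_apply_of⟩
    · obtain ⟨i, hx⟩ := (hcov x).resolve_left hxU
      refine ⟨c none hx₀ (hpU i _ (hp i)) ≫ c (some i) (hpV i _ (hp i)) hx, fun h => absurd h hxU,
        fun j hx' => ?_⟩
      obtain rfl : i = j := by
        by_contra hij
        exact Set.disjoint_left.1 (hVV i j hij) hx hx'
      rw [← Category.assoc, IsIso.hom_inv_id]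
      exact one_mem S
  choose d hdU hdV using hbase
  have hgen : ∀ ⦃x y : X⦄ (γ : Path.Homotopic.Quotient x y),
      (d x ≫ FundamentalGroupoid.fromPath γ ≫ inv (d y) : FundamentalGroup X x₀) ∈ S := by
    intro x y γ
    refine path_induction hWo hWc (C := fun x y γ =>
      (d x ≫ FundamentalGroupoid.fromPath γ ≫ inv (d y) : FundamentalGroup X x₀) ∈ S) ?_ ?_ γ
    · intro x y z γ δ h1 h2
      have h3 := mul_mem h2 h1
      convert h3 using 1
      change _ = (d x ≫ FundamentalGroupoid.fromPath γ ≫ inv (d y)) ≫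
        (d y ≫ FundamentalGroupoid.fromPath δ ≫ inv (d z))
      simp only [Category.assoc, IsIso.inv_hom_id_assoc]
      rw [← Category.assoc (FundamentalGroupoid.fromPath γ)]
      rfl
    · rintro (_ | i) x y γ hγ
      · have hx : x ∈ W none := by simpa using hγ 0
        have hy : y ∈ W none := by simpa using hγ 1
        rw [hc none hx hy γ hγ, hdU x hx, hdU y hy, ← Category.assoc, hctrans, IsIso.hom_inv_id]
        exact one_mem S
      · have hx : x ∈ W (some i) := by simpa using hγ 0
        have hy : y ∈ W (some i) := by simpa using hγ 1
        have h3 := mul_mem (hdV y i hy) (inv_mem (hdV x i hx))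
        convert h3 using 1
        rw [hc (some i) hx hy γ hγ]
        change _ = Groupoid.inv (c none hx₀ (hpU i _ (hp i)) ≫ c (some i) (hpV i _ (hp i)) hx ≫ inv (d x)) ≫
          (c none hx₀ (hpU i _ (hp i)) ≫ c (some i) (hpV i _ (hp i)) hy ≫ inv (d y))
        rw [Groupoid.inv_eq_inv, ← hctrans (some i) (hpV i _ (hp i)) hx hy]
        simp
  have hsurj : Function.Surjective (FreeGroup.lift s) := by
    intro α
    have h1 := hgen α
    have h2 : d x₀ = 𝟙 _ := by
      rw [hdU x₀ hx₀, ← hc none hx₀ hx₀ (Path.refl x₀) fun _ => hx₀]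
      rfl
    rw [h2] at h1
    have h3 : α ∈ S := by simpa using h1
    exact h3
  exact ⟨MulEquiv.ofBijective _ ⟨hinj, hsurj⟩⟩

end OpenCover

/-! ### The fundamental group of the punctured torus -/

/-- The identity of Y factors through the contractible space Z and is therefore nullhomotopic. -/
theorem contractibleSpace_of_leftInverse {Y Z : Type*} [TopologicalSpace Y] [TopologicalSpace Z]
    [ContractibleSpace Z] (σ : C(Y, Z)) (π : C(Z, Y)) (h : ∀ y, π (σ y) = y) :
    ContractibleSpace Y := by
  rw [contractible_iff_id_nullhomotopic]
  have h1 := ((id_nullhomotopic Z).comp_right π).comp_left σ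
  have h2 : (π.comp (ContinuousMap.id Z)).comp σ = ContinuousMap.id Y := by
    ext y; exact h y
  rwa [h2] at h1

namespace PuncturedTorus

open Set

theorem norm_coe_of_abs_le {r : ℝ} (hr : |r| ≤ 1 / 2) : ‖(r : UnitAddCircle)‖ = |r| :=
  (AddCircle.norm_coe_eq_abs_iff 1 one_ne_zero).2 (by simpa using hr)

theorem exists_coe_eq (z : UnitAddCircle) : ∃ r : ℝ, (r : UnitAddCircle) = z ∧ -1 / 2 < r ∧ r ≤ 1 / 2 := by
  refine ⟨(AddCircle.equivIoc 1 (-1 / 2) z : ℝ), (AddCircle.equivIoc 1 (-1 / 2)).symm_apply_apply z, ?_⟩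
  obtain ⟨h1, h2⟩ := (AddCircle.equivIoc 1 (-1 / 2 : ℝ) z).2
  exact ⟨h1, by linarith⟩

theorem coe_add_one (r : ℝ) : ((r + 1 : ℝ) : UnitAddCircle) = r := AddCircle.coe_add_period 1 r

theorem coe_injOn (a : ℝ) {r s : ℝ} (hr : r ∈ Ioo a (a + 1)) (hs : s ∈ Ioo a (a + 1))
    (h : (r : UnitAddCircle) = s) : r = s :=
  (AddCircle.coe_eq_coe_iff_of_mem_Ico (Ioo_subset_Ico_self hr) (Ioo_subset_Ico_self hs)).1 h

theorem norm_coe_gt {r : ℝ} (hr : r ∈ Ioo (1 / 4 : ℝ) (3 / 4)) : 1 / 4 < ‖(r : UnitAddCircle)‖ := by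
  obtain ⟨h1, h2⟩ := hr
  rcases le_total r (1 / 2) with h | h
  · rw [norm_coe_of_abs_le (by rw [abs_of_pos (by linarith)]; exact h), abs_of_pos (by linarith)]
    exact h1
  · have h3 : ((r - 1 : ℝ) : UnitAddCircle) = r := by
      rw [← coe_add_one, sub_add_cancel]
    rw [← h3, norm_coe_of_abs_le (by rw [abs_of_neg (by linarith)]; linarith),
      abs_of_neg (by linarith)]
    linarith

/-- A set that is parametrized by a star convex subset of the plane is simply connected. -/
theorem isSimplyConnected_of_chart (a b : ℝ) {S : Set (ℝ × ℝ)} {W : Set PuncturedTorus} {x : ℝ × ℝ}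
    (hx : x ∈ S) (hS : StarConvex ℝ x S)
    (hSW : ∀ s ∈ S, ∃ h : min ‖(s.1 : UnitAddCircle)‖ ‖(s.2 : UnitAddCircle)‖ ≤ 1 / 4,
      (⟨(s.1, s.2), h⟩ : PuncturedTorus) ∈ W)
    (hWS : ∀ p ∈ W, ∃ s ∈ S, s.1 ∈ Ioo a (a + 1) ∧ s.2 ∈ Ioo b (b + 1) ∧
      (s.1 : UnitAddCircle) = p.1.1 ∧ (s.2 : UnitAddCircle) = p.1.2) : IsSimplyConnected W := by
  have : ContractibleSpace S := hS.contractibleSpace ⟨x, hx⟩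
  let ca := AddCircle.openPartialHomeomorphCoe (1 : ℝ) a
  let cb := AddCircle.openPartialHomeomorphCoe (1 : ℝ) b
  have hinv : ∀ p ∈ W, (ca.symm p.1.1, cb.symm p.1.2) ∈ S ∧ p.1.1 ∈ ca.target ∧ p.1.2 ∈ cb.target := by
    intro p hp
    obtain ⟨s, hs, h1, h2, h3, h4⟩ := hWS p hp
    have e1 : ca.symm p.1.1 = s.1 := by rw [← h3]; exact ca.left_inv h1
    have e2 : cb.symm p.1.2 = s.2 := by rw [← h4]; exact cb.left_inv h2
    rw [e1, e2, ← h3, ← h4]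
    exact ⟨hs, ca.map_source h1, cb.map_source h2⟩
  let σ : C(W, S) := ⟨fun p => ⟨(ca.symm p.1.1.1, cb.symm p.1.1.2), (hinv p.1 p.2).1⟩, by
    refine Continuous.subtype_mk (Continuous.prodMk ?_ ?_) _
    · exact ca.continuousOn_symm.comp_continuous (by fun_prop) fun p => (hinv p.1 p.2).2.1
    · exact cb.continuousOn_symm.comp_continuous (by fun_prop) fun p => (hinv p.1 p.2).2.2⟩
  let π : C(S, W) := ⟨fun s => ⟨⟨(s.1.1, s.1.2), (hSW s.1 s.2).1⟩, (hSW s.1 s.2).2⟩, by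
    refine Continuous.subtype_mk (Continuous.subtype_mk (Continuous.prodMk ?_ ?_) _) _
    · exact (AddCircle.continuous_mk' 1).comp (by fun_prop)
    · exact (AddCircle.continuous_mk' 1).comp (by fun_prop)⟩
  have : ContractibleSpace W := contractibleSpace_of_leftInverse σ π (by
    intro p
    apply Subtype.ext
    apply Subtype.ext
    exact Prod.ext (ca.right_inv (hinv p.1 p.2).2.1) (cb.right_inv (hinv p.1 p.2).2.2))
  exact inferInstanceAs (SimplyConnectedSpace W)

/-- The two coordinates. -/
def coordinate (i : Fin 2) (p : PuncturedTorus) : UnitAddCircle := ![p.1.1, p.1.2] i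

theorem continuous_coordinate (i : Fin 2) : Continuous (coordinate i) := by
  fin_cases i
  · exact continuous_fst.comp continuous_subtype_val
  · exact continuous_snd.comp continuous_subtype_val

/-- The part of the punctured torus on which one of the coordinates is in a given interval. -/
def band (i : Fin 2) (α β : ℝ) : Set PuncturedTorus :=
  coordinate i ⁻¹' ((fun r : ℝ => (r : UnitAddCircle)) '' Ioo α β)

/-- The part of the punctured torus on which both coordinates are different from `1 / 2`. -/
def cross : Set PuncturedTorus := {p | ∀ i, coordinate i p ≠ ((1 / 2 : ℝ) : UnitAddCircle)}

theorem isOpen_band (i : Fin 2) (α β : ℝ) : IsOpen (band i α β) :=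
  ((QuotientAddGroup.isOpenMap_coe) _ isOpen_Ioo).preimage (continuous_coordinate i)

theorem isOpen_cross : IsOpen cross := by
  rw [cross, ofPred_forall]
  exact isOpen_iInter_of_finite fun i => isOpen_ne.preimage (continuous_coordinate i)

/-- The symmetry that exchanges the coordinates. -/
def swap : PuncturedTorus ≃ₜ PuncturedTorus where
  toFun p := ⟨p.1.swap, by rw [min_comm]; exact p.2⟩
  invFun p := ⟨p.1.swap, by rw [min_comm]; exact p.2⟩
  left_inv p := by simp
  right_inv p := by simp
  continuous_toFun := by fun_prop
  continuous_invFun := by fun_prop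

theorem norm_coordinate_le {i j : Fin 2} (hij : i ≠ j) {p : PuncturedTorus}
    (h : 1 / 4 < ‖coordinate i p‖) : ‖coordinate j p‖ ≤ 1 / 4 := by
  have hp := min_le_iff.1 p.2
  fin_cases i <;> fin_cases j <;> first | exact absurd rfl hij | skip
  · exact hp.resolve_left (not_le.2 h)
  · exact hp.resolve_right (not_le.2 h)

/-- Where one coordinate has norm above 1/4 the other has norm at most 1/4, so the band is a
rectangle. -/
theorem isSimplyConnected_band (i : Fin 2) {α β : ℝ} (hα : 1 / 4 ≤ α) (hαβ : α < β)
    (hβ : β ≤ 3 / 4) : IsSimplyConnected (band i α β) := by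
  have h0 : IsSimplyConnected (band 0 α β) := by
    refine isSimplyConnected_of_chart 0 (-1 / 2) (S := Ioo α β ×ˢ Icc (-1 / 4) (1 / 4))
      (x := ((α + β) / 2, 0)) ⟨⟨by simp; linarith, by simp; linarith⟩, by norm_num, by norm_num⟩
      (((convex_Ioo α β).prod (convex_Icc _ _)).starConvex
        ⟨⟨by simp; linarith, by simp; linarith⟩, by norm_num, by norm_num⟩) ?_ ?_
    · rintro ⟨s, t⟩ ⟨hs, ht1, ht2⟩
      simp only at hs ht1 ht2
      have ht : |t| ≤ 1 / 4 := abs_le.2 ⟨by linarith, ht2⟩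
      exact ⟨(min_le_right _ _).trans (by rw [norm_coe_of_abs_le (by linarith)]; exact ht), s, hs, rfl⟩
    · rintro p ⟨s, hs, hsp⟩
      have hs' : s ∈ Ioo (1 / 4 : ℝ) (3 / 4) := ⟨by linarith [hs.1], by linarith [hs.2]⟩
      have h2 : ‖coordinate 1 p‖ ≤ 1 / 4 :=
        norm_coordinate_le (i := 0) (by decide) (by rw [← hsp]; exact norm_coe_gt hs')
      obtain ⟨t, ht, ht1, ht2⟩ := exists_coe_eq (coordinate 1 p)
      rw [← ht, norm_coe_of_abs_le (abs_le.2 ⟨by linarith, ht2⟩), abs_le] at h2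
      exact ⟨(s, t), ⟨hs, by simp; constructor <;> linarith⟩,
        ⟨by simp; linarith [hs'.1], by simp; linarith [hs'.2]⟩, ⟨ht1, by simp; linarith⟩, hsp, ht⟩
  fin_cases i
  · exact h0
  · exact (swap.isSimplyConnected_preimage).2 h0

/-- Cutting both circles at 1/2 leaves a cross in the plane that is star-shaped about the origin. -/
theorem isSimplyConnected_cross : IsSimplyConnected cross := by
  refine isSimplyConnected_of_chart (-1 / 2) (-1 / 2) (x := 0)
    (S := {s : ℝ × ℝ | |s.1| < 1 / 2 ∧ |s.2| < 1 / 2 ∧ (|s.1| ≤ 1 / 4 ∨ |s.2| ≤ 1 / 4)})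
    (by norm_num) ?_ ?_ ?_
  · rw [starConvex_zero_iff]
    rintro ⟨s, t⟩ ⟨h1, h2, h3⟩ k hk0 hk1
    have hmul : ∀ r : ℝ, |k * r| ≤ |r| := fun r => by
      rw [abs_mul, abs_of_nonneg hk0]
      exact mul_le_of_le_one_left (abs_nonneg _) hk1
    exact ⟨(hmul s).trans_lt h1, (hmul t).trans_lt h2, h3.imp (hmul s).trans (hmul t).trans⟩
  · rintro ⟨s, t⟩ ⟨h1, h2, h3⟩
    simp only at h1 h2 h3
    refine ⟨by rw [norm_coe_of_abs_le h1.le, norm_coe_of_abs_le h2.le]; exact min_le_iff.2 h3, ?_⟩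
    have hne : ∀ r : ℝ, |r| < 1 / 2 → (r : UnitAddCircle) ≠ ((1 / 2 : ℝ) : UnitAddCircle) := by
      intro r hr h
      have := congrArg norm h
      rw [norm_coe_of_abs_le hr.le, norm_coe_of_abs_le (by norm_num [abs_of_pos])] at this
      norm_num [abs_of_pos] at this
      linarith
    intro i
    fin_cases i
    · exact hne s h1
    · exact hne t h2
  · intro p hp
    have key : ∀ i, ∃ r : ℝ, (r : UnitAddCircle) = coordinate i p ∧ |r| < 1 / 2 ∧
        r ∈ Ioo (-1 / 2 : ℝ) (-1 / 2 + 1) ∧ ‖coordinate i p‖ = |r| := by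
      intro i
      obtain ⟨r, hr, hr1, hr2⟩ := exists_coe_eq (coordinate i p)
      have hr3 : r < 1 / 2 := lt_of_le_of_ne hr2 (by
        rintro rfl
        exact hp i hr.symm)
      have habs : |r| < 1 / 2 := abs_lt.2 ⟨by linarith, hr3⟩
      exact ⟨r, hr, habs, ⟨hr1, by linarith⟩, by rw [← hr, norm_coe_of_abs_le habs.le]⟩
    obtain ⟨s, hs, hs1, hs2, hs3⟩ := key 0
    obtain ⟨t, ht, ht1, ht2, ht3⟩ := key 1
    refine ⟨(s, t), ⟨hs1, ht1, ?_⟩, hs2, ht2, hs, ht⟩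
    have := min_le_iff.1 p.2
    rw [← hs3, ← ht3]
    exact this

theorem mem_cross_or (p : PuncturedTorus) : p ∈ cross ∨ ∃ i, p ∈ band i (1 / 4) (3 / 4) := by
  by_cases h : p ∈ cross
  · exact Or.inl h
  · rw [cross, mem_ofPred_eq] at h
    push Not at h
    obtain ⟨i, hi⟩ := h
    exact Or.inr ⟨i, 1 / 2, by norm_num, hi.symm⟩

/-- On a band the other coordinate is already away from 1/2, so the cross removes only the middle
line. -/
theorem cross_inter_band (i : Fin 2) :
    cross ∩ band i (1 / 4) (3 / 4) = band i (1 / 4) (1 / 2) ∪ band i (1 / 2) (3 / 4) := by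
  have hback : ∀ r ∈ Ioo (1 / 4 : ℝ) (3 / 4), r ≠ 1 / 2 → ∀ p, (r : UnitAddCircle) = coordinate i p →
      p ∈ cross := by
    intro r hr hr' p hp j
    by_cases hij : i = j
    · subst hij
      rw [← hp]
      intro h
      exact hr' (coe_injOn 0 ⟨by linarith [hr.1], by linarith [hr.2]⟩ (by norm_num) h)
    · intro h
      have h1 := norm_coordinate_le hij (p := p) (by rw [← hp]; exact norm_coe_gt hr)
      rw [h, norm_coe_of_abs_le (by norm_num [abs_of_pos])] at h1
      norm_num [abs_of_pos] at h1
  ext p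
  constructor
  · rintro ⟨h, r, hr, hrp⟩
    rcases lt_trichotomy r (1 / 2) with h1 | h1 | h1
    · exact Or.inl ⟨r, ⟨hr.1, h1⟩, hrp⟩
    · subst h1
      exact absurd hrp.symm (h i)
    · exact Or.inr ⟨r, ⟨h1, hr.2⟩, hrp⟩
  · rintro (⟨r, hr, hrp⟩ | ⟨r, hr, hrp⟩)
    · have hr' : r ∈ Ioo (1 / 4 : ℝ) (3 / 4) := ⟨hr.1, by linarith [hr.2]⟩
      exact ⟨hback r hr' hr.2.ne p hrp, r, hr', hrp⟩
    · have hr' : r ∈ Ioo (1 / 4 : ℝ) (3 / 4) := ⟨by linarith [hr.1], hr.2⟩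
      exact ⟨hback r hr' hr.1.ne' p hrp, r, hr', hrp⟩

instance : PathConnectedSpace PuncturedTorus := by
  have hz : min ‖(0 : UnitAddCircle)‖ ‖(0 : UnitAddCircle)‖ ≤ 1 / 4 := by norm_num
  obtain ⟨p₀, hp₀⟩ := isSimplyConnected_cross.nonempty
  have h : ∀ p, Joined p₀ p := by
    intro p
    rcases mem_cross_or p with h | ⟨i, h⟩
    · exact (isSimplyConnected_cross.isPathConnected.joinedIn _ hp₀ _ h).joined
    · obtain ⟨q, hq⟩ := (isSimplyConnected_band i (le_refl (1 / 4 : ℝ)) (β := 1 / 2) (by norm_num)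
        (by norm_num)).nonempty
      have hq' := (cross_inter_band i).symm.subset (Or.inl hq)
      exact (isSimplyConnected_cross.isPathConnected.joinedIn _ hp₀ _ hq'.1).joined.trans
        ((isSimplyConnected_band i le_rfl (by norm_num) le_rfl).isPathConnected.joinedIn _ hq'.2 _
          h).joined
  exact { nonempty := ⟨p₀⟩, joined := fun x y => (h x).symm.trans (h y) }

/-- The fundamental group of the punctured torus is free of rank two. -/
theorem nonempty_mulEquiv_fundamentalGroup (x : PuncturedTorus) :
    Nonempty (F2 ≃* FundamentalGroup PuncturedTorus x) := by
  obtain ⟨p₀, hp₀⟩ := isSimplyConnected_cross.nonempty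
  obtain ⟨e⟩ := nonempty_freeGroup_mulEquiv_fundamentalGroup (ι := Fin 2) isOpen_cross
    (fun i => isOpen_band i (1 / 4) (3 / 4)) (fun i => isOpen_band i (1 / 4) (1 / 2))
    (fun i => isOpen_band i (1 / 2) (3 / 4)) mem_cross_or cross_inter_band
    (by
      intro i
      rw [Set.disjoint_left]
      rintro p ⟨r, hr, hrp⟩ ⟨s, hs, hsp⟩
      have := coe_injOn 0 ⟨by linarith [hr.1], by linarith [hr.2]⟩
        ⟨by linarith [hs.1], by linarith [hs.2]⟩ (hrp.trans hsp.symm)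
      linarith [hr.2, hs.1])
    (by
      intro i j hij
      rw [Set.disjoint_left]
      rintro p ⟨r, hr, hrp⟩ ⟨s, hs, hsp⟩
      have h1 := norm_coordinate_le hij (p := p) (by rw [← hrp]; exact norm_coe_gt hr)
      rw [← hsp] at h1
      exact absurd h1 (not_le.2 (norm_coe_gt hs)))
    isSimplyConnected_cross (fun i => isSimplyConnected_band i le_rfl (by norm_num) le_rfl)
    (fun i => (isSimplyConnected_band i le_rfl (by norm_num) (by norm_num)).isPathConnected)
    (fun i => (isSimplyConnected_band i (by norm_num) (by norm_num) le_rfl).isPathConnected) hp₀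
  exact ⟨e.trans (FundamentalGroup.fundamentalGroupMulEquivOfPathConnected p₀ x)⟩

end PuncturedTorus

/-! ### The infinite cyclic cover of a punctured torus bundle -/

/-- The infinite cyclic cover `T × ℝ` of the bundle. -/
@[ext]
structure CyclicCover (h : Monodromy) where
  /-- The component in the fiber. -/
  point : PuncturedTorus
  /-- The component in the line. -/
  height : ℝ

namespace CyclicCover

open Topology Set

variable (h : Monodromy)

/-- The underlying bijection with the product. -/
def equivProd : CyclicCover h ≃ PuncturedTorus × ℝ where
  toFun e := (e.point, e.height)
  invFun p := ⟨p.1, p.2⟩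
  left_inv _ := rfl
  right_inv _ := rfl

instance : TopologicalSpace (CyclicCover h) := .induced (equivProd h) inferInstance

/-- The infinite cyclic cover is homeomorphic to the product `T × ℝ`. -/
def homeomorphProd : CyclicCover h ≃ₜ PuncturedTorus × ℝ :=
  (equivProd h).toHomeomorphOfIsInducing ⟨rfl⟩

theorem continuous_point : Continuous (point : CyclicCover h → PuncturedTorus) :=
  continuous_fst.comp (homeomorphProd h).continuous

theorem continuous_height : Continuous (height : CyclicCover h → ℝ) :=
  continuous_snd.comp (homeomorphProd h).continuous

variable {h} in
theorem continuous_mk {X : Type*} [TopologicalSpace X] {f : X → PuncturedTorus} {g : X → ℝ}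
    (hf : Continuous f) (hg : Continuous g) :
    Continuous fun a => (⟨f a, g a⟩ : CyclicCover h) :=
  (homeomorphProd h).symm.continuous.comp (hf.prodMk hg)

instance : AddAction ℤ (CyclicCover h) where
  -- The inverse power of h compensates for the power by the integer part of the height in the
  -- projection.
  vadd n e := ⟨(h.toHomeomorph ^ (-n)) e.point, e.height + n⟩
  zero_vadd e := by
    change (⟨(h.toHomeomorph ^ (-(0 : ℤ))) e.point, e.height + ((0 : ℤ) : ℝ)⟩ : CyclicCover h) = e
    simp
  add_vadd m n e := by
    change (⟨(h.toHomeomorph ^ (-(m + n))) e.point, e.height + ((m + n : ℤ) : ℝ)⟩ : CyclicCover h) =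
      ⟨(h.toHomeomorph ^ (-m)) ((h.toHomeomorph ^ (-n)) e.point), e.height + n + m⟩
    rw [← Homeomorph.mul_apply, ← zpow_add, neg_add, Int.cast_add]
    congr 1
    ring

theorem vadd_def (n : ℤ) (e : CyclicCover h) :
    n +ᵥ e = ⟨(h.toHomeomorph ^ (-n)) e.point, e.height + n⟩ := rfl

/-- The covering map. -/
noncomputable def proj (e : CyclicCover h) : PuncturedTorusBundle h :=
  Quot.mk _ ((h.toHomeomorph ^ ⌊e.height⌋) e.point,
    ⟨Int.fract e.height, Int.fract_nonneg _, (Int.fract_lt_one _).le⟩)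

/-- The formula on the unit slab extends to its upper end because of the gluing relation. Having it
on closed slabs is what yields continuity. -/
theorem proj_eq (n : ℤ) (e : CyclicCover h) (he : e.height - n ∈ unitInterval) :
    proj h e = Quot.mk _ ((h.toHomeomorph ^ n) e.point, ⟨e.height - n, he⟩) := by
  obtain ⟨y, s⟩ := e
  obtain ⟨h1, h2⟩ := he
  simp only at h1 h2
  rcases h2.lt_or_eq with h2' | h2'
  · have hf : ⌊s⌋ = n := Int.floor_eq_iff.2 ⟨by linarith, by linarith⟩
    subst hf
    rfl
  · have hs : s = n + 1 := by linarith
    have hf : ⌊s⌋ = 1 + n := by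
      rw [hs, add_comm 1 n]
      exact_mod_cast Int.floor_intCast (n + 1)
    have h3 := Quot.sound (BundleRel.glue (h := h) ((h.toHomeomorph ^ n) y))
    rw [← Homeomorph.mul_apply, ← zpow_one_add] at h3
    have e1 : proj h ⟨y, s⟩ = Quot.mk _ ((h.toHomeomorph ^ (1 + n)) y, 0) := by
      refine congrArg (Quot.mk _) (Prod.ext ?_ (Subtype.ext ?_))
      · exact congrArg (fun m : ℤ => (h.toHomeomorph ^ m) y) hf
      · change Int.fract s = 0
        rw [Int.fract, hf, hs]
        push_cast
        ring
    rw [e1, ← h3]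
    exact congrArg (Quot.mk _) (Prod.ext rfl (Subtype.ext h2'.symm))

theorem continuous_proj : Continuous (proj h) := by
  have hlf : LocallyFinite fun n : ℤ => (height ⁻¹' Icc (n : ℝ) (n + 1) : Set (CyclicCover h)) := by
    intro e
    refine ⟨height ⁻¹' Ioo (e.height - 1) (e.height + 1),
      (isOpen_Ioo.preimage (continuous_height h)).mem_nhds
      ⟨by simp, by simp⟩, (Set.finite_Icc (⌊e.height⌋ - 2) (⌊e.height⌋ + 2)).subset ?_⟩
    rintro n ⟨e', ⟨h1, h2⟩, h3, h4⟩
    have h5 := Int.floor_le e.height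
    have h6 := Int.lt_floor_add_one e.height
    constructor
    · have : (⌊e.height⌋ : ℝ) - 2 < n := by linarith
      exact_mod_cast this.le
    · have : (n : ℝ) < ⌊e.height⌋ + 2 := by linarith
      exact_mod_cast this.le
  refine hlf.continuous ?_ (fun n => isClosed_Icc.preimage (continuous_height h)) ?_
  · rw [eq_univ_iff_forall]
    intro e
    exact mem_iUnion.2 ⟨⌊e.height⌋, Int.floor_le _, (Int.lt_floor_add_one _).le⟩
  · intro n
    rw [continuousOn_iff_continuous_domRestrict]
    have hmem : ∀ e : (height ⁻¹' Icc (n : ℝ) (n + 1) : Set (CyclicCover h)),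
        e.1.height - n ∈ unitInterval := fun e => ⟨by linarith [e.2.1], by linarith [e.2.2]⟩
    have heq : (height ⁻¹' Icc (n : ℝ) (n + 1) : Set (CyclicCover h)).domRestrict (proj h) =
        fun e => Quot.mk _ ((h.toHomeomorph ^ n) e.1.point, ⟨e.1.height - n, hmem e⟩) := by
      funext e
      exact proj_eq h n e.1 (hmem e)
    rw [heq]
    refine continuous_quot_mk.comp (Continuous.prodMk ?_ (Continuous.subtype_mk ?_ _))
    · exact (h.toHomeomorph ^ n).continuous.comp ((continuous_point h).comp continuous_subtype_val)
    · exact ((continuous_height h).comp continuous_subtype_val).sub continuous_const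

theorem proj_coe (y : PuncturedTorus) (s : unitInterval) :
    proj h ⟨y, s⟩ = Quot.mk _ (y, s) := by
  rw [proj_eq h 0 ⟨y, s⟩ (by simp)]
  simp

/-- Representatives of the points of the bundle. -/
noncomputable def representative : PuncturedTorusBundle h → PuncturedTorus × unitInterval :=
  Quot.lift (fun p => if p.2 = 1 then (h.toHomeomorph p.1, 0) else p) (by
    rintro _ _ ⟨x⟩
    simp)

theorem representative_proj (e : CyclicCover h) : representative h (proj h e) =
    ((h.toHomeomorph ^ ⌊e.height⌋) e.point,
      ⟨Int.fract e.height, Int.fract_nonneg _, (Int.fract_lt_one _).le⟩) := by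
  refine if_neg ?_
  intro h1
  have h2 := congrArg Subtype.val h1
  exact (Int.fract_lt_one e.height).ne h2

theorem proj_vadd (n : ℤ) (e : CyclicCover h) : proj h (n +ᵥ e) = proj h e := by
  refine congrArg (Quot.mk _) (Prod.ext ?_ (Subtype.ext ?_))
  · change (h.toHomeomorph ^ ⌊e.height + n⌋) ((h.toHomeomorph ^ (-n)) e.point) = _
    rw [← Homeomorph.mul_apply, ← zpow_add, Int.floor_add_intCast, add_neg_cancel_right]
  · exact Int.fract_add_intCast _ _

theorem isAddQuotientCoveringMap_proj : IsAddQuotientCoveringMap (proj h) ℤ where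
  toIsQuotientMap := by
    have hincl : Continuous fun p : PuncturedTorus × unitInterval =>
        (⟨p.1, (p.2 : ℝ)⟩ : CyclicCover h) :=
      continuous_mk continuous_fst (continuous_subtype_val.comp continuous_snd)
    refine IsQuotientMap.of_comp hincl (continuous_proj h) ?_
    convert isQuotientMap_quot_mk (r := BundleRel h) using 1
    funext p
    exact proj_coe h p.1 p.2
  continuous_const_vadd n :=
    continuous_mk ((h.toHomeomorph ^ (-n)).continuous.comp (continuous_point h))
      ((continuous_height h).add continuous_const)
  apply_eq_iff_mem_orbit := by
    intro e₁ e₂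
    constructor
    · intro heq
      have h1 := congrArg (representative h) heq
      rw [representative_proj, representative_proj] at h1
      obtain ⟨h2, h3⟩ := Prod.mk.inj h1
      have h3 : Int.fract e₁.height = Int.fract e₂.height := congrArg Subtype.val h3
      refine ⟨⌊e₁.height⌋ - ⌊e₂.height⌋, ?_⟩
      change (⌊e₁.height⌋ - ⌊e₂.height⌋) +ᵥ e₂ = e₁
      rw [vadd_def]
      have h4 : -(⌊e₁.height⌋ - ⌊e₂.height⌋) = -⌊e₁.height⌋ + ⌊e₂.height⌋ := by ring
      refine CyclicCover.ext ?_ ?_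
      · simp only
        rw [h4, zpow_add, Homeomorph.mul_apply, ← h2, ← Homeomorph.mul_apply, ← zpow_add,
          neg_add_cancel, zpow_zero, Homeomorph.one_apply]
      · simp only [Int.fract] at h3
        push_cast
        linarith
    · rintro ⟨n, rfl⟩
      exact proj_vadd h n e₂
  disjoint := by
    intro e
    refine ⟨height ⁻¹' Ioo (e.height - 1 / 2) (e.height + 1 / 2),
      (isOpen_Ioo.preimage (continuous_height h)).mem_nhds ⟨by simp, by simp⟩, ?_⟩
    rintro n ⟨_, ⟨e', ⟨h1, h2⟩, rfl⟩, h3, h4⟩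
    simp only [vadd_def] at h3 h4
    have h5 : (n : ℝ) < 1 := by linarith
    have h6 : (-1 : ℝ) < n := by linarith
    have h7 : n < 1 := by exact_mod_cast h5
    have h8 : -1 < n := by exact_mod_cast h6
    omega

/-- The inclusion of the fiber over `0`. -/
def fiber : C(PuncturedTorus, CyclicCover h) where
  toFun y := ⟨y, 0⟩
  continuous_toFun := continuous_mk continuous_id continuous_const

theorem proj_fiber (y : PuncturedTorus) : proj h (fiber h y) = fiberInclusion h y :=
  proj_coe h y 0

/-- The projection onto the fiber. -/
def toFiber : C(CyclicCover h, PuncturedTorus) := ⟨point, continuous_point h⟩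

/-- The projection of T × ℝ onto T retracts onto the fiber. -/
theorem map_fiber_injective (x : PuncturedTorus) :
    Function.Injective (FundamentalGroup.map (fiber h) x) := by
  refine Function.LeftInverse.injective (g := FundamentalGroup.map (toFiber h) (fiber h x)) ?_
  intro δ
  induction δ using Path.Homotopic.Quotient.ind with
  | mk δ => rfl

/-- Scaling the height linearly to 0 deforms every loop into the fiber, keeping the ends fixed. -/
theorem exists_map_fiber_eq (x : PuncturedTorus) (γ : FundamentalGroup (CyclicCover h) (fiber h x)) :
    ∃ δ : FundamentalGroup PuncturedTorus x, FundamentalGroup.map (fiber h) x δ = γ := by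
  refine ⟨FundamentalGroup.map (toFiber h) (fiber h x) γ, ?_⟩
  change Path.Homotopic.Quotient.map (Path.Homotopic.Quotient.map γ (toFiber h)) (fiber h) = γ
  induction γ using Path.Homotopic.Quotient.ind with
  | mk γ =>
    refine Path.Homotopic.Quotient.eq.2 ⟨{
      toFun := fun s => ⟨(γ s.2).point, (s.1 : ℝ) * (γ s.2).height⟩
      continuous_toFun := continuous_mk
        ((continuous_point h).comp (γ.continuous.comp continuous_snd))
        ((continuous_subtype_val.comp continuous_fst).mul
          ((continuous_height h).comp (γ.continuous.comp continuous_snd)))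
      map_zero_left := fun s => CyclicCover.ext rfl (zero_mul _)
      map_one_left := fun s => CyclicCover.ext rfl (one_mul _)
      prop' := ?_ }⟩
    intro s a ha
    refine CyclicCover.ext rfl ?_
    have hγ : (γ a).height = 0 := by
      rcases ha with rfl | rfl
      · rw [γ.source]; rfl
      · rw [γ.target]; rfl
    change (s : ℝ) * (γ a).height = 0
    rw [hγ, mul_zero]

end CyclicCover

/-- A homotopy square ends at the image of the base point under h; since that point is fixed, the
square can be rewritten with loops. -/
theorem Path.Homotopic.Quotient.trans_cast_eq {X : Type*} [TopologicalSpace X] {a b : X}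
    {P : Path.Homotopic.Quotient a a} {E : Path.Homotopic.Quotient a b}
    {R : Path.Homotopic.Quotient b b} (h : P.trans E = E.trans R) (e : a = b) :
    P.trans (E.cast rfl e) = (E.cast rfl e).trans (R.cast e e) := by
  subst e
  simpa using h

/-- The fundamental group of the bundle is an extension of an infinite cyclic group by the
fundamental group of the fiber, with the action of the monodromy. -/
theorem exists_fundamentalGroup_extension (h : Monodromy) (x : PuncturedTorus)
    (hx : x ∈ PuncturedTorus.boundary) :
    ∃ (p : FundamentalGroup (PuncturedTorusBundle h) (fiberInclusion h x) →* Multiplicative ℤ)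
      (t : FundamentalGroup (PuncturedTorusBundle h) (fiberInclusion h x)),
      Function.Injective (FundamentalGroup.map (fiberInclusion h) x) ∧ p.ker = fiberGroup h x ∧
      p t = Multiplicative.ofAdd 1 ∧
      ∀ γ, t * FundamentalGroup.map (fiberInclusion h) x γ * t⁻¹ =
        FundamentalGroup.map (fiberInclusion h) x (monodromyOnPi1 h x hx γ) := by
  have hcov := CyclicCover.isAddQuotientCoveringMap_proj h
  let q : C(CyclicCover h, PuncturedTorusBundle h) := ⟨CyclicCover.proj h, hcov.continuous⟩
  let e : CyclicCover.proj h ⁻¹' {fiberInclusion h x} :=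
    ⟨CyclicCover.fiber h x, CyclicCover.proj_fiber h x⟩
  have he : q (CyclicCover.fiber h x) = fiberInclusion h x := CyclicCover.proj_fiber h x
  have hcomp : ∀ δ, FundamentalGroup.mapOfEq q he (FundamentalGroup.map (CyclicCover.fiber h) x δ) =
      FundamentalGroup.map (fiberInclusion h) x δ := by
    intro δ
    rw [FundamentalGroup.mapOfEq_apply]
    change Path.Homotopic.Quotient.cast (Path.Homotopic.Quotient.map
      (Path.Homotopic.Quotient.map δ (CyclicCover.fiber h)) q) _ _ =
      Path.Homotopic.Quotient.map δ (fiberInclusion h)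
    induction δ using Path.Homotopic.Quotient.ind with
    | mk δ =>
      refine congrArg Path.Homotopic.Quotient.mk ?_
      ext s
      exact CyclicCover.proj_fiber h (δ s)
  have hrange : (FundamentalGroup.mapOfEq q he).range = fiberGroup h x := by
    ext γ
    constructor
    · rintro ⟨γ, rfl⟩
      obtain ⟨δ, rfl⟩ := CyclicCover.exists_map_fiber_eq h x γ
      exact ⟨δ, (hcomp δ).symm⟩
    · rintro ⟨δ, rfl⟩
      exact ⟨_, hcomp δ⟩
  let f := hcov.fundamentalGroupToMulOpposite e
  let p : FundamentalGroup (PuncturedTorusBundle h) (fiberInclusion h x) →* Multiplicative ℤ :=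
    { toFun := fun γ => (f γ).unop
      map_one' := by rw [map_one]; rfl
      map_mul' := fun γ δ => by rw [map_mul, MulOpposite.unop_mul, mul_comm] }
  have hpf : p.ker = f.ker := by
    ext γ
    rw [MonoidHom.mem_ker, MonoidHom.mem_ker]
    exact MulOpposite.unop_eq_one_iff _
  -- Flowing once around the base is a homotopy from the fiber inclusion to its composite with h.
  -- The track of the base point is the stable letter, and naturality along it is the conjugation
  -- relation.
  let F : ContinuousMap.Homotopy (fiberInclusion h)
      ((fiberInclusion h).comp (h.toHomeomorph : C(PuncturedTorus, PuncturedTorus))) :=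
    { toFun := fun s => Quot.mk _ (s.2, s.1)
      continuous_toFun := continuous_quot_mk.comp (by fun_prop)
      map_zero_left := fun y => rfl
      map_one_left := fun y => Quot.sound (BundleRel.glue y) }
  have hxx : fiberInclusion h x =
      (fiberInclusion h).comp (h.toHomeomorph : C(PuncturedTorus, PuncturedTorus)) x :=
    congrArg (fiberInclusion h) (h.fixes_boundary x hx).symm
  let t : FundamentalGroup (PuncturedTorusBundle h) (fiberInclusion h x) :=
    (Path.Homotopic.Quotient.mk (F.evalAt x)).cast rfl hxx
  refine ⟨p, t, ?_, ?_, ?_, ?_⟩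
  · have hq : Function.Injective (FundamentalGroup.mapOfEq q he) := by
      intro α β hαβ
      rw [FundamentalGroup.mapOfEq_apply, FundamentalGroup.mapOfEq_apply] at hαβ
      have h1 := congrArg (fun γ => Path.Homotopic.Quotient.cast γ he he) hαβ
      simp only [Path.Homotopic.Quotient.cast_cast, Path.Homotopic.Quotient.cast_rfl_rfl] at h1
      exact hcov.isCoveringMap.injective_path_homotopic_map _ _ h1
    intro α β hαβ
    rw [← hcomp, ← hcomp] at hαβ
    exact CyclicCover.map_fiber_injective h x (hq hαβ)
  · rw [hpf, hcov.ker_fundamentalGroupToMulOpposite, hcov.ker_monodromyPerm e]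
    exact hrange
  · have h1 : f t = MulOpposite.op (Multiplicative.ofAdd 1) := by
      rw [hcov.fundamentalGroupToMulOpposite_apply_eq_Iff]
      have h0 : (1 : ℤ) +ᵥ CyclicCover.fiber h x = ⟨x, (1 : ℝ)⟩ := by
        rw [CyclicCover.vadd_def]
        refine CyclicCover.ext ?_ ?_
        · change (h.toHomeomorph ^ (-1 : ℤ)) x = x
          rw [zpow_neg_one]
          change h.toHomeomorph.symm x = x
          rw [Homeomorph.symm_apply_eq, h.fixes_boundary x hx]
        · change (0 : ℝ) + ((1 : ℤ) : ℝ) = 1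
          simp
      let Γ : Path (CyclicCover.fiber h x) ((1 : ℤ) +ᵥ CyclicCover.fiber h x) :=
        { toFun := fun s => ⟨x, (s : ℝ)⟩
          continuous_toFun := CyclicCover.continuous_mk continuous_const continuous_subtype_val
          source' := rfl
          target' := h0.symm }
      have h2 := hcov.isCoveringMap.monodromy_eq_of_map_eq (γ := t) (ex := e)
        (ey := ⟨(1 : ℤ) +ᵥ CyclicCover.fiber h x, (hcov.map_vadd 1).trans e.2⟩) (.mk Γ) (by
          refine congrArg Path.Homotopic.Quotient.mk ?_
          ext s
          exact CyclicCover.proj_coe h x s)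
      exact (congrArg Subtype.val h2).symm
    exact congrArg MulOpposite.unop h1
  · intro γ
    rw [mul_inv_eq_iff_eq_mul]
    change Path.Homotopic.Quotient.trans (Path.Homotopic.Quotient.map γ (fiberInclusion h)) t =
      Path.Homotopic.Quotient.trans t
        (Path.Homotopic.Quotient.map (monodromyOnPi1 h x hx γ) (fiberInclusion h))
    have h1 : Path.Homotopic.Quotient.map (monodromyOnPi1 h x hx γ) (fiberInclusion h) =
        (Path.Homotopic.Quotient.map γ ((fiberInclusion h).comp
          (h.toHomeomorph : C(PuncturedTorus, PuncturedTorus)))).cast hxx hxx := by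
      rw [monodromyOnPi1, FundamentalGroup.mapOfEq_apply, Path.Homotopic.Quotient.map_cast,
        Path.Homotopic.Quotient.map_comp]
    rw [h1]
    refine Path.Homotopic.Quotient.trans_cast_eq ?_ hxx
    induction γ using Path.Homotopic.Quotient.ind with
    | mk γ => exact Path.Homotopic.Quotient.eq.2 (Path.Homotopic.map_trans_evalAt F γ)

/-! ### Pushing the bundle into its interior -/

namespace PuncturedTorus

/-- The function `r ↦ r * (1 / 2 - |r|)` on the circle. -/
noncomputable def pull : UnitAddCircle → ℝ :=
  AddCircle.liftIco 1 (-1 / 2) fun r : ℝ => r * (1 / 2 - |r|)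

theorem continuous_pull : Continuous pull := by
  refine AddCircle.liftIco_continuous ?_ (by fun_prop)
  norm_num [abs_of_neg, abs_of_pos]

theorem pull_coe {r : ℝ} (h1 : -1 / 2 < r) (h2 : r ≤ 1 / 2) :
    pull (r : UnitAddCircle) = r * (1 / 2 - |r|) := by
  rcases h2.lt_or_eq with h | rfl
  · exact AddCircle.liftIco_coe_apply ⟨h1.le, by linarith⟩
  · have h3 : ((1 / 2 : ℝ) : UnitAddCircle) = ((-1 / 2 : ℝ) : UnitAddCircle) := by
      rw [← AddCircle.coe_add_period 1 (-1 / 2 : ℝ)]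
      norm_num
    rw [h3, pull, AddCircle.liftIco_coe_apply ⟨le_rfl, by norm_num⟩]
    norm_num [abs_of_neg, abs_of_pos]

/-- The isotopy of the circle that moves all points but `1 / 2` towards `0`. -/
noncomputable def pushCircle (s : ℝ) (z : UnitAddCircle) : UnitAddCircle :=
  z - ((s * pull z : ℝ) : UnitAddCircle)

theorem pushCircle_zero (z : UnitAddCircle) : pushCircle 0 z = z := by
  simp [pushCircle]

theorem norm_pushCircle {s : ℝ} (h0 : 0 ≤ s) (h1 : s ≤ 1) (z : UnitAddCircle) :
    ‖pushCircle s z‖ = ‖z‖ * (1 - s * (1 / 2 - ‖z‖)) := by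
  obtain ⟨r, rfl, hr1, hr2⟩ := exists_coe_eq z
  have hr : |r| ≤ 1 / 2 := abs_le.2 ⟨by linarith, hr2⟩
  have hs : 0 ≤ 1 - s * (1 / 2 - |r|) := by nlinarith [abs_nonneg r]
  have hs1 : 1 - s * (1 / 2 - |r|) ≤ 1 := by nlinarith [abs_nonneg r]
  have habs : |r * (1 - s * (1 / 2 - |r|))| = |r| * (1 - s * (1 / 2 - |r|)) := by
    rw [abs_mul, abs_of_nonneg hs]
  have heq : pushCircle s (r : UnitAddCircle) =
      ((r * (1 - s * (1 / 2 - |r|)) : ℝ) : UnitAddCircle) := by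
    rw [pushCircle, pull_coe hr1 hr2, ← AddCircle.coe_sub]
    congr 1
    ring
  rw [heq, norm_coe_of_abs_le hr, norm_coe_of_abs_le, habs]
  rw [habs]
  exact (mul_le_of_le_one_right (abs_nonneg r) hs1).trans hr

theorem norm_pushCircle_le {s : ℝ} (h0 : 0 ≤ s) (h1 : s ≤ 1) (z : UnitAddCircle) :
    ‖pushCircle s z‖ ≤ ‖z‖ := by
  rw [norm_pushCircle h0 h1]
  refine mul_le_of_le_one_right (norm_nonneg _) ?_
  have : ‖z‖ ≤ 1 / 2 := by simpa using AddCircle.norm_le_half_period 1 one_ne_zero (x := z)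
  nlinarith

theorem norm_pushCircle_lt {s : ℝ} (h0 : 0 < s) (h1 : s ≤ 1) {z : UnitAddCircle} (hz : ‖z‖ ≤ 1 / 4) :
    ‖pushCircle s z‖ < 1 / 4 := by
  rw [norm_pushCircle h0.le h1]
  have h2 := norm_nonneg z
  have h3 : s * (1 / 4) ≤ s * (1 / 2 - ‖z‖) := mul_le_mul_of_nonneg_left (by linarith) h0.le
  have h4 : ‖z‖ * (1 - s * (1 / 2 - ‖z‖)) ≤ ‖z‖ * (1 - s * (1 / 4)) :=
    mul_le_mul_of_nonneg_left (by linarith) h2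
  have h5 : ‖z‖ * (1 - s * (1 / 4)) ≤ 1 / 4 * (1 - s * (1 / 4)) :=
    mul_le_mul_of_nonneg_right hz (by linarith)
  linarith

theorem notMem_boundary_iff {p : PuncturedTorus} :
    p ∉ boundary ↔ ‖p.1.1‖ < 1 / 4 ∨ ‖p.1.2‖ < 1 / 4 := by
  rw [← min_lt_iff]
  exact ⟨fun h => lt_of_le_of_ne p.2 h, fun h => h.ne⟩

/-- The isotopy of the punctured torus that moves it into its interior. -/
noncomputable def push (s : unitInterval) (p : PuncturedTorus) : PuncturedTorus :=
  ⟨(pushCircle s p.1.1, pushCircle s p.1.2),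
    (min_le_min (norm_pushCircle_le s.2.1 s.2.2 _) (norm_pushCircle_le s.2.1 s.2.2 _)).trans p.2⟩

theorem continuous_push : Continuous fun q : unitInterval × PuncturedTorus => push q.1 q.2 := by
  have h : Continuous fun q : unitInterval × UnitAddCircle => pushCircle q.1 q.2 := by
    refine continuous_snd.sub ((AddCircle.continuous_mk' 1).comp ?_)
    exact (continuous_subtype_val.comp continuous_fst).mul (continuous_pull.comp continuous_snd)
  refine Continuous.subtype_mk (Continuous.prodMk ?_ ?_) _
  · exact h.comp (continuous_fst.prodMk
      (continuous_fst.comp (continuous_subtype_val.comp continuous_snd)))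
  · exact h.comp (continuous_fst.prodMk
      (continuous_snd.comp (continuous_subtype_val.comp continuous_snd)))

theorem push_zero (p : PuncturedTorus) : push 0 p = p :=
  Subtype.ext (Prod.ext (pushCircle_zero _) (pushCircle_zero _))

theorem push_notMem_boundary (s : unitInterval) {p : PuncturedTorus} (hp : p ∉ boundary) :
    push s p ∉ boundary := by
  rw [notMem_boundary_iff] at hp ⊢
  exact hp.imp (norm_pushCircle_le s.2.1 s.2.2 _).trans_lt (norm_pushCircle_le s.2.1 s.2.2 _).trans_lt

theorem push_notMem_boundary_of_pos {s : unitInterval} (hs : (0 : ℝ) < s) (p : PuncturedTorus) :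
    push s p ∉ boundary := by
  rw [notMem_boundary_iff]
  exact (min_le_iff.1 p.2).imp (norm_pushCircle_lt hs s.2.2) (norm_pushCircle_lt hs s.2.2)

end PuncturedTorus

namespace Monodromy

open PuncturedTorus

variable (h : Monodromy)

theorem apply_mem_boundary_iff {p : PuncturedTorus} : h.toHomeomorph p ∈ boundary ↔ p ∈ boundary := by
  constructor
  · intro hp
    have h1 := h.toHomeomorph.injective (h.fixes_boundary _ hp)
    rwa [h1] at hp
  · intro hp
    rwa [h.fixes_boundary p hp]

theorem symm_apply_mem_boundary_iff {p : PuncturedTorus} :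
    h.toHomeomorph.symm p ∈ boundary ↔ p ∈ boundary := by
  rw [← h.apply_mem_boundary_iff, Homeomorph.apply_symm_apply]

/-- The push over the point `t` of the base, compatible with the gluing. -/
noncomputable def pushFiber (s t : unitInterval) (p : PuncturedTorus) : PuncturedTorus :=
  h.toHomeomorph.symm (push (s * t) (h.toHomeomorph (push (s * unitInterval.symm t) p)))

theorem continuous_pushFiber : Continuous
    fun q : unitInterval × PuncturedTorus × unitInterval => h.pushFiber q.1 q.2.2 q.2.1 := by
  refine h.toHomeomorph.symm.continuous.comp (continuous_push.comp (Continuous.prodMk ?_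
    (h.toHomeomorph.continuous.comp (continuous_push.comp (Continuous.prodMk ?_ ?_)))))
  all_goals fun_prop

theorem pushFiber_zero_left (t : unitInterval) (p : PuncturedTorus) : h.pushFiber 0 t p = p := by
  simp [pushFiber, push_zero]

/-- At t = 0 only the plain push acts and at t = 1 only its conjugate by h, which is the
compatibility that the gluing demands. -/
theorem pushFiber_glue (s : unitInterval) (p : PuncturedTorus) :
    h.toHomeomorph (h.pushFiber s 1 p) = h.pushFiber s 0 (h.toHomeomorph p) := by
  simp [pushFiber, push_zero]

/-- For every t one of the parameters t and 1 - t is positive; a push with positive parameter enters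
the interior, and none of the maps leaves it. -/
theorem pushFiber_one_notMem_boundary (t : unitInterval) (p : PuncturedTorus) :
    h.pushFiber 1 t p ∉ boundary := by
  rw [pushFiber, symm_apply_mem_boundary_iff, one_mul, one_mul]
  rcases eq_or_lt_of_le t.2.1 with ht | ht
  · refine push_notMem_boundary _ ?_
    rw [apply_mem_boundary_iff]
    refine push_notMem_boundary_of_pos ?_ _
    rw [unitInterval.coe_symm_eq, ← ht]
    norm_num
  · exact push_notMem_boundary_of_pos ht _

/-- The push of the bundle into its interior. -/
noncomputable def pushBundle (s : unitInterval) : PuncturedTorusBundle h → PuncturedTorusBundle h :=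
  Quot.lift (fun p => Quot.mk _ (h.pushFiber s p.2 p.1, p.2)) (by
    rintro _ _ ⟨x⟩
    simp only
    rw [← pushFiber_glue]
    exact Quot.sound (BundleRel.glue _))

theorem continuous_pushBundle : Continuous
    fun q : unitInterval × PuncturedTorusBundle h => h.pushBundle q.1 q.2 := by
  refine (isQuotientMap_quot_mk (r := BundleRel h)).continuous_lift_prod_right ?_
  exact continuous_quot_mk.comp (h.continuous_pushFiber.prodMk
    (continuous_snd.comp continuous_snd))

theorem pushBundle_one_mem (m : PuncturedTorusBundle h) :
    ∃ p : PuncturedTorus × unitInterval, p.1 ∉ boundary ∧ Quot.mk _ p = h.pushBundle 1 m := by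
  induction m using Quot.ind with
  | mk p => exact ⟨(h.pushFiber 1 p.2 p.1, p.2), h.pushFiber_one_notMem_boundary _ _, rfl⟩

theorem pushBundle_zero (m : PuncturedTorusBundle h) : h.pushBundle 0 m = m := by
  induction m using Quot.ind with
  | mk p => exact congrArg (Quot.mk _) (Prod.ext (h.pushFiber_zero_left p.2 p.1) rfl)

/-- The bundle, pushed into its interior. -/
noncomputable def retractInterior : C(PuncturedTorusBundle h, BundleInterior h) where
  toFun m := ⟨h.pushBundle 1 m, h.pushBundle_one_mem m⟩
  continuous_toFun := Continuous.subtype_mk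
    (h.continuous_pushBundle.comp (continuous_const.prodMk continuous_id)) _

/-- The inclusion of the interior. -/
def interiorInclusion : C(BundleInterior h, PuncturedTorusBundle h) :=
  ⟨Subtype.val, continuous_subtype_val⟩

/-- The push is a homotopy. -/
noncomputable def pushHomotopy : ContinuousMap.Homotopy (ContinuousMap.id (PuncturedTorusBundle h))
    (h.interiorInclusion.comp h.retractInterior) where
  toFun q := h.pushBundle q.1 q.2
  continuous_toFun := h.continuous_pushBundle
  map_zero_left := h.pushBundle_zero
  map_one_left _ := rfl

end Monodromy

theorem Path.Homotopic.Quotient.trans_right_cancel {X : Type*} [TopologicalSpace X] {a b c : X}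
    {P Q : Path.Homotopic.Quotient a b} {E : Path.Homotopic.Quotient b c}
    (h : P.trans E = Q.trans E) : P = Q := by
  have h1 := congrArg (fun R => Path.Homotopic.Quotient.trans R E.symm) h
  simpa using h1

/-- A map that is homotopic to the identity is injective on fundamental groups. -/
theorem ContinuousMap.Homotopy.map_injective {X : Type*} [TopologicalSpace X] {g : C(X, X)}
    (F : ContinuousMap.Homotopy (ContinuousMap.id X) g) (x : X) :
    Function.Injective (FundamentalGroup.map g x) := by
  have key : ∀ γ : Path.Homotopic.Quotient x x,
      γ.trans (.mk (F.evalAt x)) = Path.Homotopic.Quotient.trans (.mk (F.evalAt x)) (γ.map g) := by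
    intro γ
    induction γ using Path.Homotopic.Quotient.ind with
    | mk γ => exact Path.Homotopic.Quotient.eq.2 (Path.Homotopic.map_trans_evalAt F γ)
  intro α β hαβ
  refine Path.Homotopic.Quotient.trans_right_cancel ((key α).trans (Eq.trans ?_ (key β).symm))
  exact congrArg (Path.Homotopic.Quotient.trans _) hαβ

/-! ### The fundamental group of a hyperbolic bundle -/

namespace HyperbolicThreeSpace

/-- A lower triangular matrix of determinant one. -/
noncomputable def lowerTriangular (q : ℝ × ℂ) : Matrix (Fin 2) (Fin 2) ℂ :=
  !![(Real.exp (q.1 / 2) : ℂ), 0; star q.2 * (Real.exp (-(q.1 / 2)) : ℂ), (Real.exp (-(q.1 / 2)) : ℂ)]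

theorem exp_mul_exp_neg_half (u : ℝ) : Real.exp (u / 2) * Real.exp (-(u / 2)) = 1 := by
  rw [← Real.exp_add, add_neg_cancel, Real.exp_zero]

theorem det_lowerTriangular (q : ℝ × ℂ) : (lowerTriangular q).det = 1 := by
  rw [lowerTriangular, Matrix.det_fin_two_of, zero_mul, sub_zero, ← Complex.ofReal_mul,
    exp_mul_exp_neg_half, Complex.ofReal_one]

theorem lowerTriangular_mul_conjTranspose (q : ℝ × ℂ) :
    lowerTriangular q * (lowerTriangular q).conjTranspose =
      !![(Real.exp q.1 : ℂ), q.2; star q.2, (1 + q.2 * star q.2) * (Real.exp (-q.1) : ℂ)] := by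
  have h1 : (Real.exp (q.1 / 2) : ℂ) * (Real.exp (q.1 / 2) : ℂ) = Real.exp q.1 := by
    rw [← Complex.ofReal_mul, ← Real.exp_add, add_halves]
  have h2 : (Real.exp (-(q.1 / 2)) : ℂ) * (Real.exp (-(q.1 / 2)) : ℂ) = Real.exp (-q.1) := by
    rw [← Complex.ofReal_mul, ← Real.exp_add]
    congr 2
    ring
  have h3 : (Real.exp (q.1 / 2) : ℂ) * (Real.exp (-(q.1 / 2)) : ℂ) = 1 := by
    rw [← Complex.ofReal_mul, exp_mul_exp_neg_half, Complex.ofReal_one]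
  have hs : ∀ r : ℝ, (starRingEnd ℂ) (r : ℂ) = r := Complex.conj_ofReal
  ext i j
  fin_cases i <;> fin_cases j <;>
    simp [lowerTriangular, Matrix.mul_apply, Fin.sum_univ_two, hs, -Complex.ofReal_exp]
  · exact h1
  · linear_combination q.2 * h3
  · linear_combination (starRingEnd ℂ) q.2 * h3
  · linear_combination (1 + q.2 * (starRingEnd ℂ) q.2) * h2

theorem eq_of_entries {X Y : HyperbolicThreeSpace} (h0 : X.1 0 0 = Y.1 0 0) (h1 : X.1 0 1 = Y.1 0 1) :
    X = Y := by
  have h2 : X.1 1 0 = Y.1 1 0 := by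
    rw [← X.2.1.1.apply 1 0, ← Y.2.1.1.apply 1 0, h1]
  have hpos : X.1 0 0 ≠ 0 := (X.2.1.diag_pos).ne'
  have hX := X.2.2
  have hY := Y.2.2
  rw [Matrix.det_fin_two] at hX hY
  have h3 : X.1 1 1 = Y.1 1 1 := by
    refine mul_left_cancel₀ hpos ?_
    rw [← h0, ← h1, ← h2] at hY
    linear_combination hX - hY
  apply Subtype.ext
  ext i j
  fin_cases i <;> fin_cases j
  exacts [h0, h1, h2, h3]

/-- Hyperbolic space is homeomorphic to `ℝ × ℂ`. -/
noncomputable def homeomorphProd : HyperbolicThreeSpace ≃ₜ ℝ × ℂ where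
  toFun X := (Real.log (X.1 0 0).re, X.1 0 1)
  -- A Cholesky factorization: the first row of a positive definite matrix of determinant one is
  -- arbitrary up to positivity of its first entry, and determines the rest.
  invFun q := ⟨lowerTriangular q * (lowerTriangular q).conjTranspose, by
    have h := Matrix.PosDef.one.mul_mul_conjTranspose_same (B := lowerTriangular q)
      (Matrix.vecMul_injective_of_isUnit
        ((Matrix.isUnit_iff_isUnit_det _).2 (by simp [det_lowerTriangular])))
    rwa [mul_one] at h, by
    rw [Matrix.det_mul, Matrix.det_conjTranspose, det_lowerTriangular]
    simp⟩
  left_inv X := by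
    have hpos := Complex.pos_iff.1 (X.2.1.diag_pos (i := 0))
    apply eq_of_entries
    · simp only [lowerTriangular_mul_conjTranspose]
      simp only [Matrix.of_apply, Matrix.cons_val_zero]
      rw [Real.exp_log hpos.1]
      exact Complex.ext rfl hpos.2
    · simp [lowerTriangular_mul_conjTranspose]
  right_inv q := by
    simp only [lowerTriangular_mul_conjTranspose]
    simp [-Complex.ofReal_exp]
  continuous_toFun := by
    have hc : ∀ i j, Continuous fun X : HyperbolicThreeSpace => X.1 i j := fun i j =>
      continuous_subtype_val.matrix_elem i j
    refine Continuous.prodMk (Continuous.log (Complex.continuous_re.comp (hc 0 0)) ?_) (hc 0 1)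
    intro X
    exact (Complex.pos_iff.1 (X.2.1.diag_pos (i := 0))).1.ne'
  continuous_invFun := by
    refine Continuous.subtype_mk ?_ _
    have hc : Continuous lowerTriangular := by
      refine continuous_matrix fun i j => ?_
      fin_cases i <;> fin_cases j <;> simp [lowerTriangular, -Complex.ofReal_exp] <;> fun_prop
    exact hc.matrix_mul hc.matrix_conjTranspose

instance : LocallyCompactSpace HyperbolicThreeSpace :=
  homeomorphProd.isClosedEmbedding.locallyCompactSpace

instance : ContractibleSpace HyperbolicThreeSpace := homeomorphProd.contractibleSpace

theorem continuous_smul_const (γ : SL(2, ℂ)) : Continuous fun X : HyperbolicThreeSpace => γ • X := by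
  refine Continuous.subtype_mk ?_ _
  exact (continuous_const.matrix_mul continuous_subtype_val).matrix_mul continuous_const

/-- The fundamental group of a hyperbolic manifold is commutative transitive. -/
theorem isCommutativeTransitive_fundamentalGroup (Γ : Subgroup SL(2, ℂ))
    [ProperlyDiscontinuousSMul Γ HyperbolicThreeSpace]
    (hfree : ∀ γ ∈ Γ, ∀ X : HyperbolicThreeSpace, γ • X = X → γ = 1 ∨ γ = -1)
    (y : Quotient (MulAction.orbitRel Γ HyperbolicThreeSpace)) :
    IsCommutativeTransitive (FundamentalGroup _ y) := by
  -- The action of `Γ` need not be free, since -1 acts trivially. Its image in the permutations acts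
  -- freely, and the fundamental group of the quotient embeds in the opposite of that image.
  let Δ := (MulAction.toPermHom Γ HyperbolicThreeSpace).range
  have hneg : ∀ X : HyperbolicThreeSpace, (-1 : SL(2, ℂ)) • X = X := by
    intro X
    apply Subtype.ext
    change (-1 : Matrix (Fin 2) (Fin 2) ℂ) * X.1 * (-1 : Matrix (Fin 2) (Fin 2) ℂ).conjTranspose = X.1
    simp
  have : ContinuousConstSMul Δ HyperbolicThreeSpace := ⟨by
    rintro ⟨_, γ, rfl⟩
    exact continuous_smul_const γ.1⟩
  have : ProperlyDiscontinuousSMul Δ HyperbolicThreeSpace := ⟨by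
    intro K L hK hL
    refine ((ProperlyDiscontinuousSMul.finite_disjoint_inter_image (Γ := Γ) hK hL).image
      (MulAction.toPermHom Γ HyperbolicThreeSpace).rangeRestrict).subset ?_
    rintro ⟨_, γ, rfl⟩ hγ
    exact ⟨γ, hγ, rfl⟩⟩
  have : IsCancelSMul Δ HyperbolicThreeSpace := by
    rw [isCancelSMul_iff_eq_one_of_smul_eq]
    rintro ⟨_, γ, rfl⟩ X hX
    apply Subtype.ext
    refine Equiv.ext fun Y => ?_
    change γ.1 • Y = Y
    rcases hfree γ.1 γ.2 X hX with h | h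
    · rw [h, one_smul]
    · rw [h, hneg]
  have hcov : IsQuotientCoveringMap
      (Quotient.mk (MulAction.orbitRel Γ HyperbolicThreeSpace)) Δ := by
    refine isQuotientMap_quotient_mk'.isQuotientCoveringMap_of_properlyDiscontinuousSMul ?_
    intro X Y
    refine Quotient.eq''.trans ?_
    constructor
    · rintro ⟨γ, hγ⟩
      exact ⟨⟨_, γ, rfl⟩, hγ⟩
    · rintro ⟨⟨_, γ, rfl⟩, hγ⟩
      exact ⟨γ, hγ⟩
  obtain ⟨X, hX⟩ := Quotient.exists_rep y
  exact (isCommutativeTransitive_range_toPermHom Γ hfree).mulOpposite.of_injective _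
    (hcov.fundamentalGroupToMulOpposite_injective ⟨X, hX⟩)

end HyperbolicThreeSpace

theorem IsHyperbolicBundle.isCommutativeTransitive {h : Monodromy} (hh : IsHyperbolicBundle h)
    (m : PuncturedTorusBundle h) :
    IsCommutativeTransitive (FundamentalGroup (PuncturedTorusBundle h) m) := by
  obtain ⟨Γ, hΓ, hfree, ⟨e⟩⟩ := hh
  let f := (ContinuousMap.mk e e.continuous).comp h.retractInterior
  refine (HyperbolicThreeSpace.isCommutativeTransitive_fundamentalGroup Γ hfree (f m)).of_injective
    (FundamentalGroup.map f m) ?_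
  -- The push followed by the inclusion of the interior is homotopic to the identity, so the push
  -- alone is already injective on fundamental groups.
  have hinj := h.pushHomotopy.map_injective m
  let k := h.interiorInclusion.comp (ContinuousMap.mk e.symm e.symm.continuous)
  have hk : k.comp f = h.interiorInclusion.comp h.retractInterior := by
    ext a
    change h.interiorInclusion (e.symm (e (h.retractInterior a))) = _
    rw [e.symm_apply_apply]
    rfl
  rw [← hk] at hinj
  intro α β hαβ
  apply hinj
  change Path.Homotopic.Quotient.map α (k.comp f) = Path.Homotopic.Quotient.map β (k.comp f)
  rw [Path.Homotopic.Quotient.map_comp (f := f) (g := k), Path.Homotopic.Quotient.map_comp (f := f) (g := k)]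
  exact congrArg (fun γ => Path.Homotopic.Quotient.map γ k) hαβ

/-! ### The monodromy of an untwisted bundle -/

namespace F2

/-- Real eigenvalues of the exponent matrix are eigenvalues of the map on the abelianization. -/
theorem hasEigenvalue_baseChange {G : Type*} [Group G] (e : F2 ≃* G) (ψ : G →* G) (φ : F2 →* F2)
    (hφ : ∀ f, e (φ f) = ψ (e f)) {μ : ℝ}
    (hμ : μ ^ 2 - (exponentMatrix φ).trace * μ + (exponentMatrix φ).det = 0) :
    Module.End.HasEigenvalue
      ((MonoidHom.toAdditive (Abelianization.map ψ)).toIntLinearMap.baseChange ℝ) μ := by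
  set A := exponentMatrix φ with hA
  obtain ⟨v, hv0, hv⟩ : ∃ v : Fin 2 → ℝ, v ≠ 0 ∧
      (!![(A 0 0 : ℝ) - μ, A 0 1; A 1 0, A 1 1 - μ]).mulVec v = 0 := by
    rw [Matrix.exists_mulVec_eq_zero_iff, Matrix.det_fin_two_of]
    rw [Matrix.trace_fin_two, Matrix.det_fin_two] at hμ
    push_cast at hμ
    linarith
  have hv1 : A 0 0 * v 0 + A 0 1 * v 1 = μ * v 0 := by
    have := congrFun hv 0
    simp [Matrix.mulVec, dotProduct, Fin.sum_univ_two] at this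
    linarith
  have hv2 : A 1 0 * v 0 + A 1 1 * v 1 = μ * v 1 := by
    have := congrFun hv 1
    simp [Matrix.mulVec, dotProduct, Fin.sum_univ_two] at this
    linarith
  let q : F2 →* Abelianization G := Abelianization.of.comp e.toMonoidHom
  let E : Fin 2 → Additive (Abelianization G) := fun j => Additive.ofMul (q (FreeGroup.of j))
  let L := (MonoidHom.toAdditive (Abelianization.map ψ)).toIntLinearMap
  have hL : ∀ j, L (E j) = A 0 j • E 0 + A 1 j • E 1 := by
    intro j
    have h1 : Abelianization.map ψ (q (FreeGroup.of j)) = q (φ (FreeGroup.of j)) :=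
      congrArg Abelianization.of (hφ (FreeGroup.of j)).symm
    have h2 := h1.trans (hom_apply_eq q (φ (FreeGroup.of j)))
    exact congrArg Additive.ofMul h2
  -- The exponent sums, as real functionals, show that the tensor built from a nonzero vector is
  -- nonzero.
  let l : Fin 2 → (Additive (Abelianization G) →ₗ[ℤ] ℝ) := fun i =>
    (Int.castAddHom ℝ).toIntLinearMap ∘ₗ (AddMonoidHom.toIntLinearMap
      (MonoidHom.toAdditiveLeft (Abelianization.lift ((exponentSum i).comp e.symm.toMonoidHom))))
  have hl : ∀ i j, l i (E j) = if i = j then 1 else 0 := by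
    intro i j
    change (((exponentSum i (e.symm (e (FreeGroup.of j)))).toAdd : ℤ) : ℝ) = _
    rw [e.symm_apply_apply, exponentSum_of]
    push_cast
    rfl
  refine Module.End.hasEigenvalue_of_hasEigenvector
    (x := v 0 ⊗ₜ[ℤ] E 0 + v 1 ⊗ₜ[ℤ] E 1) ⟨?_, ?_⟩
  · rw [Module.End.mem_eigenspace_iff]
    change L.baseChange ℝ _ = _
    rw [map_add, LinearMap.baseChange_tmul, LinearMap.baseChange_tmul, hL, hL]
    simp only [TensorProduct.tmul_add, TensorProduct.tmul_smul, smul_add, TensorProduct.smul_tmul']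
    rw [smul_eq_mul, smul_eq_mul, ← hv1, ← hv2]
    simp only [TensorProduct.add_tmul, zsmul_eq_mul]
    abel
  · intro h0
    apply hv0
    funext i
    have h1 := congrArg ((l i).liftBaseChange ℝ) h0
    rw [map_add, LinearMap.liftBaseChange_tmul, LinearMap.liftBaseChange_tmul, hl, hl, map_zero] at h1
    fin_cases i <;> simpa using h1

/-- The determinant is ±1. Determinant -1, or determinant 1 with trace at most -2, makes the smaller
real root of the characteristic polynomial negative. Traces -1, 0 and 1 survive because they have no
real root. -/
theorem det_eq_one_and_neg_one_le_trace (φ : MulAut F2)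
    (h : ∀ μ : ℝ, μ ^ 2 - (autMatrix φ).trace * μ + (autMatrix φ).det = 0 → 0 < μ) :
    (autMatrix φ).det = 1 ∧ -1 ≤ (autMatrix φ).trace := by
  have hunit : IsUnit (autMatrix φ).det := by
    refine IsUnit.of_mul_eq_one (autMatrix φ⁻¹).det ?_
    rw [← Matrix.det_mul, ← map_mul, mul_inv_cancel, map_one, Matrix.det_one]
  have hquad : ∀ d : ℝ, ((autMatrix φ).det : ℝ) = d → 0 ≤ ((autMatrix φ).trace : ℝ) ^ 2 - 4 * d →
      0 < (autMatrix φ).trace - √(((autMatrix φ).trace : ℝ) ^ 2 - 4 * d) := by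
    intro d hd h0
    have h1 := h (((autMatrix φ).trace - √(((autMatrix φ).trace : ℝ) ^ 2 - 4 * d)) / 2) (by
      have h2 := Real.sq_sqrt h0
      rw [hd]
      linear_combination h2 / 4)
    linarith
  rcases Int.isUnit_iff.1 hunit with hd | hd
  · refine ⟨hd, ?_⟩
    by_contra! ht
    have ht' : ((autMatrix φ).trace : ℝ) ≤ -2 := by
      exact_mod_cast (by omega : (autMatrix φ).trace ≤ -2)
    have h1 := hquad 1 (by rw [hd]; simp) (by nlinarith)
    linarith [Real.sqrt_nonneg (((autMatrix φ).trace : ℝ) ^ 2 - 4 * 1)]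
  · exfalso
    have h1 := hquad (-1) (by rw [hd]; simp) (by nlinarith)
    have h2 : |((autMatrix φ).trace : ℝ)| ≤ √(((autMatrix φ).trace : ℝ) ^ 2 - 4 * (-1)) :=
      Real.abs_le_sqrt (by linarith)
    linarith [le_abs_self ((autMatrix φ).trace : ℝ)]

end F2

/-! ### The monodromy as an automorphism, and the conclusion. -/

theorem monodromyOnPi1_bijective (h : Monodromy) (x : PuncturedTorus)
    (hx : x ∈ PuncturedTorus.boundary) : Function.Bijective (monodromyOnPi1 h x hx) := by
  have hx' : h.toHomeomorph.symm x = x := by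
    rw [Homeomorph.symm_apply_eq, h.fixes_boundary x hx]
  rw [Function.bijective_iff_has_inverse]
  refine ⟨FundamentalGroup.mapOfEq (h.toHomeomorph.symm : C(PuncturedTorus, PuncturedTorus)) hx', ?_, ?_⟩
  · intro γ
    rw [monodromyOnPi1, FundamentalGroup.mapOfEq_apply, FundamentalGroup.mapOfEq_apply]
    induction γ using Path.Homotopic.Quotient.ind with
    | mk γ =>
      refine congrArg Path.Homotopic.Quotient.mk (Path.ext (funext fun s => ?_))
      exact h.toHomeomorph.symm_apply_apply (γ s)
  · intro γ
    rw [monodromyOnPi1, FundamentalGroup.mapOfEq_apply, FundamentalGroup.mapOfEq_apply]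
    induction γ using Path.Homotopic.Quotient.ind with
    | mk γ =>
      refine congrArg Path.Homotopic.Quotient.mk (Path.ext (funext fun s => ?_))
      exact h.toHomeomorph.apply_symm_apply (γ s)
theorem theorem1p4 (h : Monodromy) (hhyp : IsHyperbolicBundle h)
    (x : PuncturedTorus) (hx : x ∈ PuncturedTorus.boundary) (hunt : IsUntwisted h x hx) :
    ∃ lt : FundamentalGroup (PuncturedTorusBundle h) (fiberInclusion h x) →
        FundamentalGroup (PuncturedTorusBundle h) (fiberInclusion h x) → Prop,
      IsBiOrder lt ∧
      ¬ IsStandardBiOrder (restrictOrder lt (fiberGroup h x)) ∧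
      ¬ IsConvexSubgroup (restrictOrder lt (fiberGroup h x)) (lcs (fiberGroup h x) 2) := by
  obtain ⟨e⟩ := PuncturedTorus.nonempty_mulEquiv_fundamentalGroup x
  let ψ := MulEquiv.ofBijective _ (monodromyOnPi1_bijective h x hx)
  let φ : MulAut F2 := (e.trans ψ).trans e.symm
  have hφ : ∀ f, e (φ f) = monodromyOnPi1 h x hx (e f) := fun f => e.apply_symm_apply _
  obtain ⟨hdet, htr⟩ := F2.det_eq_one_and_neg_one_le_trace φ fun μ hμ =>
    hunt μ (F2.hasEigenvalue_baseChange e _ φ.toMonoidHom hφ hμ)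
  obtain ⟨p, t, hinj, hker, ht, hconj⟩ := exists_fundamentalGroup_extension h x hx
  let i := (FundamentalGroup.map (fiberInclusion h) x).comp e.toMonoidHom
  have hi : Function.Injective i := hinj.comp e.injective
  have hrange : i.range = fiberGroup h x := by
    rw [MonoidHom.range_comp, MonoidHom.range_eq_top.2 e.surjective, ← MonoidHom.range_eq_map]
    rfl
  have hti : ∀ f, t * i f * t⁻¹ = i (φ f) := by
    intro f
    change _ = FundamentalGroup.map (fiberInclusion h) x (e (φ f))
    rw [hφ, ← hconj]
    rfl
  have hpi : ∀ f, p (i f) = 1 := by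
    intro f
    rw [← MonoidHom.mem_ker, hker, ← hrange]
    exact ⟨f, rfl⟩
  -- The only use of hyperbolicity: it raises the lower bound on the trace from -1 to 3.
  have htr3 := F2.three_le_trace (hhyp.isCommutativeTransitive _) i hi p hpi t ht φ hti hdet htr
  obtain ⟨u, hu⟩ := F2.exists_map_commutator_eq φ hdet
  obtain ⟨P, hP, hφP, hc, hw⟩ := F2.exists_nonstandard_cone φ.toMonoidHom hdet htr3 u hu
  exact exists_nonstandard_biOrder_of_extension i hi _ hrange p hker t ht φ.toMonoidHom hti P hP hφP hc hw
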